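/- Let $S=(-a,a)$ with $0<a<\infty$, or $S=\mathbb R$, and let $\Omega=\mathbb R\times S$. Let $W\in L^1_{\rm loc}(S)$ be real-valued with $W(y)\ge c\,y^2$ for all $y\in S$, for some constant $c\ge 0$, where $c>0$ if $S=\mathbb R$. Let $U\in L^\infty(\Omega)$ be real-valued with $$\lim_{|x|\to\infty}\ \sup_{y\in S}|U(x,y)|=0$$ (suprema being understood up to null sets). For $B\in\mathbb R$ let $$H_U(B)=H_0(B)+U,\qquad H_0(B)=(-i\partial_x-By)^2-\partial_y^2+W(y),$$ act in $L^2(\Omega)$, with Dirichlet conditions on $\partial\Omega$ if $S=(-a,a)$; that is, $H_0(B)$ is the self-adjoint operator associated with the closure of the quadratic form $\varphi\mapsto\|(-i\partial_x-By)\varphi\|^2+\|\partial_y\varphi\|^2+\|W^{1/2}\varphi\|^2$ on $C_0^\infty(\Omega)$. If $U$ is purely attractive, i.e. $U\le 0$ a.e. in $\Omega$ and $U$ is not a.e. equal to $0$, then for every $B\in\mathbb R$ the discrete spectrum of $H_U(B)$ (the set of isolated points of its spectrum that are eigenvalues of finite multiplicity) is non-empty. -/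

import Mathlib

open MeasureTheory
open scoped ContDiff

namespace QuantumWire

noncomputable section

/-! ### Spectral notions for unbounded operators -/

section Spectrum

variable {H : Type*} [NormedAddCommGroup H] [InnerProductSpace ℂ H]

/-- The resolvent set of an unbounded operator `T`: the complex numbers `z` for which `T - z` has
an everywhere defined bounded two-sided inverse `R`. -/
def resolventSet (T : H →ₗ.[ℂ] H) : Set ℂ :=
  {z | ∃ R : H →L[ℂ] H,
    (∀ f : H, ∃ h : R f ∈ T.domain, T ⟨R f, h⟩ - z • R f = f) ∧
    ∀ ψ : T.domain, R (T ψ - z • (ψ : H)) = ψ}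

/-- The spectrum of an unbounded operator. -/
def spectrum (T : H →ₗ.[ℂ] H) : Set ℂ := (resolventSet T)ᶜ

/-- The eigenspace `Ker (T - z)` of an unbounded operator. -/
def eigenspace (T : H →ₗ.[ℂ] H) (z : ℂ) : Submodule ℂ H where
  carrier := {ψ | ∃ h : ψ ∈ T.domain, T ⟨ψ, h⟩ = z • ψ}
  zero_mem' := ⟨T.domain.zero_mem, by
    rw [smul_zero]
    exact T.map_zero⟩
  add_mem' := by
    rintro a b ⟨ha, ha'⟩ ⟨hb, hb'⟩
    refine ⟨T.domain.add_mem ha hb, ?_⟩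
    rw [smul_add, ← ha', ← hb', ← T.map_add]
    rfl
  smul_mem' := by
    rintro c a ⟨ha, ha'⟩
    refine ⟨T.domain.smul_mem c ha, ?_⟩
    rw [smul_comm, ← ha', ← T.map_smul]
    rfl

/-- The discrete spectrum of a (self-adjoint) operator: the isolated points of the spectrum that
are eigenvalues of finite multiplicity. -/
def discreteSpectrum (T : H →ₗ.[ℂ] H) : Set ℂ :=
  {z | z ∈ spectrum T ∧ (∃ ε > 0, ∀ w ∈ spectrum T, dist w z < ε → w = z) ∧
    eigenspace T z ≠ ⊥ ∧ FiniteDimensional ℂ (eigenspace T z)}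

end Spectrum

/-! ### The Hamiltonian of the wire -/

/-- The strip `Ω = ℝ × S`. -/
def strip (S : Set ℝ) : Set (ℝ × ℝ) := Set.univ ×ˢ S

/-- The Lebesgue measure on the strip. -/
abbrev stripMeasure (S : Set ℝ) : Measure (ℝ × ℝ) := volume.restrict (strip S)

/-- The state space `L²(Ω)`. -/
abbrev StateSpace (S : Set ℝ) : Type := Lp ℂ 2 (stripMeasure S)

/-- The test functions `C₀^∞(Ω)`. -/
structure IsTest (S : Set ℝ) (φ : ℝ × ℝ → ℂ) : Prop where
  smooth : ContDiff ℝ ∞ φ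
  compact : HasCompactSupport φ
  supp : tsupport φ ⊆ strip S

/-- The longitudinal magnetic derivative `(-i ∂ₓ - B y) φ`. -/
def magDeriv (B : ℝ) (φ : ℝ × ℝ → ℂ) (z : ℝ × ℝ) : ℂ :=
  -Complex.I * fderiv ℝ φ z (1, 0) - (B * z.2 : ℝ) * φ z

/-- The transverse derivative `∂_y φ`. -/
def transDeriv (φ : ℝ × ℝ → ℂ) (z : ℝ × ℝ) : ℂ := fderiv ℝ φ z (0, 1)

/-- `W^{1/2} φ`, for the lateral confinement `W ≥ 0`. -/
def sqrtMul (W : ℝ → ℝ) (φ : ℝ × ℝ → ℂ) (z : ℝ × ℝ) : ℂ := (√(W z.2) : ℝ) * φ z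

/-- The quadruples `(φ, (-i ∂ₓ - B y) φ, ∂_y φ, W^{1/2} φ)` in `L²(Ω)⁴`, where `φ` runs through the
test functions on `Ω`. -/
def formCore (S : Set ℝ) (W : ℝ → ℝ) (B : ℝ) :
    Submodule ℂ (StateSpace S × StateSpace S × StateSpace S × StateSpace S) where
  carrier := {Φ | ∃ φ, IsTest S φ ∧ Φ.1 =ᵐ[stripMeasure S] φ ∧
    Φ.2.1 =ᵐ[stripMeasure S] magDeriv B φ ∧ Φ.2.2.1 =ᵐ[stripMeasure S] transDeriv φ ∧
    Φ.2.2.2 =ᵐ[stripMeasure S] sqrtMul W φ}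
  zero_mem' := by
    have h0 := Lp.coeFn_zero ℂ 2 (stripMeasure S)
    refine ⟨0, ⟨contDiff_const, HasCompactSupport.zero, by simp [tsupport]⟩, h0, ?_, ?_, ?_⟩
    all_goals
      filter_upwards [h0] with z hz
      exact hz.trans (by simp [magDeriv, transDeriv, sqrtMul])
  add_mem' := by
    rintro Φ Ψ ⟨φ, hφ, h1, h2, h3, h4⟩ ⟨ψ, hψ, k1, k2, k3, k4⟩
    have dφ : Differentiable ℝ φ := hφ.smooth.differentiable (by simp)
    have dψ : Differentiable ℝ ψ := hψ.smooth.differentiable (by simp)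
    refine ⟨φ + ψ, ⟨hφ.smooth.add hψ.smooth, hφ.compact.add hψ.compact,
      (tsupport_add φ ψ).trans (Set.union_subset hφ.supp hψ.supp)⟩, ?_, ?_, ?_, ?_⟩
    · filter_upwards [h1, k1, Lp.coeFn_add Φ.1 Ψ.1] with z a b c
      rw [Prod.fst_add, c, Pi.add_apply, Pi.add_apply, a, b]
    · filter_upwards [h2, k2, Lp.coeFn_add Φ.2.1 Ψ.2.1] with z a b c
      simp only [Prod.fst_add, Prod.snd_add, c, Pi.add_apply, a, b, magDeriv,
        fderiv_add (dφ z) (dψ z), add_apply]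
      ring
    · filter_upwards [h3, k3, Lp.coeFn_add Φ.2.2.1 Ψ.2.2.1] with z a b c
      simp only [Prod.fst_add, Prod.snd_add, c, Pi.add_apply, a, b, transDeriv,
        fderiv_add (dφ z) (dψ z), add_apply]
    · filter_upwards [h4, k4, Lp.coeFn_add Φ.2.2.2 Ψ.2.2.2] with z a b c
      simp only [Prod.snd_add, c, Pi.add_apply, a, b, sqrtMul]
      ring
  smul_mem' := by
    rintro t Φ ⟨φ, hφ, h1, h2, h3, h4⟩
    have dφ : Differentiable ℝ φ := hφ.smooth.differentiable (by simp)
    refine ⟨t • φ, ⟨hφ.smooth.const_smul t, hφ.compact.smul_left (f := fun _ => t),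
      (tsupport_smul_subset_right (fun _ => t) φ).trans hφ.supp⟩, ?_, ?_, ?_, ?_⟩
    · filter_upwards [h1, Lp.coeFn_smul t Φ.1] with z a c
      simp [c, a]
    · filter_upwards [h2, Lp.coeFn_smul t Φ.2.1] with z a c
      simp only [Prod.smul_fst, Prod.smul_snd, c, Pi.smul_apply, a, magDeriv,
        fderiv_const_smul (dφ z) t, smul_apply, smul_eq_mul]
      ring
    · filter_upwards [h3, Lp.coeFn_smul t Φ.2.2.1] with z a c
      simp only [Prod.smul_fst, Prod.smul_snd, c, Pi.smul_apply, a, transDeriv,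
        fderiv_const_smul (dφ z) t, smul_apply, smul_eq_mul]
    · filter_upwards [h4, Lp.coeFn_smul t Φ.2.2.2] with z a c
      simp only [Prod.smul_snd, c, Pi.smul_apply, a, sqrtMul, smul_eq_mul]
      ring

/-- The graph of `H₀(B)`. The closure of `formCore` consists of the quadruples
`(ψ, (-i ∂ₓ - B y) ψ, ∂_y ψ, W^{1/2} ψ)` with `ψ` in the form domain, that is in the completion of
`C₀^∞(Ω)` for the form norm (so that `ψ` vanishes on the boundary of `Ω`). The pair `(ψ, f)` is in
the graph if `ψ` is in the form domain and
`((-i ∂ₓ - B y) φ, (-i ∂ₓ - B y) ψ) + (∂_y φ, ∂_y ψ) + (W^{1/2} φ, W^{1/2} ψ) = (φ, f)`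
for all test functions `φ`. -/
def freeGraph (S : Set ℝ) (W : ℝ → ℝ) (B : ℝ) : Submodule ℂ (StateSpace S × StateSpace S) where
  carrier := {p | ∃ Ψ ∈ (formCore S W B).topologicalClosure, Ψ.1 = p.1 ∧
    ∀ Φ ∈ formCore S W B, inner ℂ Φ.2.1 Ψ.2.1 + inner ℂ Φ.2.2.1 Ψ.2.2.1
      + inner ℂ Φ.2.2.2 Ψ.2.2.2 = inner ℂ Φ.1 p.2}
  zero_mem' := ⟨0, Submodule.zero_mem _, rfl, by simp⟩
  add_mem' := by
    rintro p q ⟨Ψ, hΨ, h1, h2⟩ ⟨Ξ, hΞ, k1, k2⟩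
    refine ⟨Ψ + Ξ, Submodule.add_mem _ hΨ hΞ, by simp [h1, k1], fun Φ hΦ => ?_⟩
    simp only [Prod.fst_add, Prod.snd_add, inner_add_right, ← h2 Φ hΦ, ← k2 Φ hΦ]
    ring
  smul_mem' := by
    rintro t p ⟨Ψ, hΨ, h1, h2⟩
    refine ⟨t • Ψ, Submodule.smul_mem _ t hΨ, by simp [h1], fun Φ hΦ => ?_⟩
    simp only [Prod.smul_fst, Prod.smul_snd, inner_smul_right, ← h2 Φ hΦ]
    ring

section WellDefined

variable {S : Set ℝ} {W : ℝ → ℝ} {B : ℝ}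

theorem isOpen_strip (hS : IsOpen S) : IsOpen (strip S) := isOpen_univ.prod hS

theorem IsTest.continuous_magDeriv {φ : ℝ × ℝ → ℂ} (hφ : IsTest S φ) :
    Continuous (magDeriv B φ) := by
  have h := hφ.smooth.continuous_fderiv (by simp)
  have h' := hφ.smooth.continuous
  unfold magDeriv
  fun_prop

theorem IsTest.continuous_transDeriv {φ : ℝ × ℝ → ℂ} (hφ : IsTest S φ) :
    Continuous (transDeriv φ) := by
  have h := hφ.smooth.continuous_fderiv (by simp)
  unfold transDeriv
  fun_prop

theorem IsTest.compact_magDeriv {φ : ℝ × ℝ → ℂ} (hφ : IsTest S φ) :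
    HasCompactSupport (magDeriv B φ) := by
  refine hφ.compact.mono' fun z hz => ?_
  by_contra h
  have h1 := image_eq_zero_of_notMem_tsupport h
  have h2 : fderiv ℝ φ z = 0 :=
    image_eq_zero_of_notMem_tsupport fun h' => h (tsupport_fderiv_subset ℝ h')
  exact hz (by simp [magDeriv, h1, h2])

theorem IsTest.compact_transDeriv {φ : ℝ × ℝ → ℂ} (hφ : IsTest S φ) :
    HasCompactSupport (transDeriv φ) := by
  refine hφ.compact.mono' fun z hz => ?_
  by_contra h
  have h2 : fderiv ℝ φ z = 0 :=
    image_eq_zero_of_notMem_tsupport fun h' => h (tsupport_fderiv_subset ℝ h')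
  exact hz (by simp [transDeriv, h2])

theorem IsTest.memLp_sqrtMul (hW : LocallyIntegrableOn W S volume) {φ : ℝ × ℝ → ℂ}
    (hφ : IsTest S φ) : MemLp (sqrtMul W φ) 2 (stripMeasure S) := by
  set K := tsupport φ with hK
  have cK : IsCompact K := hφ.compact
  set K1 := Prod.fst '' K
  set K2 := Prod.snd '' K
  have c1 : IsCompact K1 := cK.image continuous_fst
  have c2 : IsCompact K2 := cK.image continuous_snd
  have hK2 : K2 ⊆ S := by
    rintro _ ⟨z, hz, rfl⟩
    exact (hφ.supp hz).2
  have iW : IntegrableOn W K2 volume := hW.integrableOn_compact_subset hK2 c2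
  have : IsFiniteMeasure ((volume : Measure ℝ).restrict K1) :=
    isFiniteMeasure_restrict.2 c1.measure_lt_top.ne
  have iW2 : Integrable (fun z : ℝ × ℝ => W z.2)
      (((volume : Measure ℝ).restrict K1).prod ((volume : Measure ℝ).restrict K2)) :=
    Integrable.comp_snd iW _
  rw [Measure.prod_restrict] at iW2
  have iW3 : MemLp (fun z : ℝ × ℝ => √(W z.2)) 2 (volume.restrict (K1 ×ˢ K2)) := by
    have m : AEStronglyMeasurable (fun z : ℝ × ℝ => √(W z.2)) (volume.restrict (K1 ×ˢ K2)) :=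
      Real.continuous_sqrt.comp_aestronglyMeasurable iW2.1
    rw [memLp_two_iff_integrable_sq m]
    refine Integrable.mono' iW2.norm (m.pow 2) (Filter.Eventually.of_forall fun z => ?_)
    rw [Real.norm_eq_abs, abs_of_nonneg (sq_nonneg _), Real.norm_eq_abs]
    rcases le_total 0 (W z.2) with h | h
    · rw [Real.sq_sqrt h]
      exact le_abs_self _
    · rw [Real.sqrt_eq_zero_of_nonpos h]
      simp
  obtain ⟨C, hC⟩ := hφ.smooth.continuous.bounded_above_of_compact_support hφ.compact
  have mφ : AEStronglyMeasurable φ (volume.restrict (K1 ×ˢ K2)) :=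
    hφ.smooth.continuous.aestronglyMeasurable
  have i4 : MemLp (sqrtMul W φ) 2 (volume.restrict (K1 ×ˢ K2)) := by
    refine MemLp.of_le_mul (c := C) iW3
      ((Complex.continuous_ofReal.comp_aestronglyMeasurable iW3.1).mul mφ)
      (Filter.Eventually.of_forall fun z => ?_)
    simp only [sqrtMul, norm_mul, Complex.norm_real]
    rw [mul_comm]
    exact mul_le_mul_of_nonneg_right (hC z) (norm_nonneg _)
  have mK : MeasurableSet (K1 ×ˢ K2) := c1.measurableSet.prod c2.measurableSet
  have i5 : MemLp (sqrtMul W φ) 2 volume := by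
    rw [← memLp_indicator_iff_restrict mK] at i4
    have hi : (K1 ×ˢ K2).indicator (sqrtMul W φ) = sqrtMul W φ := by
      rw [Set.indicator_eq_self]
      intro z hz
      have hz' : φ z ≠ 0 := fun h => hz (by simp [sqrtMul, h])
      have : z ∈ K := subset_tsupport _ hz'
      exact ⟨⟨z, this, rfl⟩, ⟨z, this, rfl⟩⟩
    rwa [hi] at i4
  exact i5.mono_measure Measure.restrict_le_self

/-- Every test function gives an element of the form core. -/
theorem IsTest.exists_mem_formCore (hW : LocallyIntegrableOn W S volume) {φ : ℝ × ℝ → ℂ}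
    (hφ : IsTest S φ) : ∃ Φ ∈ formCore S W B, Φ.1 =ᵐ[stripMeasure S] φ := by
  have h1 : MemLp φ 2 (stripMeasure S) :=
    (hφ.smooth.continuous.memLp_of_hasCompactSupport hφ.compact).mono_measure
      Measure.restrict_le_self
  have h2 : MemLp (magDeriv B φ) 2 (stripMeasure S) :=
    (hφ.continuous_magDeriv.memLp_of_hasCompactSupport hφ.compact_magDeriv).mono_measure
      Measure.restrict_le_self
  have h3 : MemLp (transDeriv φ) 2 (stripMeasure S) :=
    (hφ.continuous_transDeriv.memLp_of_hasCompactSupport hφ.compact_transDeriv).mono_measure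
      Measure.restrict_le_self
  have h4 := hφ.memLp_sqrtMul hW
  exact ⟨(h1.toLp, h2.toLp, h3.toLp, h4.toLp), ⟨φ, hφ, h1.coeFn_toLp, h2.coeFn_toLp,
    h3.coeFn_toLp, h4.coeFn_toLp⟩, h1.coeFn_toLp⟩

/-- Test functions are total in `L²(Ω)`. -/
theorem eq_zero_of_inner_formCore (hS : IsOpen S) (hW : LocallyIntegrableOn W S volume)
    {f : StateSpace S} (hf : ∀ Φ ∈ formCore S W B, inner ℂ Φ.1 f = 0) : f = 0 := by
  have hΩ := isOpen_strip hS
  have hloc : LocallyIntegrableOn f (strip S) volume :=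
    locallyIntegrableOn_of_locallyIntegrable_restrict
      ((Lp.memLp f).locallyIntegrable one_le_two)
  have key := hΩ.ae_eq_zero_of_integral_contDiff_smul_eq_zero hloc (fun g h1 h2 h3 => by
    have ht : IsTest S (fun z => (g z : ℂ)) :=
      ⟨Complex.ofRealCLM.contDiff.comp h1, h2.comp_left Complex.ofReal_zero,
        (tsupport_comp_subset Complex.ofReal_zero g).trans h3⟩
    obtain ⟨Φ, hΦ, hΦ1⟩ := ht.exists_mem_formCore (B := B) hW
    have h := hf Φ hΦ
    rw [L2.inner_def] at h
    have e : ∫ z in strip S, inner ℂ (Φ.1 z) (f z) = ∫ z in strip S, g z • f z := by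
      refine integral_congr_ae ?_
      filter_upwards [hΦ1] with z hz
      rw [hz]
      simp [mul_comm]
    rw [e] at h
    rw [← h]
    refine (setIntegral_eq_integral_of_forall_compl_eq_zero fun z hz => ?_).symm
    rw [image_eq_zero_of_notMem_tsupport fun h' => hz (h3 h'), zero_smul])
  apply Lp.ext
  rw [← ae_restrict_iff' hΩ.measurableSet] at key
  filter_upwards [key, Lp.coeFn_zero ℂ 2 (stripMeasure S)] with z a b
  rw [a, b]
  rfl

/-- Integration by parts for test functions. -/
theorem integral_conj_mul_fderiv {φ χ : ℝ × ℝ → ℂ} (hφ : IsTest S φ) (hχ : IsTest S χ)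
    (v : ℝ × ℝ) :
    ∫ z in strip S, (starRingEnd ℂ) (φ z) * fderiv ℝ χ z v
      = -∫ z in strip S, (starRingEnd ℂ) (fderiv ℝ φ z v) * χ z := by
  have dφ : Differentiable ℝ φ := hφ.smooth.differentiable (by simp)
  have dχ : Differentiable ℝ χ := hχ.smooth.differentiable (by simp)
  have cφ := hφ.smooth.continuous
  have cχ := hχ.smooth.continuous
  have cφ' := hφ.smooth.continuous_fderiv (by simp)
  have cχ' := hχ.smooth.continuous_fderiv (by simp)
  have hd : ∀ z, HasFDerivAt (fun z => (starRingEnd ℂ) (φ z))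
      ((Complex.conjCLE : ℂ →L[ℝ] ℂ).comp (fderiv ℝ φ z)) z := fun z =>
    (Complex.conjCLE : ℂ →L[ℝ] ℂ).hasFDerivAt.comp z (dφ z).hasFDerivAt
  have hd' : ∀ z, fderiv ℝ (fun z => (starRingEnd ℂ) (φ z)) z v
      = (starRingEnd ℂ) (fderiv ℝ φ z v) := fun z => by
    rw [(hd z).fderiv]
    rfl
  have hout : ∀ z, z ∉ strip S → χ z = 0 := fun z hz =>
    image_eq_zero_of_notMem_tsupport fun h' => hz (hχ.supp h')
  have hout' : ∀ z, z ∉ strip S → φ z = 0 := fun z hz =>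
    image_eq_zero_of_notMem_tsupport fun h' => hz (hφ.supp h')
  rw [setIntegral_eq_integral_of_forall_compl_eq_zero (fun z hz => by simp [hout' z hz]),
    setIntegral_eq_integral_of_forall_compl_eq_zero (fun z hz => by simp [hout z hz])]
  simp only [← hd']
  apply integral_mul_fderiv_eq_neg_fderiv_mul_of_integrable
  · simp only [hd']
    refine Continuous.integrable_of_hasCompactSupport (by fun_prop) hχ.compact.mul_left
  · refine Continuous.integrable_of_hasCompactSupport (by fun_prop) ?_
    exact HasCompactSupport.mul_right (hφ.compact.comp_left (map_zero _))
  · refine Continuous.integrable_of_hasCompactSupport (by fun_prop) hχ.compact.mul_left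
  · exact fun z _ => (hd z).differentiableAt
  · exact fun z _ => dχ z

theorem inner_magDeriv {Φ X : StateSpace S × StateSpace S × StateSpace S × StateSpace S}
    (hΦ : Φ ∈ formCore S W B) (hX : X ∈ formCore S W B) :
    inner ℂ Φ.1 X.2.1 = inner ℂ Φ.2.1 X.1 := by
  obtain ⟨φ, hφ, h1, h2, -, -⟩ := hΦ
  obtain ⟨χ, hχ, k1, k2, -, -⟩ := hX
  have cφ := hφ.smooth.continuous
  have cχ := hχ.smooth.continuous
  have cφ' := hφ.smooth.continuous_fderiv (by simp)
  have cχ' := hχ.smooth.continuous_fderiv (by simp)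
  have ip := integral_conj_mul_fderiv hφ hχ (1, 0)
  have i1 : Integrable (fun z => (starRingEnd ℂ) (φ z) * fderiv ℝ χ z (1, 0))
      (stripMeasure S) := by
    refine (Continuous.integrable_of_hasCompactSupport (by fun_prop) ?_).restrict
    exact HasCompactSupport.mul_right (hφ.compact.comp_left (map_zero _))
  have i2 : Integrable (fun z => (starRingEnd ℂ) (fderiv ℝ φ z (1, 0)) * χ z)
      (stripMeasure S) :=
    (Continuous.integrable_of_hasCompactSupport (by fun_prop) hχ.compact.mul_left).restrict
  have i3 : Integrable (fun z : ℝ × ℝ => (B * z.2 : ℝ) * ((starRingEnd ℂ) (φ z) * χ z))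
      (stripMeasure S) :=
    (Continuous.integrable_of_hasCompactSupport (by fun_prop)
      hχ.compact.mul_left.mul_left).restrict
  rw [L2.inner_def, L2.inner_def]
  have e1 : ∫ z in strip S, inner ℂ (Φ.1 z) (X.2.1 z)
      = ∫ z in strip S, (-Complex.I * ((starRingEnd ℂ) (φ z) * fderiv ℝ χ z (1, 0))
        - (B * z.2 : ℝ) * ((starRingEnd ℂ) (φ z) * χ z)) := by
    refine integral_congr_ae ?_
    filter_upwards [h1, k2] with z a b
    rw [a, b, RCLike.inner_apply, magDeriv]
    ring
  have e2 : ∫ z in strip S, inner ℂ (Φ.2.1 z) (X.1 z)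
      = ∫ z in strip S, (Complex.I * ((starRingEnd ℂ) (fderiv ℝ φ z (1, 0)) * χ z)
        - (B * z.2 : ℝ) * ((starRingEnd ℂ) (φ z) * χ z)) := by
    refine integral_congr_ae ?_
    filter_upwards [h2, k1] with z a b
    rw [a, b, RCLike.inner_apply, magDeriv]
    simp only [map_sub, map_mul, map_neg, Complex.conj_I, Complex.conj_ofReal]
    ring
  rw [e1, e2, integral_sub (i1.const_mul _) i3, integral_sub (i2.const_mul _) i3,
    integral_const_mul, integral_const_mul, ip]
  ring

theorem inner_transDeriv {Φ X : StateSpace S × StateSpace S × StateSpace S × StateSpace S}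
    (hΦ : Φ ∈ formCore S W B) (hX : X ∈ formCore S W B) :
    inner ℂ Φ.1 X.2.2.1 = -inner ℂ Φ.2.2.1 X.1 := by
  obtain ⟨φ, hφ, h1, -, h2, -⟩ := hΦ
  obtain ⟨χ, hχ, k1, -, k2, -⟩ := hX
  have ip := integral_conj_mul_fderiv hφ hχ (0, 1)
  rw [L2.inner_def, L2.inner_def]
  have e1 : ∫ z in strip S, inner ℂ (Φ.1 z) (X.2.2.1 z)
      = ∫ z in strip S, (starRingEnd ℂ) (φ z) * fderiv ℝ χ z (0, 1) := by
    refine integral_congr_ae ?_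
    filter_upwards [h1, k2] with z a b
    rw [a, b, RCLike.inner_apply, transDeriv, mul_comm]
  have e2 : ∫ z in strip S, inner ℂ (Φ.2.2.1 z) (X.1 z)
      = ∫ z in strip S, (starRingEnd ℂ) (fderiv ℝ φ z (0, 1)) * χ z := by
    refine integral_congr_ae ?_
    filter_upwards [h2, k1] with z a b
    rw [a, b, RCLike.inner_apply, transDeriv, mul_comm]
  rw [e1, e2, ip]

theorem inner_sqrtMul {Φ X : StateSpace S × StateSpace S × StateSpace S × StateSpace S}
    (hΦ : Φ ∈ formCore S W B) (hX : X ∈ formCore S W B) :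
    inner ℂ Φ.1 X.2.2.2 = inner ℂ Φ.2.2.2 X.1 := by
  obtain ⟨φ, hφ, h1, -, -, h2⟩ := hΦ
  obtain ⟨χ, hχ, k1, -, -, k2⟩ := hX
  rw [L2.inner_def, L2.inner_def]
  refine integral_congr_ae ?_
  filter_upwards [h1, k2, h2, k1] with z a b c d
  rw [a, b, c, d, RCLike.inner_apply, RCLike.inner_apply, sqrtMul, sqrtMul, map_mul,
    Complex.conj_ofReal]
  ring

/-- The quadratic form is closable: an element of the closure of the form core is determined by
its first component. -/
theorem closure_formCore_eq_zero (hS : IsOpen S) (hW : LocallyIntegrableOn W S volume)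
    {Ψ : StateSpace S × StateSpace S × StateSpace S × StateSpace S}
    (hΨ : Ψ ∈ (formCore S W B).topologicalClosure) (h0 : Ψ.1 = 0) : Ψ = 0 := by
  have key : ∀ Φ ∈ formCore S W B, inner ℂ Φ.1 Ψ.2.1 = inner ℂ Φ.2.1 Ψ.1 ∧
      inner ℂ Φ.1 Ψ.2.2.1 = -inner ℂ Φ.2.2.1 Ψ.1 ∧
      inner ℂ Φ.1 Ψ.2.2.2 = inner ℂ Φ.2.2.2 Ψ.1 := by
    intro Φ hΦ
    have hΨ' : Ψ ∈ closure (formCore S W B : Set (StateSpace S × StateSpace S × StateSpace S ×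
        StateSpace S)) := hΨ
    refine closure_minimal (t := {Ψ : StateSpace S × StateSpace S × StateSpace S × StateSpace S |
        inner ℂ Φ.1 Ψ.2.1 = inner ℂ Φ.2.1 Ψ.1 ∧
        inner ℂ Φ.1 Ψ.2.2.1 = -inner ℂ Φ.2.2.1 Ψ.1 ∧
        inner ℂ Φ.1 Ψ.2.2.2 = inner ℂ Φ.2.2.2 Ψ.1})
      (fun X hX => ⟨inner_magDeriv hΦ hX, inner_transDeriv hΦ hX, inner_sqrtMul hΦ hX⟩) ?_ hΨ'
    refine (isClosed_eq ?_ ?_).inter ((isClosed_eq ?_ ?_).inter (isClosed_eq ?_ ?_)) <;> fun_prop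
  simp only [h0, inner_zero_right, neg_zero] at key
  have h1 : Ψ.2.1 = 0 := eq_zero_of_inner_formCore (B := B) hS hW fun Φ hΦ => (key Φ hΦ).1
  have h2 : Ψ.2.2.1 = 0 := eq_zero_of_inner_formCore (B := B) hS hW fun Φ hΦ => (key Φ hΦ).2.1
  have h3 : Ψ.2.2.2 = 0 := eq_zero_of_inner_formCore (B := B) hS hW fun Φ hΦ => (key Φ hΦ).2.2
  exact Prod.ext h0 (Prod.ext h1 (Prod.ext h2 h3))

theorem freeGraph_single_valued (hS : IsOpen S) (hW : LocallyIntegrableOn W S volume)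
    (p : StateSpace S × StateSpace S) (hp : p ∈ freeGraph S W B) (h0 : p.1 = 0) : p.2 = 0 := by
  obtain ⟨Ψ, hΨ, h1, h2⟩ := hp
  have hz := closure_formCore_eq_zero hS hW hΨ (h1.trans h0)
  refine eq_zero_of_inner_formCore (B := B) hS hW fun Φ hΦ => ?_
  rw [← h2 Φ hΦ, hz]
  simp

end WellDefined

/-- The operator `H₀(B) = (-i ∂ₓ - B y)² - ∂_y² + W(y)` on `L²(Ω)` with Dirichlet boundary
conditions (if `S` has boundary points), the self-adjoint operator associated with the closure of
its quadratic form on `C₀^∞(Ω)`. See `freeHamiltonian_graph`. -/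
def freeHamiltonian (S : Set ℝ) (W : ℝ → ℝ) (B : ℝ) : StateSpace S →ₗ.[ℂ] StateSpace S :=
  (freeGraph S W B).toLinearPMap

theorem freeHamiltonian_graph {S : Set ℝ} {W : ℝ → ℝ} {B : ℝ} (hS : IsOpen S)
    (hW : LocallyIntegrableOn W S volume) :
    (freeHamiltonian S W B).graph = freeGraph S W B :=
  Submodule.toLinearPMap_graph_eq _ (freeGraph_single_valued hS hW)

/-- Multiplication by a real function `U ∈ L^∞(Ω)` on `L²(Ω)`. -/
def mulOp {S : Set ℝ} (U : Lp ℝ ⊤ (stripMeasure S)) : StateSpace S →ₗ[ℂ] StateSpace S where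
  toFun ψ := U • ψ
  map_add' ψ χ := Lp.add_smul U ψ χ
  map_smul' t ψ := by
    apply Lp.ext
    filter_upwards [Lp.coeFn_lpSMul (r := 2) U (t • ψ), Lp.coeFn_smul t ψ,
      Lp.coeFn_smul t (U • ψ : StateSpace S), Lp.coeFn_lpSMul (r := 2) U ψ] with z a b c d
    simp only [RingHom.id_apply]
    rw [a, c, Pi.smul_apply, d]
    simp only [Pi.smul_apply', b, Pi.smul_apply, Complex.real_smul, smul_eq_mul]
    ring

/-- The operator `H_U(B) = H₀(B) + U` on `L²(Ω)`, with the domain of `H₀(B)`. -/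
def hamiltonian (S : Set ℝ) (W : ℝ → ℝ) (U : Lp ℝ ⊤ (stripMeasure S)) (B : ℝ) :
    StateSpace S →ₗ.[ℂ] StateSpace S where
  domain := (freeHamiltonian S W B).domain
  toFun := (freeHamiltonian S W B).toFun + mulOp U ∘ₗ (freeHamiltonian S W B).domain.subtype

end

end QuantumWire

/-! A Fourier transform in `x` decomposes `H₀(B)` into fiber operators `-∂_y² + (p - By)² + W(y)`.
Let `L` be the infimum of their forms over all momenta `p` and all normalized test functions
(`groundEnergy`). The proof shows that an attractive `U` pushes the form of `H_U(B)` strictly below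
`L` for some test function, and that the spectrum below `L` is discrete. The infimum of the form
belongs to the spectrum and lies below `L`, so it is the required point.

Discreteness below `L`. Plancherel in `x` bounds the form of `H₀(B)` from below by `L`
(`groundEnergy_mul_le_energy`). Outside a large box `U` is negligible: it decays in `x`, while for
large `|y|` it is dominated by a small multiple of `1 + W` (on a bounded cross-section this region
is eventually empty). Inside the box, the Poincaré inequality on a fine mesh bounds the mass by a
small multiple of the form plus finitely many squared averages. So for every `l < L` the form is at
least `l` after a finite rank correction (`exists_lower_bound_mod_averages`). This replaces a
compactness argument: below `l` every spectral point is an eigenvalue of finite multiplicity, and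
there are finitely many of them (`IsFormOperator.discreteSpectrum_nonempty`).

Energy below `L`. The trial function is `exp(ipx) f(x) g(y)` with `f` a cut-off of length `ℓ` and
`g` a near-minimizer with excess `η`. The longitudinal kinetic cost is `O(1/ℓ)` and the cost of not
being at the minimum is `O(ℓ η)`. The gain from `U` stays away from zero provided that `g` is
bounded below on a rectangle where `U` has negative integral. No minimizer is constructed, so `g`
and `p` vary with `η`, and the lower bound on `g` must be uniform over near-minimizers. It comes
from a Harnack inequality for near-minimizers (`integral_log_deriv_le`, `harnack`,
`exists_lower_bound`), which allows `ℓ` to be fixed first and `η` afterwards (`exists_energy_lt`).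
-/

namespace QuantumWire

/-! ### Invertibility of perturbed operators below a form bound, modulo finite rank. -/

section AbstractSpectrum

variable {H : Type*} [NormedAddCommGroup H] [InnerProductSpace ℂ H]

/-- If `H_V = R₀⁻¹ + V`, then `(H_V - z) R₀ k = shiftedOp R₀ V z k`. -/
noncomputable def shiftedOp (R₀ V : H →L[ℂ] H) (z : ℂ) : H →L[ℂ] H :=
  1 + (V - z • (1 : H →L[ℂ] H)) ∘L R₀

theorem shiftedOp_apply (R₀ V : H →L[ℂ] H) (z : ℂ) (k : H) :
    shiftedOp R₀ V z k = k + V (R₀ k) - z • R₀ k := by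
  simp [shiftedOp, add_sub_assoc]

/-- The Fredholm alternative for finite rank. The operator `1 - K` preserves the finite-dimensional
range of `K`, where injectivity gives surjectivity; solving `u - K u = K y` there yields the
solution `x = y + u`. -/
theorem surjective_one_sub_of_injective {K : H →ₗ[ℂ] H} [FiniteDimensional ℂ K.range]
    (hK : ∀ x, x - K x = 0 → x = 0) (y : H) : ∃ x, x - K x = y := by
  let L : K.range →ₗ[ℂ] K.range := LinearMap.id - (K.domRestrict K.range).codRestrict K.range
    (fun x => ⟨x, rfl⟩)
  have hL : Function.Injective L := by
    rw [← LinearMap.ker_eq_bot, LinearMap.ker_eq_bot']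
    intro x hx
    apply Subtype.ext
    exact hK x (congrArg Subtype.val hx)
  obtain ⟨u, hu⟩ := LinearMap.surjective_of_injective hL ⟨K y, y, rfl⟩
  refine ⟨y + u, ?_⟩
  have hu' : (u : H) - K u = K y := congrArg Subtype.val hu
  rw [map_add, ← hu']
  abel

/-- With `ψ = R₀ k`, the vector `shiftedOp R₀ V z k` stands for `(H_V - z) ψ`. The form bound
estimates the real part of its inner product with `ψ` from below, and Cauchy–Schwarz concludes. -/
theorem le_norm_shiftedOp {R₀ V : H →L[ℂ] H} {l : ℝ}
    (hl : ∀ k, l * ‖R₀ k‖ ^ 2 ≤ (inner ℂ (R₀ k) (k + V (R₀ k))).re) (z : ℂ) (k : H) :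
    (l - z.re) * ‖R₀ k‖ ≤ ‖shiftedOp R₀ V z k‖ := by
  have h1 : (l - z.re) * ‖R₀ k‖ ^ 2 ≤ (inner ℂ (R₀ k) (shiftedOp R₀ V z k)).re := by
    rw [shiftedOp_apply, inner_sub_right, inner_smul_right, inner_self_eq_norm_sq_to_K]
    have := hl k
    have e : (z * ((‖R₀ k‖ : ℝ) : ℂ) ^ 2).re = z.re * ‖R₀ k‖ ^ 2 := by
      rw [← Complex.ofReal_pow, Complex.re_mul_ofReal]
    simp only [Complex.coe_algebraMap, Complex.sub_re] at *
    rw [e]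
    linarith
  have h2 : (inner ℂ (R₀ k) (shiftedOp R₀ V z k)).re ≤ ‖R₀ k‖ * ‖shiftedOp R₀ V z k‖ :=
    (Complex.re_le_norm _).trans (norm_inner_le_norm _ _)
  rcases (norm_nonneg (R₀ k)).eq_or_lt with h | h
  · rw [← h, mul_zero]
    exact norm_nonneg _
  · nlinarith

/-- The finite rank operator `∑ⱼ |fⱼ⟩⟨fⱼ|`. -/
noncomputable def sumProj {m : ℕ} (f : Fin m → H) : H →L[ℂ] H :=
  ∑ j, (innerSL ℂ (f j)).smulRight (f j)

theorem sumProj_apply {m : ℕ} (f : Fin m → H) (h : H) :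
    sumProj f h = ∑ j, inner ℂ (f j) h • f j := by
  simp [sumProj]

theorem re_inner_sumProj {m : ℕ} (f : Fin m → H) (h : H) :
    (inner ℂ h (sumProj f h)).re = ∑ j, ‖inner ℂ (f j) h‖ ^ 2 := by
  rw [sumProj_apply, inner_sum, Complex.re_sum]
  refine Finset.sum_congr rfl fun j _ => ?_
  rw [inner_smul_right, ← inner_conj_symm h (f j), Complex.mul_conj, Complex.ofReal_re,
    Complex.normSq_eq_norm_sq]

instance finiteDimensional_range_sumProj {m : ℕ} (f : Fin m → H) :
    FiniteDimensional ℂ (sumProj f : H →ₗ[ℂ] H).range := by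
  have := FiniteDimensional.span_of_finite ℂ (Set.finite_range f)
  refine Submodule.finiteDimensional_of_le (S₂ := Submodule.span ℂ (Set.range f)) ?_
  rintro _ ⟨h, rfl⟩
  simp only [ContinuousLinearMap.coe_coe, sumProj_apply]
  exact Submodule.sum_mem _ fun j _ =>
    Submodule.smul_mem _ _ (Submodule.subset_span ⟨j, rfl⟩)

variable [CompleteSpace H]

/-- The bound at `z` makes the operator injective with closed range. A vector orthogonal to the
range lies in the kernel of the adjoint `1 + R₀ (V - z̄)`. It therefore equals `-R₀ k` with `k = (V
- z̄) h`, and this `k` is annihilated by the shifted operator at `z̄`, where the second bound forces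
`k = 0`. -/
theorem bijective_shiftedOp {R₀ V : H →L[ℂ] H} (hR : IsSelfAdjoint R₀) (hV : IsSelfAdjoint V)
    {z : ℂ} {c : ℝ} (hc : 0 < c) (h1 : ∀ k, c * ‖R₀ k‖ ≤ ‖shiftedOp R₀ V z k‖)
    (h2 : ∀ k, c * ‖R₀ k‖ ≤ ‖shiftedOp R₀ V (starRingEnd ℂ z) k‖) :
    Function.Bijective (shiftedOp R₀ V z) := by
  set T := shiftedOp R₀ V z with hT
  -- The hypothesis controls only `R₀ k`; the identity `k = shiftedOp k - (V - w) R₀ k` upgrades it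
  -- to control of `k` itself.
  have hb : ∀ w : ℂ, (∀ k, c * ‖R₀ k‖ ≤ ‖shiftedOp R₀ V w k‖) →
      ∀ k, ‖k‖ ≤ (1 + ‖V - w • (1 : H →L[ℂ] H)‖ / c) * ‖shiftedOp R₀ V w k‖ := by
    intro w hw k
    have e : k = shiftedOp R₀ V w k - (V - w • (1 : H →L[ℂ] H)) (R₀ k) := by
      simp [shiftedOp]
    have e1 : ‖k‖ ≤ ‖shiftedOp R₀ V w k‖ + ‖V - w • (1 : H →L[ℂ] H)‖ * ‖R₀ k‖ := by
      conv_lhs => rw [e]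
      exact (norm_sub_le _ _).trans (add_le_add_right (ContinuousLinearMap.le_opNorm _ _) _)
    have e2 : ‖R₀ k‖ ≤ ‖shiftedOp R₀ V w k‖ / c := by
      rw [le_div_iff₀ hc, mul_comm]
      exact hw k
    calc ‖k‖ ≤ _ := e1
      _ ≤ ‖shiftedOp R₀ V w k‖
          + ‖V - w • (1 : H →L[ℂ] H)‖ * (‖shiftedOp R₀ V w k‖ / c) := by gcongr
      _ = _ := by ring
  have hz := hb z h1
  have hz' := hb _ h2
  have anti : AntilipschitzWith (Real.toNNReal (1 + ‖V - z • (1 : H →L[ℂ] H)‖ / c)) T := by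
    refine ContinuousLinearMap.antilipschitz_of_bound T fun k => ?_
    rw [Real.coe_toNNReal _ (by positivity)]
    exact hz k
  refine ⟨anti.injective, ?_⟩
  have hcl : IsClosed (T.range : Set H) := by
    exact anti.isClosed_range T.uniformContinuous
  have hker : T.rangeᗮ = ⊥ := by
    rw [ContinuousLinearMap.orthogonal_range, LinearMap.ker_eq_bot']
    intro h hh
    have hadj : ContinuousLinearMap.adjoint T
        = 1 + R₀ ∘L (V - (starRingEnd ℂ z) • (1 : H →L[ℂ] H)) := by
      have hR' : ContinuousLinearMap.adjoint R₀ = R₀ := hR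
      have hV' : ContinuousLinearMap.adjoint V = V := hV
      have h1' : ContinuousLinearMap.adjoint (1 : H →L[ℂ] H) = 1 := by
        exact star_one (H →L[ℂ] H)
      rw [hT, shiftedOp, map_add, ContinuousLinearMap.adjoint_comp, map_sub, h1', hR', hV',
        LinearIsometryEquiv.map_smulₛₗ, h1']
    have e : h + R₀ ((V - (starRingEnd ℂ z) • (1 : H →L[ℂ] H)) h) = 0 := by
      have := hh
      rw [hadj] at this
      simpa using this
    set k := (V - (starRingEnd ℂ z) • (1 : H →L[ℂ] H)) h with hk
    have e' : h = - R₀ k := eq_neg_of_add_eq_zero_left e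
    have : shiftedOp R₀ V (starRingEnd ℂ z) k = 0 := by
      have : k = -(V - (starRingEnd ℂ z) • (1 : H →L[ℂ] H)) (R₀ k) := by
        rw [← map_neg, ← e']
      simp only [shiftedOp, add_apply, ContinuousLinearMap.comp_apply,
        one_apply_eq_self]
      conv_lhs => enter [1]; rw [this]
      abel
    have hk0 := hz' k
    rw [this, norm_zero, mul_zero] at hk0
    have hk1 : k = 0 := norm_le_zero_iff.1 hk0
    rw [e', hk1, map_zero, neg_zero]
  have : CompleteSpace T.range := hcl.completeSpace_coe
  exact LinearMap.range_eq_top.1 (Submodule.orthogonal_eq_bot_iff.1 hker)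

theorem isSelfAdjoint_sumProj {m : ℕ} (f : Fin m → H) : IsSelfAdjoint (sumProj f) := by
  rw [ContinuousLinearMap.isSelfAdjoint_iff_isSymmetric]
  intro x y
  simp only [ContinuousLinearMap.coe_coe, sumProj_apply, inner_sum, sum_inner,
    inner_smul_right, inner_smul_left, inner_conj_symm]
  exact Finset.sum_congr rfl fun j _ => mul_comm _ _

/-- Adding the finite rank operator `F = ∑ⱼ |fⱼ⟩⟨fⱼ|` to `V` lifts the form above `l`, so the
resulting shifted operator `A` is invertible for `Re z < l`. The original one is `A (1 - A⁻¹ F R₀)`,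
to which the Fredholm alternative applies. -/
theorem bijective_shiftedOp_of_injective {R₀ V : H →L[ℂ] H} (hR : IsSelfAdjoint R₀)
    (hV : IsSelfAdjoint V) {m : ℕ} {f : Fin m → H} {l : ℝ}
    (hl : ∀ k, l * ‖R₀ k‖ ^ 2
      ≤ (inner ℂ (R₀ k) (k + V (R₀ k))).re + ∑ j, ‖inner ℂ (f j) (R₀ k)‖ ^ 2)
    {z : ℂ} (hz : z.re < l) (hinj : ∀ k, shiftedOp R₀ V z k = 0 → k = 0) :
    Function.Bijective (shiftedOp R₀ V z) := by
  set F := sumProj f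
  have hl' : ∀ k, l * ‖R₀ k‖ ^ 2 ≤ (inner ℂ (R₀ k) (k + (V + F) (R₀ k))).re := by
    intro k
    rw [add_apply, ← add_assoc, inner_add_right, Complex.add_re, re_inner_sumProj]
    exact hl k
  have hbij : Function.Bijective (shiftedOp R₀ (V + F) z) := by
    refine bijective_shiftedOp hR (hV.add (isSelfAdjoint_sumProj f)) (sub_pos.2 hz)
      (fun k => le_norm_shiftedOp hl' z k) (fun k => ?_)
    simpa using le_norm_shiftedOp hl' (starRingEnd ℂ z) k
  let A : H ≃ₗ[ℂ] H := LinearEquiv.ofBijective (shiftedOp R₀ (V + F) z : H →ₗ[ℂ] H) hbij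
  have hA : ∀ k, A k = shiftedOp R₀ (V + F) z k := fun k => rfl
  let K : H →ₗ[ℂ] H := A.symm.toLinearMap ∘ₗ (F : H →ₗ[ℂ] H) ∘ₗ (R₀ : H →ₗ[ℂ] H)
  have hAK : ∀ x, A (x - K x) = shiftedOp R₀ V z x := by
    intro x
    rw [map_sub]
    have : A (K x) = F (R₀ x) := by simp [K]
    rw [this, hA, shiftedOp_apply, shiftedOp_apply, add_apply]
    abel
  have hfin : FiniteDimensional ℂ K.range := by
    refine Submodule.finiteDimensional_of_le
      (S₂ := (F : H →ₗ[ℂ] H).range.map A.symm.toLinearMap) ?_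
    rintro _ ⟨x, rfl⟩
    exact ⟨F (R₀ x), ⟨R₀ x, rfl⟩, rfl⟩
  have hK : ∀ x, x - K x = 0 → x = 0 := by
    intro x hx
    apply hinj
    rw [← hAK, hx, map_zero]
  refine ⟨(injective_iff_map_eq_zero _).2 hinj, fun y => ?_⟩
  obtain ⟨x, hx⟩ := surjective_one_sub_of_injective hK (A.symm y)
  exact ⟨x, by rw [← hAK, hx, A.apply_symm_apply]⟩

end AbstractSpectrum

/-! ### Spectrum of an operator defined by a form: eigenvalues below `l` and the bottom of the
spectrum. -/

section FormOperator

variable {H : Type*} [NormedAddCommGroup H] [InnerProductSpace ℂ H] [CompleteSpace H]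
variable {Q : Type*} [NormedAddCommGroup Q] [InnerProductSpace ℂ Q] [CompleteSpace Q]

/-- `T + 1 - V` is the self-adjoint operator associated with the form `‖·‖²` on the form domain
`Q`, mapped to `H` by `J`. -/
structure IsFormOperator (J : Q →L[ℂ] H) (V : H →L[ℂ] H) (T : H →ₗ.[ℂ] H) : Prop where
  selfAdjoint : IsSelfAdjoint V
  mem_domain : ∀ ψ, ψ ∈ T.domain ↔ ∃ k, J (ContinuousLinearMap.adjoint J k) = ψ
  apply : ∀ k h, T ⟨J (ContinuousLinearMap.adjoint J k), h⟩
    = k + V (J (ContinuousLinearMap.adjoint J k))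

namespace IsFormOperator

variable {J : Q →L[ℂ] H} {V : H →L[ℂ] H} {T : H →ₗ.[ℂ] H}

theorem isSelfAdjoint_comp_adjoint (J : Q →L[ℂ] H) :
    IsSelfAdjoint (J ∘L ContinuousLinearMap.adjoint J) := by
  change ContinuousLinearMap.adjoint _ = _
  rw [ContinuousLinearMap.adjoint_comp, ContinuousLinearMap.adjoint_adjoint]

/-- Every domain vector is `R₀ k` with `R₀ = J J*`, and `(T - z) R₀ k` is the shifted operator `A`
applied to `k`. The resolvent is therefore `R₀ A⁻¹`. -/
theorem mem_resolventSet (h : IsFormOperator J V T) {z : ℂ}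
    (hz : Function.Bijective (shiftedOp (J ∘L ContinuousLinearMap.adjoint J) V z)) :
    z ∈ resolventSet T := by
  set R₀ := J ∘L ContinuousLinearMap.adjoint J with hR₀
  let A : H ≃L[ℂ] H := ContinuousLinearEquiv.ofBijective (shiftedOp R₀ V z)
    (LinearMap.ker_eq_bot.2 hz.1) (LinearMap.range_eq_top.2 hz.2)
  have hA : ∀ k, A k = k + V (R₀ k) - z • R₀ k := fun k => shiftedOp_apply R₀ V z k
  refine ⟨R₀ ∘L (A.symm : H →L[ℂ] H), fun f => ?_, fun ψ => ?_⟩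
  · have hd : (R₀ ∘L (A.symm : H →L[ℂ] H)) f ∈ T.domain := (h.mem_domain _).2 ⟨A.symm f, rfl⟩
    refine ⟨hd, ?_⟩
    have h1 := h.apply (A.symm f) hd
    have h2 := hA (A.symm f)
    rw [A.apply_symm_apply] at h2
    conv_rhs => rw [h2]
    exact congrArg (· - z • R₀ (A.symm f)) h1
  · obtain ⟨ψ, hψ⟩ := ψ
    obtain ⟨k, rfl⟩ := (h.mem_domain ψ).1 hψ
    have h1 := h.apply k hψ
    rw [h1]
    have h2 : k + V (R₀ k) - z • R₀ k = A k := (hA k).symm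
    change R₀ (A.symm (k + V (R₀ k) - z • R₀ k)) = R₀ k
    rw [h2, A.symm_apply_apply]

theorem re_inner (J : Q →L[ℂ] H) (V : H →L[ℂ] H) (k : H) :
    (inner ℂ (J (ContinuousLinearMap.adjoint J k))
        (k + V (J (ContinuousLinearMap.adjoint J k)))).re
      = ‖ContinuousLinearMap.adjoint J k‖ ^ 2 + (inner ℂ (J (ContinuousLinearMap.adjoint J k))
        (V (J (ContinuousLinearMap.adjoint J k)))).re := by
  rw [inner_add_right, Complex.add_re, ← ContinuousLinearMap.adjoint_inner_right,
    inner_self_eq_norm_sq_to_K]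
  simp [← Complex.ofReal_pow]

/-- `H_V` is a symmetric operator. -/
theorem inner_eigenvectors (h : IsFormOperator J V T) {z w : ℂ} {ψ χ : H}
    (hψ : ψ ∈ eigenspace T z) (hχ : χ ∈ eigenspace T w) :
    w * inner ℂ ψ χ = starRingEnd ℂ z * inner ℂ ψ χ := by
  obtain ⟨h1, h2⟩ := hψ
  obtain ⟨h3, h4⟩ := hχ
  obtain ⟨k, rfl⟩ := (h.mem_domain ψ).1 h1
  obtain ⟨l, rfl⟩ := (h.mem_domain χ).1 h3
  rw [h.apply] at h2 h4
  have hV := (ContinuousLinearMap.isSelfAdjoint_iff_isSymmetric.1 h.selfAdjoint)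
    (J (ContinuousLinearMap.adjoint J k)) (J (ContinuousLinearMap.adjoint J l))
  simp only [ContinuousLinearMap.coe_coe] at hV
  rw [← inner_smul_right, ← h4, ← inner_smul_left, ← h2, inner_add_right, inner_add_left, hV,
    ← ContinuousLinearMap.adjoint_inner_right, ← ContinuousLinearMap.adjoint_inner_left,
    ContinuousLinearMap.adjoint_inner_left, ContinuousLinearMap.adjoint_inner_right]
  congr 1
  rw [← ContinuousLinearMap.adjoint_inner_left, ← ContinuousLinearMap.adjoint_inner_right]

theorem eigenvalue_real (h : IsFormOperator J V T) {z : ℂ} (hz : eigenspace T z ≠ ⊥) :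
    z.im = 0 := by
  obtain ⟨ψ, hψ, h0⟩ := (Submodule.ne_bot_iff _).1 hz
  have h1 := h.inner_eigenvectors hψ hψ
  have h2 : inner ℂ ψ ψ ≠ 0 := inner_self_ne_zero.2 h0
  exact Complex.conj_eq_iff_im.1 (mul_right_cancel₀ h2 h1).symm

variable {m : ℕ} {f : Fin m → H} {l : ℝ}

/-- Below `l`, the form is nonpositive only on a space of dimension at most `m`. -/
abbrev FormBound (J : Q →L[ℂ] H) (V : H →L[ℂ] H) (f : Fin m → H) (l : ℝ) : Prop :=
  ∀ Φ : Q, l * ‖J Φ‖ ^ 2 ≤ ‖Φ‖ ^ 2 + (inner ℂ (J Φ) (V (J Φ))).re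
    + ∑ j, ‖inner ℂ (f j) (J Φ)‖ ^ 2

/-- A kernel vector `k` of the shifted operator gives the eigenvector `J J* k`, and `k = 0` if that
vanishes. Without eigenvectors the shifted operator is injective, hence bijective, and `z` is in the
resolvent set. -/
theorem eigenspace_ne_bot (h : IsFormOperator J V T) (hl : FormBound J V f l) {z : ℂ}
    (hz : z.re < l) (hs : z ∈ spectrum T) : eigenspace T z ≠ ⊥ := by
  intro hbot
  refine hs (h.mem_resolventSet (bijective_shiftedOp_of_injective (f := f)
    (isSelfAdjoint_comp_adjoint J) h.selfAdjoint (fun k => ?_) hz fun k hk => ?_))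
  · rw [ContinuousLinearMap.comp_apply, re_inner]
    exact hl _
  · rw [shiftedOp_apply] at hk
    have hmem : J (ContinuousLinearMap.adjoint J k) ∈ eigenspace T z := by
      refine ⟨(h.mem_domain _).2 ⟨k, rfl⟩, ?_⟩
      rw [h.apply]
      exact sub_eq_zero.1 hk
    rw [hbot, Submodule.mem_bot] at hmem
    simpa [hmem] using hk

theorem norm_sq_lt (h : IsFormOperator J V T) {ψ : H} (hψ : ψ ∈ T.domain)
    (hl : FormBound J V f l) (hf : ∀ j, inner ℂ (f j) ψ = 0) :
    l * ‖ψ‖ ^ 2 ≤ (inner ℂ ψ (T ⟨ψ, hψ⟩)).re := by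
  obtain ⟨k, rfl⟩ := (h.mem_domain ψ).1 hψ
  rw [h.apply, re_inner]
  simpa [hf] using hl (ContinuousLinearMap.adjoint J k)

/-- The linear map `ψ ↦ (⟨fⱼ, ψ⟩)ⱼ`. -/
noncomputable def testMap (f : Fin m → H) : H →ₗ[ℂ] (Fin m → ℂ) :=
  LinearMap.pi fun j => (innerSL ℂ (f j) : H →ₗ[ℂ] ℂ)

/-- An eigenvector orthogonal to all `fⱼ` would have form at least `l ‖ψ‖²`, contradicting `Re z <
l` unless it is zero. Hence the `m` functionals separate points of the eigenspace. -/
theorem finiteDimensional_eigenspace (h : IsFormOperator J V T) (hl : FormBound J V f l) {z : ℂ}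
    (hz : z.re < l) : FiniteDimensional ℂ (eigenspace T z) := by
  refine FiniteDimensional.of_injective (testMap f ∘ₗ (eigenspace T z).subtype) ?_
  rw [← LinearMap.ker_eq_bot, LinearMap.ker_eq_bot']
  rintro ⟨ψ, hd, hψ⟩ h0
  have hf : ∀ j, inner ℂ (f j) ψ = 0 := fun j => congrFun h0 j
  have h1 := h.norm_sq_lt hd hl hf
  rw [hψ, inner_smul_right, inner_self_eq_norm_sq_to_K] at h1
  simp only [Complex.coe_algebraMap, ← Complex.ofReal_pow, Complex.re_mul_ofReal] at h1
  have h2 : ‖ψ‖ ^ 2 ≤ 0 := by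
    by_contra h3
    push Not at h3
    nlinarith
  apply Subtype.ext
  simpa using le_antisymm h2 (sq_nonneg _)

/-- Among `m + 1` eigenvectors with distinct eigenvalues, which are mutually orthogonal, some
nontrivial combination is annihilated by all `m` functionals. Its form is a weighted sum of
eigenvalues below `l`, hence less than `l` times its squared norm, against the form bound. -/
theorem finite_eigenvalues (h : IsFormOperator J V T) (hl : FormBound J V f l) :
    {z : ℂ | z.re < l ∧ eigenspace T z ≠ ⊥}.Finite := by
  by_contra hinf
  obtain ⟨t, ht, hcard⟩ := Set.Infinite.exists_subset_card_eq hinf (m + 1)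
  have hev : ∀ z : t, ∃ ψ ∈ eigenspace T (z : ℂ), ψ ≠ 0 := fun z =>
    (Submodule.ne_bot_iff _).1 (ht z.2).2
  choose ψ hψ hψ0 using hev
  have horth : ∀ z w : t, z ≠ w → inner ℂ (ψ z) (ψ w) = 0 := by
    intro z w hzw
    by_contra h0
    have h1 := mul_right_cancel₀ h0 (h.inner_eigenvectors (hψ z) (hψ w))
    rw [Complex.conj_eq_iff_im.2 (h.eigenvalue_real (ht z.2).2)] at h1
    exact hzw (Subtype.ext h1.symm)
  let L : (t → ℂ) →ₗ[ℂ] H := Fintype.linearCombination ℂ ψ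
  have hdim : Module.finrank ℂ (Fin m → ℂ) < Module.finrank ℂ (t → ℂ) := by
    simp [hcard]
  have hker : LinearMap.ker (testMap f ∘ₗ L) ≠ ⊥ := LinearMap.ker_ne_bot_of_finrank_lt hdim
  obtain ⟨c, hc, hc0⟩ := (Submodule.ne_bot_iff _).1 hker
  have hLc : L c = ∑ z, c z • ψ z := Fintype.linearCombination_apply ℂ ψ c
  have hf : ∀ j, inner ℂ (f j) (L c) = 0 := fun j => congrFun (LinearMap.mem_ker.1 hc) j
  have hd : L c ∈ T.domain := by
    rw [hLc]
    exact Submodule.sum_mem _ fun z _ => Submodule.smul_mem _ _ (hψ z).1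
  have hT : T ⟨L c, hd⟩ = ∑ z : t, c z • (z : ℂ) • ψ z := by
    have e : (⟨L c, hd⟩ : T.domain) = ∑ z : t, c z • ⟨ψ z, (hψ z).1⟩ := by
      apply Subtype.ext
      simp [hLc]
    rw [e]
    change T.toFun _ = _
    rw [map_sum]
    refine Finset.sum_congr rfl fun z _ => ?_
    rw [map_smul]
    exact congrArg (c z • ·) (hψ z).2
  have hinner : ∀ d : t → ℂ, (inner ℂ (L c) (∑ z : t, c z • d z • ψ z)).re
      = ∑ z : t, (d z).re * (‖c z‖ ^ 2 * ‖ψ z‖ ^ 2) := by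
    intro d
    rw [hLc, sum_inner, Complex.re_sum]
    refine Finset.sum_congr rfl fun z _ => ?_
    rw [inner_sum, Finset.sum_eq_single z]
    · rw [inner_smul_left, inner_smul_right, inner_smul_right, inner_self_eq_norm_sq_to_K]
      simp only [Complex.coe_algebraMap]
      have : starRingEnd ℂ (c z) * (c z * (d z * ((‖ψ z‖ : ℝ) : ℂ) ^ 2))
          = d z * ((‖c z‖ ^ 2 * ‖ψ z‖ ^ 2 : ℝ) : ℂ) := by
        push_cast
        rw [← Complex.conj_mul' (c z)]
        ring
      rw [this, Complex.re_mul_ofReal]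
    · intro w _ hw
      rw [inner_smul_left, inner_smul_right, inner_smul_right, horth z w hw.symm]
      simp
    · simp
  have h1 := h.norm_sq_lt hd hl hf
  rw [hT, hinner] at h1
  have h2 : ‖L c‖ ^ 2 = ∑ z : t, ‖c z‖ ^ 2 * ‖ψ z‖ ^ 2 := by
    have := hinner fun _ => 1
    simp only [one_smul, Complex.one_re, one_mul] at this
    rw [← this, ← hLc, inner_self_eq_norm_sq_to_K]
    simp [← Complex.ofReal_pow]
  rw [h2, Finset.mul_sum] at h1
  obtain ⟨w, hw⟩ := Function.ne_iff.1 hc0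
  refine absurd h1 (not_le.2 (Finset.sum_lt_sum (fun z _ => ?_) ⟨w, Finset.mem_univ _, ?_⟩))
  · exact mul_le_mul_of_nonneg_right (ht z.2).1.le (by positivity)
  · have : 0 < ‖c w‖ ^ 2 * ‖ψ w‖ ^ 2 :=
      mul_pos (pow_pos (norm_pos_iff.2 hw) _) (pow_pos (norm_pos_iff.2 (hψ0 w)) _)
    exact mul_lt_mul_of_pos_right (ht w.2).1 this

/-- The infimum of the form belongs to the spectrum. -/
theorem mem_spectrum (h : IsFormOperator J V T) {E : ℝ}
    -- In the proof, a bounded inverse `R` of `T - E` is contradicted by inserting `Φ - t Ψ` with `J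
    -- Ψ = R (J Φ)` into `hE`. The shifted form there is the form at `Φ`, which is below `t ‖J Φ‖²`,
    -- minus `2 t ‖J Φ‖²`, plus a term at most `t ‖J Φ‖²` because `t ‖R‖ ≤ 1`; it would be negative.
    (hE : ∀ Φ : Q, E * ‖J Φ‖ ^ 2 ≤ ‖Φ‖ ^ 2 + (inner ℂ (J Φ) (V (J Φ))).re)
    (hE' : ∀ E' > E, ∃ Φ : Q, ‖Φ‖ ^ 2 + (inner ℂ (J Φ) (V (J Φ))).re < E' * ‖J Φ‖ ^ 2) :
    (E : ℂ) ∈ spectrum T := by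
  rintro ⟨R, hR, -⟩
  set t : ℝ := 1 / (‖R‖ + 1) with ht
  have ht0 : 0 < t := by positivity
  obtain ⟨Φ, hΦ⟩ := hE' (E + t) (by linarith)
  obtain ⟨hd, hR'⟩ := hR (J Φ)
  obtain ⟨k, hk⟩ := (h.mem_domain _).1 hd
  set Ψ := ContinuousLinearMap.adjoint J k with hΨ
  have hTk : k + V (J Ψ) - (E : ℂ) • J Ψ = J Φ := by
    have h1 := h.apply k (hk ▸ hd)
    rw [← h1]
    refine Eq.trans ?_ hR'
    congr 2
    exact Subtype.ext hk
  have hVs : ∀ x y, inner ℂ (V x) y = inner ℂ x (V y) := fun x y =>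
    (ContinuousLinearMap.isSelfAdjoint_iff_isSymmetric.1 h.selfAdjoint) x y
  -- the form of `Φ - t Ψ`
  have hcross : ∀ X : Q, inner ℂ X Ψ + inner ℂ (J X) (V (J Ψ)) - E * inner ℂ (J X) (J Ψ)
      = inner ℂ (J X) (J Φ) := by
    intro X
    rw [← hTk, hΨ, ContinuousLinearMap.adjoint_inner_right, inner_sub_right, inner_add_right,
      inner_smul_right]
  have hre : ∀ X : Q, (inner ℂ X Ψ : ℂ).re + (inner ℂ (J X) (V (J Ψ))).re
      - E * (inner ℂ (J X) (J Ψ)).re = (inner ℂ (J X) (J Φ)).re := by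
    intro X
    rw [← hcross X]
    simp
  have c1 := hre Φ
  have c2 := hre Ψ
  have b := hE (Φ - (t : ℂ) • Ψ)
  have nsq : ∀ x : H, (inner ℂ x x).re = ‖x‖ ^ 2 := fun x => by
    rw [inner_self_eq_norm_sq_to_K]; simp [← Complex.ofReal_pow]
  have nsqQ : ∀ x : Q, (inner ℂ x x : ℂ).re = ‖x‖ ^ 2 := fun x => by
    rw [inner_self_eq_norm_sq_to_K]; simp [← Complex.ofReal_pow]
  have symH : ∀ x y : H, (inner ℂ x y).re = (inner ℂ y x).re := fun x y => by
    rw [← inner_conj_symm, Complex.conj_re]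
  have symQ : ∀ x y : Q, (inner ℂ x y : ℂ).re = (inner ℂ y x : ℂ).re := fun x y => by
    rw [← inner_conj_symm, Complex.conj_re]
  rw [← nsq, ← nsqQ] at b
  simp only [map_sub, map_smul, inner_sub_left, inner_sub_right, inner_smul_left,
    inner_smul_right, Complex.conj_ofReal, Complex.sub_re, Complex.re_ofReal_mul] at b
  rw [symQ Ψ Φ, symH (J Ψ) (J Φ), symH (J Ψ) (V (J Φ)), hVs (J Φ) (J Ψ), nsq, nsqQ, nsq,
    nsqQ] at b
  rw [nsq] at c1
  rw [nsq, nsqQ] at c2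
  have b' : 0 ≤ (‖Φ‖ ^ 2 + (inner ℂ (J Φ) (V (J Φ))).re - E * ‖J Φ‖ ^ 2)
      - 2 * t * ‖J Φ‖ ^ 2 + t ^ 2 * (inner ℂ (J Ψ) (J Φ)).re := by
    have d1 := congrArg (2 * t * ·) c1
    have d2 := congrArg (t ^ 2 * ·) c2
    linarith
  have e1 : (inner ℂ (J Ψ) (J Φ)).re ≤ ‖R‖ * ‖J Φ‖ ^ 2 := by
    rw [hk]
    calc (inner ℂ (R (J Φ)) (J Φ)).re ≤ ‖R (J Φ)‖ * ‖J Φ‖ :=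
          (Complex.re_le_norm _).trans (norm_inner_le_norm _ _)
      _ ≤ (‖R‖ * ‖J Φ‖) * ‖J Φ‖ := by gcongr; exact R.le_opNorm _
      _ = _ := by ring
  have e2 : t ^ 2 * (inner ℂ (J Ψ) (J Φ)).re ≤ t * ‖J Φ‖ ^ 2 := by
    have : t * ‖R‖ ≤ 1 := by
      rw [ht, one_div, inv_mul_le_iff₀ (by positivity)]
      linarith
    calc t ^ 2 * (inner ℂ (J Ψ) (J Φ)).re ≤ t ^ 2 * (‖R‖ * ‖J Φ‖ ^ 2) := by gcongr
      _ = (t * ‖R‖) * (t * ‖J Φ‖ ^ 2) := by ring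
      _ ≤ 1 * (t * ‖J Φ‖ ^ 2) := by gcongr
      _ = _ := one_mul _
  nlinarith

/-- The best lower bound `E` of the form lies in the spectrum, and `hex` puts it below `l`. There
the spectrum consists of finitely many eigenvalues of finite multiplicity, so `E` is isolated. -/
theorem discreteSpectrum_nonempty (h : IsFormOperator J V T) (hl : FormBound J V f l)
    (hex : ∃ Φ : Q, ‖Φ‖ ^ 2 + (inner ℂ (J Φ) (V (J Φ))).re < l * ‖J Φ‖ ^ 2) :
    (discreteSpectrum T).Nonempty := by
  have hVb : ∀ x, -(‖V‖ * ‖x‖ ^ 2) ≤ (inner ℂ x (V x)).re := by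
    intro x
    have h1 : |(inner ℂ x (V x)).re| ≤ ‖x‖ * ‖V x‖ :=
      (Complex.abs_re_le_norm _).trans (norm_inner_le_norm _ _)
    have h2 := V.le_opNorm x
    have h3 := (abs_le.1 h1).1
    nlinarith [norm_nonneg x]
  set A : Set ℝ := {E | ∀ Φ : Q, E * ‖J Φ‖ ^ 2 ≤ ‖Φ‖ ^ 2 + (inner ℂ (J Φ) (V (J Φ))).re}
  obtain ⟨Φ₀, hΦ₀⟩ := hex
  have hA : A.Nonempty := ⟨-‖V‖, fun Φ => by have := hVb (J Φ); nlinarith [sq_nonneg ‖Φ‖]⟩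
  have hlt : ∀ E ∈ A, E < l := by
    intro E hE
    have := hE Φ₀
    by_contra hc
    push Not at hc
    nlinarith [sq_nonneg ‖J Φ₀‖]
  -- If `J Φ₀ = 0`, the form at `Φ₀` would be both nonnegative and negative.
  have hpos : 0 < ‖J Φ₀‖ ^ 2 := by
    refine lt_of_le_of_ne (sq_nonneg _) fun h0 => ?_
    have := hVb (J Φ₀)
    rw [← h0] at this hΦ₀
    nlinarith [sq_nonneg ‖Φ₀‖]
  have hbdd : BddAbove A := ⟨l, fun E hE => (hlt E hE).le⟩
  set E := sSup A
  have hEA : E ∈ A := by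
    intro Φ
    rcases (sq_nonneg ‖J Φ‖).eq_or_lt with h0 | h0
    · rw [← h0, mul_zero]
      obtain ⟨e, he⟩ := hA
      have := he Φ
      rwa [← h0, mul_zero] at this
    · rw [← le_div_iff₀ h0]
      exact csSup_le hA fun e he => (le_div_iff₀ h0).2 (he Φ)
  have hE' : ∀ E' > E, ∃ Φ : Q, ‖Φ‖ ^ 2 + (inner ℂ (J Φ) (V (J Φ))).re < E' * ‖J Φ‖ ^ 2 := by
    intro E' hE'
    by_contra hc
    push Not at hc
    exact absurd (le_csSup hbdd hc) (not_le.2 hE')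
  have hspec := h.mem_spectrum hEA hE'
  have hEl : ((E : ℂ)).re < l := by simpa using hlt E hEA
  refine ⟨E, hspec, ?_, h.eigenspace_ne_bot hl hEl hspec, h.finiteDimensional_eigenspace hl hEl⟩
  -- Removing the finitely many other eigenvalues from the half-plane `Re w < l` leaves an open
  -- neighborhood of `E` whose only spectral point is `E`.
  have hfin := (h.finite_eigenvalues hl).subset
    (Set.sdiff_subset : {z : ℂ | z.re < l ∧ eigenspace T z ≠ ⊥} \ {(E : ℂ)} ⊆ _)
  have hopen : {w : ℂ | w.re < l} ∩ ({z : ℂ | z.re < l ∧ eigenspace T z ≠ ⊥} \ {(E : ℂ)})ᶜ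
      ∈ nhds (E : ℂ) :=
    ((isOpen_lt Complex.continuous_re continuous_const).inter hfin.isClosed.isOpen_compl).mem_nhds
      ⟨hEl, by simp⟩
  obtain ⟨ε, hε, hball⟩ := Metric.mem_nhds_iff.1 hopen
  refine ⟨ε, hε, fun w hw hd => ?_⟩
  obtain ⟨h1, h2⟩ := hball hd
  by_contra hne
  exact h2 ⟨⟨h1, h.eigenspace_ne_bot hl h1 hw⟩, hne⟩

end IsFormOperator

end FormOperator

/-! ### The Hilbert space of the form and the Hamiltonian as a form operator. -/

section FormSpace

variable {S : Set ℝ}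

theorem norm_sq_eq_integral {μ : Measure (ℝ × ℝ)} (f : Lp ℂ 2 μ) :
    ‖f‖ ^ 2 = ∫ z, ‖f z‖ ^ 2 ∂μ := by
  have h : ((‖f‖ ^ 2 : ℝ) : ℂ) = ((∫ z, ‖f z‖ ^ 2 ∂μ : ℝ) : ℂ) := by
    rw [← integral_complex_ofReal, Complex.ofReal_pow]
    have := inner_self_eq_norm_sq_to_K (𝕜 := ℂ) f
    simp only [Complex.coe_algebraMap] at this
    rw [← this, L2.inner_def]
    refine integral_congr_ae (Filter.Eventually.of_forall fun z => ?_)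
    simp only [inner_self_eq_norm_sq_to_K, Complex.coe_algebraMap, Complex.ofReal_pow]
  exact_mod_cast h

/-- Multiplication by `U ∈ L^∞(Ω)` as a bounded operator. -/
noncomputable def mulCLM (U : Lp ℝ ⊤ (stripMeasure S)) : StateSpace S →L[ℂ] StateSpace S :=
  (mulOp U).mkContinuous ‖U‖ fun ψ => Lp.norm_smul_le U ψ

theorem coeFn_mulCLM (U : Lp ℝ ⊤ (stripMeasure S)) (ψ : StateSpace S) :
    mulCLM U ψ =ᵐ[stripMeasure S] fun z => (U z : ℂ) * ψ z := by
  filter_upwards [Lp.coeFn_lpSMul (r := 2) U ψ] with z hz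
  change (U • ψ : StateSpace S) z = _
  rw [hz, Pi.smul_apply', Complex.real_smul]

theorem isSelfAdjoint_mulCLM (U : Lp ℝ ⊤ (stripMeasure S)) : IsSelfAdjoint (mulCLM U) := by
  rw [ContinuousLinearMap.isSelfAdjoint_iff_isSymmetric]
  intro ψ χ
  simp only [ContinuousLinearMap.coe_coe, L2.inner_def]
  refine integral_congr_ae ?_
  filter_upwards [coeFn_mulCLM U ψ, coeFn_mulCLM U χ] with z h1 h2
  rw [h1, h2, RCLike.inner_apply, RCLike.inner_apply, map_mul, Complex.conj_ofReal]
  ring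

theorem re_inner_mulCLM (U : Lp ℝ ⊤ (stripMeasure S)) (ψ : StateSpace S) :
    (inner ℂ ψ (mulCLM U ψ)).re = ∫ z in strip S, U z * ‖ψ z‖ ^ 2 := by
  have h : inner ℂ ψ (mulCLM U ψ) = ((∫ z in strip S, U z * ‖ψ z‖ ^ 2 : ℝ) : ℂ) := by
    rw [L2.inner_def, ← integral_complex_ofReal]
    refine integral_congr_ae ?_
    filter_upwards [coeFn_mulCLM U ψ] with z h1
    rw [h1, RCLike.inner_apply, mul_assoc, Complex.mul_conj']
    push_cast
    ring
  rw [h, Complex.ofReal_re]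

/-- The product `L²(Ω)⁴` with its Hilbert space structure. -/
abbrev QuadSpace (S : Set ℝ) : Type := PiLp 2 (fun _ : Fin 4 => StateSpace S)

/-- The plain product carries the sup norm, which is not Hilbertian; this map transports the closure
of the form core to the Hilbert sum. -/
noncomputable def quad (S : Set ℝ) :
    QuadSpace S →L[ℂ] StateSpace S × StateSpace S × StateSpace S × StateSpace S :=
  (PiLp.proj 2 _ 0).prod ((PiLp.proj 2 _ 1).prod ((PiLp.proj 2 _ 2).prod (PiLp.proj 2 _ 3)))

/-- The form domain of `H₀(B)` with its form norm. -/
noncomputable def formSpace (S : Set ℝ) (W : ℝ → ℝ) (B : ℝ) : Submodule ℂ (QuadSpace S) :=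
  (formCore S W B).topologicalClosure.comap (quad S : QuadSpace S →ₗ[ℂ] _)

instance (S : Set ℝ) (W : ℝ → ℝ) (B : ℝ) : CompleteSpace (formSpace S W B) :=
  IsComplete.completeSpace_coe (IsClosed.isComplete
    ((Submodule.isClosed_topologicalClosure _).preimage (quad S).continuous))

noncomputable def formEmbedding (S : Set ℝ) (W : ℝ → ℝ) (B : ℝ) :
    formSpace S W B →L[ℂ] StateSpace S :=
  PiLp.proj 2 _ 0 ∘L (formSpace S W B).subtypeL

variable {W : ℝ → ℝ} {B : ℝ}

theorem formEmbedding_apply (x : formSpace S W B) : formEmbedding S W B x = (x : QuadSpace S) 0 :=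
  rfl

theorem mem_formSpace {x : QuadSpace S} :
    x ∈ formSpace S W B ↔ (x 0, x 1, x 2, x 3) ∈ (formCore S W B).topologicalClosure := Iff.rfl

theorem exists_formSpace_eq
    {Φ : StateSpace S × StateSpace S × StateSpace S × StateSpace S}
    (hΦ : Φ ∈ (formCore S W B).topologicalClosure) :
    ∃ x : formSpace S W B, (x : QuadSpace S) 0 = Φ.1 ∧ (x : QuadSpace S) 1 = Φ.2.1 ∧
      (x : QuadSpace S) 2 = Φ.2.2.1 ∧ (x : QuadSpace S) 3 = Φ.2.2.2 :=
  ⟨⟨WithLp.toLp 2 ![Φ.1, Φ.2.1, Φ.2.2.1, Φ.2.2.2], hΦ⟩, rfl, rfl, rfl, rfl⟩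

theorem inner_formSpace (x y : formSpace S W B) :
    inner ℂ x y = inner ℂ ((x : QuadSpace S) 0) ((y : QuadSpace S) 0)
      + (inner ℂ ((x : QuadSpace S) 1) ((y : QuadSpace S) 1)
      + inner ℂ ((x : QuadSpace S) 2) ((y : QuadSpace S) 2)
      + inner ℂ ((x : QuadSpace S) 3) ((y : QuadSpace S) 3)) := by
  rw [Submodule.coe_inner, PiLp.inner_apply, Fin.sum_univ_four]
  ring

theorem norm_sq_formSpace (x : formSpace S W B) :
    ‖x‖ ^ 2 = ‖(x : QuadSpace S) 0‖ ^ 2 + (‖(x : QuadSpace S) 1‖ ^ 2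
      + ‖(x : QuadSpace S) 2‖ ^ 2 + ‖(x : QuadSpace S) 3‖ ^ 2) := by
  rw [← Submodule.norm_coe, PiLp.norm_sq_eq_of_L2, Fin.sum_univ_four]
  ring

/-- Adding `⟨φ, ψ⟩` to both sides of the weak equation for `H₀ ψ = f` turns its left side into the
inner product of the form space. The equation then reads `y = J*(f + ψ)`, so that `J J*` plays the
role of `(H₀ + 1)⁻¹` and `k` that of `(H₀ + 1) ψ`. -/
theorem mem_freeGraph_iff {p : StateSpace S × StateSpace S} :
    p ∈ freeGraph S W B ↔ ∃ k, p = (formEmbedding S W B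
        (ContinuousLinearMap.adjoint (formEmbedding S W B) k),
      k - formEmbedding S W B (ContinuousLinearMap.adjoint (formEmbedding S W B) k)) := by
  constructor
  · rintro ⟨Ψ, hΨ, h1, h2⟩
    obtain ⟨y, y0, y1, y2, y3⟩ := exists_formSpace_eq hΨ
    have key : ∀ x : formSpace S W B,
        inner ℂ x y = inner ℂ (formEmbedding S W B x) (p.2 + p.1) := by
      intro x
      rw [inner_formSpace, formEmbedding_apply, y0, y1, y2, y3, h1, inner_add_right, add_comm]
      congr 1
      -- The weak equation is assumed only against test functions; both sides are continuous, so it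
      -- extends to the whole form domain.
      refine closure_minimal (t := {Φ : StateSpace S × StateSpace S × StateSpace S × StateSpace S |
        inner ℂ Φ.2.1 Ψ.2.1 + inner ℂ Φ.2.2.1 Ψ.2.2.1 + inner ℂ Φ.2.2.2 Ψ.2.2.2
          = inner ℂ Φ.1 p.2}) (fun Φ hΦ => h2 Φ hΦ) (isClosed_eq (by fun_prop) (by fun_prop))
        (mem_formSpace.1 x.2)
    have hy : y = ContinuousLinearMap.adjoint (formEmbedding S W B) (p.2 + p.1) := by
      refine ext_inner_left ℂ fun x => ?_
      rw [key, ContinuousLinearMap.adjoint_inner_right]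
    have hp : formEmbedding S W B y = p.1 := y0.trans h1
    refine ⟨p.2 + p.1, ?_⟩
    rw [← hy, hp, add_sub_cancel_right]
  · rintro ⟨k, rfl⟩
    set y := ContinuousLinearMap.adjoint (formEmbedding S W B) k with hy
    refine ⟨_, mem_formSpace.1 y.2, rfl, fun Φ hΦ => ?_⟩
    obtain ⟨x, x0, x1, x2, x3⟩ :=
      exists_formSpace_eq ((formCore S W B).le_topologicalClosure hΦ)
    have h1 : inner ℂ x y = inner ℂ (formEmbedding S W B x) k := by
      rw [hy, ContinuousLinearMap.adjoint_inner_right]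
    rw [inner_formSpace, formEmbedding_apply, x0, x1, x2, x3] at h1
    rw [inner_sub_right, ← h1, formEmbedding_apply, add_sub_cancel_left]

/-- The bounded part is `U - 1` because the form norm already contains `‖ψ‖²`, that is, it describes
`H₀ + 1`. -/
theorem isFormOperator_hamiltonian (hS : IsOpen S) (hW : LocallyIntegrableOn W S volume)
    (U : Lp ℝ ⊤ (stripMeasure S)) :
    IsFormOperator (formEmbedding S W B) (mulCLM U - 1) (hamiltonian S W U B) where
  selfAdjoint := (isSelfAdjoint_mulCLM U).sub (IsSelfAdjoint.one _)
  mem_domain ψ := by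
    change ψ ∈ (freeHamiltonian S W B).domain ↔ _
    rw [LinearPMap.mem_domain_iff]
    simp only [freeHamiltonian_graph hS hW, mem_freeGraph_iff, Prod.mk.injEq]
    constructor
    · rintro ⟨_, k, hk, -⟩
      exact ⟨k, hk.symm⟩
    · rintro ⟨k, hk⟩
      exact ⟨_, k, hk.symm, rfl⟩
  apply k h := by
    set ψ := formEmbedding S W B (ContinuousLinearMap.adjoint (formEmbedding S W B) k) with hψ
    have h1 : (ψ, k - ψ) ∈ (freeHamiltonian S W B).graph := by
      rw [freeHamiltonian_graph hS hW]
      exact mem_freeGraph_iff.2 ⟨k, rfl⟩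
    have h2 : (freeHamiltonian S W B) ⟨ψ, h⟩ = k - ψ :=
      (LinearPMap.image_iff (f := freeHamiltonian S W B) h).2 h1 |>.symm
    change (freeHamiltonian S W B) ⟨ψ, h⟩ + mulCLM U ψ = _
    rw [h2, sub_apply, one_apply_eq_self]
    abel

/-- The quadratic form of `H_U(B)` at a test function. -/
noncomputable def energy (S : Set ℝ) (W : ℝ → ℝ) (U : ℝ × ℝ → ℝ) (B : ℝ) (φ : ℝ × ℝ → ℂ) : ℝ :=
  (∫ z in strip S, ‖magDeriv B φ z‖ ^ 2) + (∫ z in strip S, ‖transDeriv φ z‖ ^ 2)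
    + (∫ z in strip S, ‖sqrtMul W φ z‖ ^ 2) + ∫ z in strip S, U z * ‖φ z‖ ^ 2

theorem form_eq_energy (U : Lp ℝ ⊤ (stripMeasure S))
    {Φ : StateSpace S × StateSpace S × StateSpace S × StateSpace S} {φ : ℝ × ℝ → ℂ}
    (h1 : Φ.1 =ᵐ[stripMeasure S] φ)
    (h2 : Φ.2.1 =ᵐ[stripMeasure S] magDeriv B φ) (h3 : Φ.2.2.1 =ᵐ[stripMeasure S] transDeriv φ)
    (h4 : Φ.2.2.2 =ᵐ[stripMeasure S] sqrtMul W φ) :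
    ‖Φ.2.1‖ ^ 2 + ‖Φ.2.2.1‖ ^ 2 + ‖Φ.2.2.2‖ ^ 2 + (inner ℂ Φ.1 (mulCLM U Φ.1)).re
      = energy S W U B φ := by
  have e : ∀ (f : StateSpace S) (g : ℝ × ℝ → ℂ), f =ᵐ[stripMeasure S] g →
      ‖f‖ ^ 2 = ∫ z in strip S, ‖g z‖ ^ 2 := fun f g h => by
    rw [norm_sq_eq_integral]
    refine integral_congr_ae ?_
    filter_upwards [h] with z hz
    rw [hz]
  rw [energy, e _ _ h2, e _ _ h3, e _ _ h4, re_inner_mulCLM]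
  congr 1
  refine integral_congr_ae ?_
  filter_upwards [h1] with z hz
  rw [hz]

theorem norm_sq_add_inner_mulCLM_sub_one (U : Lp ℝ ⊤ (stripMeasure S)) (x : formSpace S W B) :
    ‖x‖ ^ 2 + (inner ℂ (formEmbedding S W B x)
        ((mulCLM U - 1) (formEmbedding S W B x))).re
      = ‖(x : QuadSpace S) 1‖ ^ 2 + ‖(x : QuadSpace S) 2‖ ^ 2 + ‖(x : QuadSpace S) 3‖ ^ 2
        + (inner ℂ ((x : QuadSpace S) 0) (mulCLM U ((x : QuadSpace S) 0))).re := by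
  rw [norm_sq_formSpace, formEmbedding_apply, sub_apply, one_apply_eq_self, inner_sub_right,
    Complex.sub_re, inner_self_eq_norm_sq_to_K]
  simp only [Complex.coe_algebraMap, ← Complex.ofReal_pow, Complex.ofReal_re]
  ring

/-- The discrete spectrum is non-empty if a test function has energy below `l`, where the energy is
bounded from below by `l` up to finitely many averages. -/
theorem discreteSpectrum_nonempty_of_test (hS : IsOpen S) (hW : LocallyIntegrableOn W S volume)
    (U : Lp ℝ ⊤ (stripMeasure S)) {l : ℝ} {m : ℕ} {A : Fin m → Set (ℝ × ℝ)} {c : ℝ}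
    (hA : ∀ j, MeasurableSet (A j)) (hA' : ∀ j, volume (A j) ≠ ⊤) (hc : 0 ≤ c)
    (hl : ∀ φ, IsTest S φ → l * ∫ z in strip S, ‖φ z‖ ^ 2
      ≤ energy S W U B φ + c * ∑ j, ‖∫ z in A j ∩ strip S, φ z‖ ^ 2)
    (hex : ∃ φ, IsTest S φ ∧ energy S W U B φ < l * ∫ z in strip S, ‖φ z‖ ^ 2) :
    (discreteSpectrum (hamiltonian S W U B)).Nonempty := by
  have hA2 : ∀ j, stripMeasure S (A j) ≠ ⊤ := fun j =>
    ne_top_of_le_ne_top (hA' j) (Measure.restrict_apply_le _ _)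
  -- The factor `√c` makes `‖⟨fⱼ, ψ⟩‖²` equal to `c` times the squared integral over `A j`.
  let f : Fin m → StateSpace S := fun j => indicatorConstLp 2 (hA j) (hA2 j) ((√c : ℝ) : ℂ)
  have hf : ∀ j (ψ : StateSpace S) (φ : ℝ × ℝ → ℂ), ψ =ᵐ[stripMeasure S] φ →
      ‖inner ℂ (f j) ψ‖ ^ 2 = c * ‖∫ z in A j ∩ strip S, φ z‖ ^ 2 := by
    intro j ψ φ h
    have h1 := L2.inner_indicatorConstLp_eq_inner_setIntegral ℂ (hA j) (hA2 j) ((√c : ℝ) : ℂ) ψ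
    rw [h1, RCLike.inner_apply, Complex.conj_ofReal, norm_mul, Complex.norm_real, mul_pow,
      Real.norm_eq_abs, sq_abs, Real.sq_sqrt hc, mul_comm, Measure.restrict_restrict (hA j)]
    congr 3
    refine integral_congr_ae ?_
    rw [← Measure.restrict_restrict (hA j)]
    exact ae_restrict_of_ae h
  refine (isFormOperator_hamiltonian (B := B) hS hW U).discreteSpectrum_nonempty (f := f) (l := l)
    (fun x => ?_) ?_
  · rw [norm_sq_add_inner_mulCLM_sub_one, formEmbedding_apply]
    -- All terms of the bound are continuous in the quadruple, so it passes from test functions to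
    -- the closure.
    refine closure_minimal (t := {Φ : StateSpace S × StateSpace S × StateSpace S × StateSpace S |
      l * ‖Φ.1‖ ^ 2 ≤ ‖Φ.2.1‖ ^ 2 + ‖Φ.2.2.1‖ ^ 2 + ‖Φ.2.2.2‖ ^ 2
        + (inner ℂ Φ.1 (mulCLM U Φ.1)).re + ∑ j, ‖inner ℂ (f j) Φ.1‖ ^ 2}) ?_
      (isClosed_le (by fun_prop) (by fun_prop)) (mem_formSpace.1 x.2)
    rintro Φ ⟨φ, hφ, h1, h2, h3, h4⟩
    simp only [Set.mem_ofPred_eq]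
    rw [form_eq_energy U h1 h2 h3 h4, norm_sq_eq_integral]
    simp only [fun j => hf j Φ.1 φ h1, ← Finset.mul_sum]
    refine le_of_eq_of_le ?_ (hl φ hφ)
    congr 1
    refine integral_congr_ae ?_
    filter_upwards [h1] with z hz
    rw [hz]
  · obtain ⟨φ, hφ, hlt⟩ := hex
    have i1 : MemLp φ 2 (stripMeasure S) :=
      (hφ.smooth.continuous.memLp_of_hasCompactSupport hφ.compact).mono_measure
        Measure.restrict_le_self
    have i2 : MemLp (magDeriv B φ) 2 (stripMeasure S) :=
      (hφ.continuous_magDeriv.memLp_of_hasCompactSupport hφ.compact_magDeriv).mono_measure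
        Measure.restrict_le_self
    have i3 : MemLp (transDeriv φ) 2 (stripMeasure S) :=
      (hφ.continuous_transDeriv.memLp_of_hasCompactSupport hφ.compact_transDeriv).mono_measure
        Measure.restrict_le_self
    have i4 := hφ.memLp_sqrtMul hW
    let Φ : StateSpace S × StateSpace S × StateSpace S × StateSpace S :=
      (i1.toLp, i2.toLp, i3.toLp, i4.toLp)
    have hΦ : Φ ∈ formCore S W B := ⟨φ, hφ, i1.coeFn_toLp, i2.coeFn_toLp, i3.coeFn_toLp,
      i4.coeFn_toLp⟩
    obtain ⟨x, x0, x1, x2, x3⟩ :=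
      exists_formSpace_eq ((formCore S W B).le_topologicalClosure hΦ)
    refine ⟨x, ?_⟩
    rw [norm_sq_add_inner_mulCLM_sub_one, formEmbedding_apply, x0, x1, x2, x3,
      form_eq_energy U i1.coeFn_toLp i2.coeFn_toLp i3.coeFn_toLp i4.coeFn_toLp,
      norm_sq_eq_integral]
    refine hlt.trans_eq ?_
    congr 1
    refine integral_congr_ae ?_
    filter_upwards [i1.coeFn_toLp] with z hz
    rw [hz]

end FormSpace

/-! ### The geometry of the wire and the strength of the confinement. -/

/-- The standing hypotheses on the cross-section `S` and on the lateral confinement `W`. -/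
structure IsWire (S : Set ℝ) (W : ℝ → ℝ) : Prop where
  shape : (∃ a : ℝ, 0 < a ∧ S = Set.Ioo (-a) a) ∨ S = Set.univ
  locallyIntegrable : LocallyIntegrableOn W S volume
  confining : ∃ c : ℝ, 0 ≤ c ∧ (S = Set.univ → 0 < c) ∧ ∀ y ∈ S, c * y ^ 2 ≤ W y

namespace IsWire

variable {S : Set ℝ} {W : ℝ → ℝ}

theorem isOpen (h : IsWire S W) : IsOpen S := by
  rcases h.shape with ⟨a, -, rfl⟩ | rfl
  · exact isOpen_Ioo
  · exact isOpen_univ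

theorem zero_mem (h : IsWire S W) : (0 : ℝ) ∈ S := by
  rcases h.shape with ⟨a, ha, rfl⟩ | rfl
  · exact ⟨neg_lt_zero.2 ha, ha⟩
  · trivial

theorem exists_gt (h : IsWire S W) {r : ℝ} (hr : r ∈ S) : ∃ r' ∈ S, r < r' := by
  rcases h.shape with ⟨a, -, rfl⟩ | rfl
  · obtain ⟨r', h1, h2⟩ := exists_between hr.2
    exact ⟨r', ⟨hr.1.trans h1, h2⟩, h1⟩
  · exact ⟨r + 1, trivial, lt_add_one r⟩

theorem mem_of_abs_le (h : IsWire S W) {r y : ℝ} (hr : r ∈ S) (hy : |y| ≤ r) : y ∈ S := by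
  rcases h.shape with ⟨a, -, rfl⟩ | rfl
  · exact ⟨by linarith [(abs_le.1 hy).1, hr.2], (abs_le.1 hy).2.trans_lt hr.2⟩
  · trivial

theorem abs_mem (h : IsWire S W) {y : ℝ} (hy : y ∈ S) : |y| ∈ S := by
  rcases h.shape with ⟨a, -, rfl⟩ | rfl
  · exact ⟨by linarith [abs_nonneg y, hy.1, hy.2], abs_lt.2 hy⟩
  · trivial

theorem nonneg (h : IsWire S W) {y : ℝ} (hy : y ∈ S) : 0 ≤ W y := by
  obtain ⟨c, hc, -, hW⟩ := h.confining
  exact (mul_nonneg hc (sq_nonneg y)).trans (hW y hy)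

/-- The common substitute for the two cases: `y²` is bounded on a bounded cross-section, and `W`
itself controls `y²` on the line. It serves both to bound momenta and to control `U` at large `|y|`.
-/
theorem exists_sq_le (h : IsWire S W) : ∃ M, 0 < M ∧ ∀ y ∈ S, y ^ 2 ≤ M * (1 + W y) := by
  have h0 : ∀ y ∈ S, 0 ≤ W y := fun y hy => h.nonneg hy
  obtain ⟨c, hc, hc', hW⟩ := h.confining
  rcases h.shape with ⟨a, ha, rfl⟩ | rfl
  · refine ⟨a ^ 2, by positivity, fun y hy => ?_⟩
    have h1 : y ^ 2 ≤ a ^ 2 := sq_le_sq' hy.1.le hy.2.le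
    nlinarith [h0 y hy, mul_nonneg (sq_nonneg a) (h0 y hy)]
  · have hc0 := hc' rfl
    refine ⟨1 / c, by positivity, fun y hy => ?_⟩
    rw [div_mul_eq_mul_div, one_mul, le_div_iff₀ hc0]
    linarith [hW y hy]

end IsWire

/-! ### Transverse test functions and the fiber forms. -/

/-- Real test functions on the cross-section. -/
structure IsTest₁ (S : Set ℝ) (g : ℝ → ℝ) : Prop where
  smooth : ContDiff ℝ ∞ g
  compact : HasCompactSupport g
  supp : tsupport g ⊆ S

/-- The effective potential of the fiber at momentum `p`. -/
def pot (W : ℝ → ℝ) (B p y : ℝ) : ℝ := (p - B * y) ^ 2 + W y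

/-- The quadratic form of the fiber operator at momentum `p`. -/
noncomputable def fiberForm (W : ℝ → ℝ) (B p : ℝ) (g : ℝ → ℝ) : ℝ :=
  ∫ y, deriv g y ^ 2 + pot W B p y * g y ^ 2

/-- The ground state energy of the fibers. -/
noncomputable def groundEnergy (S : Set ℝ) (W : ℝ → ℝ) (B : ℝ) : ℝ :=
  sSup {l | ∀ p g, IsTest₁ S g → l * ∫ y, g y ^ 2 ≤ fiberForm W B p g}

theorem hasCompactSupport_sq {f : ℝ → ℝ} (hf : HasCompactSupport f) :
    HasCompactSupport fun y => f y ^ 2 := by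
  simp only [sq]
  exact hf.mul_right

theorem integrable_mul_of_support {S : Set ℝ} {V : ℝ → ℝ} (hV : LocallyIntegrableOn V S volume)
    {f : ℝ → ℝ} (hf : Continuous f) (hc : HasCompactSupport f) (hs : tsupport f ⊆ S) :
    Integrable (fun y => V y * f y) := by
  have h1 : IntegrableOn V (tsupport f) := hV.integrableOn_compact_subset hs hc
  have h2 : IntegrableOn (fun y => V y * f y) (tsupport f) :=
    h1.mul_continuousOn hf.continuousOn hc
  refine (integrableOn_iff_integrable_of_support_subset fun y hy => ?_).1 h2
  exact subset_tsupport _ (right_ne_zero_of_mul hy)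

theorem locallyIntegrableOn_pot {S : Set ℝ} {W : ℝ → ℝ} (hS : IsOpen S)
    (hW : LocallyIntegrableOn W S volume)
    (B p : ℝ) : LocallyIntegrableOn (pot W B p) S volume :=
  ((by fun_prop : Continuous fun y => (p - B * y) ^ 2).continuousOn.locallyIntegrableOn
    hS.measurableSet).add hW

namespace IsTest₁

variable {S : Set ℝ} {W : ℝ → ℝ} {g h : ℝ → ℝ} {B p : ℝ}

theorem differentiable (hg : IsTest₁ S g) : Differentiable ℝ g :=
  hg.smooth.differentiable (by simp)

theorem continuous_deriv (hg : IsTest₁ S g) : Continuous (deriv g) :=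
  hg.smooth.continuous_deriv (by simp)

theorem add (hg : IsTest₁ S g) (hh : IsTest₁ S h) : IsTest₁ S (g + h) :=
  ⟨hg.smooth.add hh.smooth, hg.compact.add hh.compact,
    (tsupport_add g h).trans (Set.union_subset hg.supp hh.supp)⟩

theorem const_mul (hg : IsTest₁ S g) (t : ℝ) : IsTest₁ S (fun y => t * g y) :=
  ⟨contDiff_const.mul hg.smooth, hg.compact.mul_left, (tsupport_mul_subset_right).trans hg.supp⟩

theorem mul_left (hg : IsTest₁ S g) (hh : ContDiff ℝ ∞ h) : IsTest₁ S (fun y => h y * g y) :=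
  ⟨hh.mul hg.smooth, hg.compact.mul_left, (tsupport_mul_subset_right).trans hg.supp⟩

theorem integrable_deriv_sq (hg : IsTest₁ S g) : Integrable fun y => deriv g y ^ 2 := by
  have h := hg.continuous_deriv
  exact Continuous.integrable_of_hasCompactSupport (by fun_prop)
    (hasCompactSupport_sq hg.compact.deriv)

theorem integrable_sq (hg : IsTest₁ S g) : Integrable fun y => g y ^ 2 := by
  have h := hg.smooth.continuous
  exact Continuous.integrable_of_hasCompactSupport (by fun_prop) (hasCompactSupport_sq hg.compact)

theorem integrable_abs (hg : IsTest₁ S g) : Integrable fun y => |g y| :=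
  (hg.smooth.continuous.integrable_of_hasCompactSupport hg.compact).abs

theorem integrable_mul_sq (hg : IsTest₁ S g) {V : ℝ → ℝ} (hV : LocallyIntegrableOn V S volume) :
    Integrable fun y => V y * g y ^ 2 :=
  integrable_mul_of_support hV (hg.smooth.continuous.pow 2)
    (hg.compact.comp_left (g := fun t : ℝ => t ^ 2) (by simp))
    ((tsupport_comp_subset (g := fun t : ℝ => t ^ 2) (by simp) g).trans hg.supp)

theorem integrable_fiberForm (hg : IsTest₁ S g) (hw : IsWire S W) (B p : ℝ) :
    Integrable fun y => deriv g y ^ 2 + pot W B p y * g y ^ 2 :=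
  hg.integrable_deriv_sq.add
    (hg.integrable_mul_sq (locallyIntegrableOn_pot hw.isOpen hw.locallyIntegrable B p))

theorem eq_zero_of_notMem (hg : IsTest₁ S g) {y : ℝ} (hy : y ∉ S) : g y = 0 :=
  image_eq_zero_of_notMem_tsupport fun h => hy (hg.supp h)

/-- Nothing is known about `W` off `S`, but `g` vanishes there. -/
theorem mul_sq_nonneg (hg : IsTest₁ S g) (hw : IsWire S W) (y : ℝ) : 0 ≤ W y * g y ^ 2 := by
  by_cases hy : y ∈ S
  · exact mul_nonneg (hw.nonneg hy) (sq_nonneg _)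
  · simp [hg.eq_zero_of_notMem hy]

theorem fiberForm_nonneg (hg : IsTest₁ S g) (hw : IsWire S W) (B p : ℝ) :
    0 ≤ fiberForm W B p g := by
  refine integral_nonneg fun y => ?_
  have := hg.mul_sq_nonneg hw y
  simp only [pot, Pi.zero_apply, add_mul]
  positivity

end IsTest₁

/-- The smooth cut-off function with value `1` on `[-r, r]` and support in `[-r', r']`. -/
theorem IsWire.exists_cutoff {S : Set ℝ} {W : ℝ → ℝ} (hw : IsWire S W) {r : ℝ} (hr0 : 0 < r)
    (hr : r ∈ S) : ∃ χ, IsTest₁ S χ ∧ (∀ y, 0 ≤ χ y) ∧ (∀ y, χ y ≤ 1) ∧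
      ∀ y, |y| ≤ r → χ y = 1 := by
  obtain ⟨r', hr', hlt⟩ := hw.exists_gt hr
  let b : ContDiffBump (0 : ℝ) := ⟨r, r', hr0, hlt⟩
  refine ⟨b, ⟨b.contDiff, b.hasCompactSupport, ?_⟩, fun y => b.nonneg, fun y => b.le_one,
    fun y hy => b.one_of_mem_closedBall (by simpa [Metric.mem_closedBall] using hy)⟩
  rw [b.tsupport_eq]
  intro y hy
  exact hw.mem_of_abs_le hr' (by simpa [Metric.mem_closedBall] using hy)

/-! ### Near-minimizers of the fiber forms and their logarithmic derivatives. -/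

section GroundEnergy

variable {S : Set ℝ} {W : ℝ → ℝ} {B : ℝ}

theorem exists_test_pos (hw : IsWire S W) : ∃ g, IsTest₁ S g ∧ 0 < ∫ y, g y ^ 2 := by
  obtain ⟨r, hr, hr0⟩ := hw.exists_gt hw.zero_mem
  obtain ⟨χ, hχ, -, -, h1⟩ := hw.exists_cutoff hr0 hr
  refine ⟨χ, hχ, ?_⟩
  refine (integral_pos_iff_support_of_nonneg (fun y => sq_nonneg (χ y)) hχ.integrable_sq).2 ?_
  have hsub : Set.Icc (-r) r ⊆ Function.support fun y => χ y ^ 2 := by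
    intro y hy
    simp [h1 y (abs_le.2 hy)]
  refine lt_of_lt_of_le ?_ (measure_mono hsub)
  rw [Real.volume_Icc]
  simp [hr0]

theorem groundEnergy_mul_le (hw : IsWire S W) {g : ℝ → ℝ} (hg : IsTest₁ S g) (p : ℝ) :
    groundEnergy S W B * ∫ y, g y ^ 2 ≤ fiberForm W B p g := by
  have h0 : 0 ≤ ∫ y, g y ^ 2 := integral_nonneg fun y => sq_nonneg _
  rcases h0.eq_or_lt with h0 | h0
  · rw [← h0, mul_zero]
    exact hg.fiberForm_nonneg hw B p
  · rw [← le_div_iff₀ h0]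
    refine csSup_le ⟨0, fun q f hf => ?_⟩ fun l hl => (le_div_iff₀ h0).2 (hl p g hg)
    rw [zero_mul]
    exact hf.fiberForm_nonneg hw B q

theorem bddAbove_lowerBounds (hw : IsWire S W) (B : ℝ) :
    BddAbove {l | ∀ p g, IsTest₁ S g → l * ∫ y, g y ^ 2 ≤ fiberForm W B p g} := by
  obtain ⟨g, hg, h0⟩ := exists_test_pos hw
  exact ⟨fiberForm W B 0 g / ∫ y, g y ^ 2, fun l hl => (le_div_iff₀ h0).2 (hl 0 g hg)⟩

theorem groundEnergy_nonneg (hw : IsWire S W) : 0 ≤ groundEnergy S W B := by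
  refine le_csSup (bddAbove_lowerBounds hw B) fun p g hg => ?_
  rw [zero_mul]
  exact hg.fiberForm_nonneg hw B p

theorem exists_fiberForm_lt (hw : IsWire S W) {e : ℝ} (he : groundEnergy S W B < e) :
    ∃ p g, IsTest₁ S g ∧ fiberForm W B p g < e * ∫ y, g y ^ 2 := by
  by_contra hc
  push Not at hc
  exact absurd (le_csSup (bddAbove_lowerBounds hw B) hc) (not_le.2 he)

/-- A nonnegative smoothing of `|g|`. -/
theorem exists_smooth_abs {g : ℝ → ℝ} (hg : IsTest₁ S g) {ε : ℝ} (hε : 0 < ε) :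
    ∃ f, IsTest₁ S f ∧ (∀ y, 0 ≤ f y) ∧ (∀ y, deriv f y ^ 2 ≤ deriv g y ^ 2) ∧
      (∀ y, f y ^ 2 ≤ g y ^ 2) ∧ ∀ y, g y ^ 2 - 2 * ε * |g y| ≤ f y ^ 2 := by
  have hpos : ∀ y, 0 < g y ^ 2 + ε ^ 2 := fun y => by positivity
  have hs1 : ∀ y, ε ≤ √(g y ^ 2 + ε ^ 2) := fun y => by
    rw [Real.le_sqrt hε.le (hpos y).le]
    linarith [sq_nonneg (g y)]
  have hs2 : ∀ y, √(g y ^ 2 + ε ^ 2) ≤ |g y| + ε := fun y => by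
    rw [Real.sqrt_le_left (by positivity), ← sq_abs (g y)]
    nlinarith [mul_nonneg (abs_nonneg (g y)) hε.le]
  -- The square root is smooth since `ε > 0`, and subtracting `ε` makes the function vanish wherever
  -- `g` does, so the support does not grow.
  refine ⟨fun y => √(g y ^ 2 + ε ^ 2) - ε, ⟨?_, ?_, ?_⟩, fun y => sub_nonneg.2 (hs1 y),
    fun y => ?_, fun y => ?_, fun y => ?_⟩
  · exact (((hg.smooth.pow 2).add contDiff_const).sqrt fun y => (hpos y).ne').sub contDiff_const
  · exact hg.compact.comp_left (g := fun t : ℝ => √(t ^ 2 + ε ^ 2) - ε)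
      (by simp [Real.sqrt_sq hε.le])
  · exact (tsupport_comp_subset (g := fun t : ℝ => √(t ^ 2 + ε ^ 2) - ε)
      (by simp [Real.sqrt_sq hε.le]) g).trans hg.supp
  · have hd : HasDerivAt (fun y => √(g y ^ 2 + ε ^ 2) - ε)
        ((2 * g y ^ (2 - 1) * deriv g y) / (2 * √(g y ^ 2 + ε ^ 2))) y := by
      have h1 := ((hg.differentiable y).hasDerivAt.pow 2).add_const (ε ^ 2)
      exact (h1.sqrt (hpos y).ne').sub_const ε
    rw [hd.deriv]
    have e : (2 * g y ^ (2 - 1) * deriv g y) / (2 * √(g y ^ 2 + ε ^ 2))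
        = g y / √(g y ^ 2 + ε ^ 2) * deriv g y := by
      norm_num
      field_simp
    rw [e, mul_pow, div_pow, Real.sq_sqrt (hpos y).le]
    refine mul_le_of_le_one_left (sq_nonneg _) ?_
    rw [div_le_one (hpos y)]
    linarith [sq_nonneg ε]
  · rw [← sq_abs (g y)]
    exact pow_le_pow_left₀ (sub_nonneg.2 (hs1 y)) (by linarith [hs2 y]) 2
  · have h1 := Real.sq_sqrt (hpos y).le
    nlinarith [hs2 y]

/-- The nonnegative, approximately normalized functions whose energy is almost minimal. -/
structure IsNearMin (S : Set ℝ) (W : ℝ → ℝ) (B η p : ℝ) (g : ℝ → ℝ) : Prop where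
  test : IsTest₁ S g
  nonneg : ∀ y, 0 ≤ g y
  half_le : 1 / 2 ≤ ∫ y, g y ^ 2
  le_one : ∫ y, g y ^ 2 ≤ 1
  form_le : fiberForm W B p g ≤ groundEnergy S W B * (∫ y, g y ^ 2) + η

/-- A nearly optimal pair exists by definition of the infimum. After normalization, `g` is replaced
by a smoothing of `|g|`, which does not increase the form and loses little mass. -/
theorem exists_isNearMin (hw : IsWire S W) (B : ℝ) {η : ℝ} (hη : 0 < η) :
    ∃ p g, IsNearMin S W B η p g := by
  set L := groundEnergy S W B with hL
  have hL0 : 0 ≤ L := groundEnergy_nonneg hw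
  obtain ⟨p, g, hg, hlt⟩ := exists_fiberForm_lt (B := B) hw (lt_add_of_pos_right L (half_pos hη))
  have hN : 0 < ∫ y, g y ^ 2 := by
    have h0 : 0 ≤ ∫ y, g y ^ 2 := integral_nonneg fun y => sq_nonneg _
    refine lt_of_le_of_ne h0 fun h => ?_
    rw [← h, mul_zero] at hlt
    exact absurd (hg.fiberForm_nonneg hw B p) (not_le.2 hlt)
  set N := ∫ y, g y ^ 2
  set t := 1 / √N
  have ht : t ^ 2 * N = 1 := by
    rw [div_pow, one_pow, Real.sq_sqrt hN.le, one_div_mul_cancel hN.ne']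
  set g₁ : ℝ → ℝ := fun y => t * g y
  have hg₁ : IsTest₁ S g₁ := hg.const_mul t
  have n1 : ∫ y, g₁ y ^ 2 = 1 := by
    simp only [g₁, mul_pow]
    rw [integral_const_mul, ht]
  have f1 : fiberForm W B p g₁ ≤ L + η / 2 := by
    have e : fiberForm W B p g₁ = t ^ 2 * fiberForm W B p g := by
      rw [fiberForm, fiberForm, ← integral_const_mul]
      refine integral_congr_ae (Filter.Eventually.of_forall fun y => ?_)
      have hd : deriv g₁ y = t * deriv g y := deriv_const_mul _ (hg.differentiable y)
      simp only [hd, g₁]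
      ring
    rw [e]
    calc t ^ 2 * fiberForm W B p g ≤ t ^ 2 * ((L + η / 2) * N) := by gcongr
      _ = (L + η / 2) * (t ^ 2 * N) := by ring
      _ = _ := by rw [ht, mul_one]
  set D := ∫ y, |g₁ y|
  have hD : 0 ≤ D := integral_nonneg fun y => abs_nonneg _
  -- The smoothing loses mass at most `2εD`. The first term of the minimum keeps at least half of
  -- the mass; the second makes `L` times the loss at most `η / 2`.
  set ε := min (1 / 2) (η / (2 * (L + 1))) / (2 * (D + 1)) with hε
  have hmin : 0 < min (1 / 2) (η / (2 * (L + 1))) := lt_min (by norm_num) (by positivity)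
  have hε0 : 0 < ε := by positivity
  have hεD : 2 * ε * D ≤ min (1 / 2) (η / (2 * (L + 1))) := by
    have : 2 * ε * (D + 1) = min (1 / 2) (η / (2 * (L + 1))) := by
      rw [hε]
      field_simp
    nlinarith
  obtain ⟨f, hf, hf0, hfd, hfle, hfge⟩ := exists_smooth_abs hg₁ hε0
  have m1 : 1 - 2 * ε * D ≤ ∫ y, f y ^ 2 := by
    rw [← n1, ← integral_const_mul, ← integral_sub hg₁.integrable_sq
      (hg₁.integrable_abs.const_mul _)]
    exact integral_mono (hg₁.integrable_sq.sub (hg₁.integrable_abs.const_mul _)) hf.integrable_sq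
      hfge
  have m2 : ∫ y, f y ^ 2 ≤ 1 := by
    rw [← n1]
    exact integral_mono hf.integrable_sq hg₁.integrable_sq hfle
  have m3 : fiberForm W B p f ≤ fiberForm W B p g₁ := by
    refine integral_mono (hf.integrable_fiberForm hw B p) (hg₁.integrable_fiberForm hw B p)
      fun y => add_le_add (hfd y) ?_
    by_cases hy : y ∈ S
    · refine mul_le_mul_of_nonneg_left (hfle y) ?_
      have := hw.nonneg hy
      rw [pot]
      positivity
    · simp [hf.eq_zero_of_notMem hy, hg₁.eq_zero_of_notMem hy]
  refine ⟨p, f, hf, hf0, ?_, m2, ?_⟩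
  · linarith [min_le_left (1 / 2) (η / (2 * (L + 1)))]
  · have h1 : L * (2 * ε * D) ≤ η / 2 := by
      calc L * (2 * ε * D) ≤ L * (η / (2 * (L + 1))) := by
            gcongr
            exact hεD.trans (min_le_right _ _)
        _ ≤ (L + 1) * (η / (2 * (L + 1))) := by
            gcongr
            linarith
        _ = η / 2 := by field_simp
    nlinarith

/-- The local logarithmic derivative estimate behind Harnack's inequality. -/
theorem integral_log_deriv_le (hw : IsWire S W) {p ε : ℝ} (hε : 0 < ε) {g χ : ℝ → ℝ}
    (hg : IsNearMin S W B (ε ^ 2) p g) (hχ : IsTest₁ S χ) (hχ0 : ∀ y, 0 ≤ χ y)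
    (hχ1 : ∀ y, χ y ≤ 1) :
    ∫ y, (χ y * (deriv g y / (g y + ε))) ^ 2 ≤ 12 * (∫ y, deriv χ y ^ 2)
      + 5 * (∫ y, |pot W B p y - groundEnergy S W B| * χ y ^ 2) + 8 := by
  set L := groundEnergy S W B with hL
  set k : ℝ → ℝ := fun y => pot W B p y - L with hk
  have hgε : ∀ y, 0 < g y + ε := fun y => add_pos_of_nonneg_of_pos (hg.nonneg y) hε
  set w : ℝ → ℝ := fun y => deriv g y / (g y + ε) with hw'
  have cw : Continuous w :=
    hg.test.continuous_deriv.div (hg.test.smooth.continuous.add continuous_const)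
      fun y => (hgε y).ne'
  have hkloc : LocallyIntegrableOn k S volume :=
    (locallyIntegrableOn_pot hw.isOpen hw.locallyIntegrable B p).sub
      (continuous_const.continuousOn.locallyIntegrableOn hw.isOpen.measurableSet)
  -- Near-minimality is tested with `f = g + t χ² / (g + ε)`. The first variation produces `-(χ
  -- w)²`, the negative square of the localized logarithmic derivative. With this `t`, the second
  -- order term consumes only half of the remaining `-(1/4) ε² (χ w)²`, because `ε / (g + ε) ≤ 1`.
  set t := ε ^ 2 / 4 with ht
  set φ : ℝ → ℝ := fun y => (χ y / (g y + ε)) * χ y with hφdef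
  have hφ : IsTest₁ S φ := hχ.mul_left
    (hχ.smooth.div (hg.test.smooth.add contDiff_const) fun y => (hgε y).ne')
  have dφ : ∀ y, deriv φ y = (2 * χ y * deriv χ y - χ y ^ 2 * w y) / (g y + ε) := by
    intro y
    have h1 := (hχ.differentiable y).hasDerivAt
    have h2 := ((hg.test.differentiable y).hasDerivAt).add_const ε
    have h3 : HasDerivAt φ _ y := (h1.fun_div h2 (hgε y).ne').mul h1
    rw [h3.deriv, hw']
    have := (hgε y).ne'
    field_simp
    ring
  set f : ℝ → ℝ := g + fun y => t * φ y with hf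
  have hft : IsTest₁ S f := hg.test.add (hφ.const_mul t)
  have df : ∀ y, deriv f y = deriv g y + t * deriv φ y := by
    intro y
    have h1 := (hg.test.differentiable y).hasDerivAt
    have h2 := ((hφ.differentiable y).hasDerivAt).const_mul t
    exact (h1.add h2).deriv
  have i1 : Integrable fun y => (χ y * w y) ^ 2 := by
    have cχ := hχ.smooth.continuous
    exact Continuous.integrable_of_hasCompactSupport (by fun_prop)
      (hasCompactSupport_sq hχ.compact.mul_right)
  have i2 : Integrable fun y => |k y| * χ y ^ 2 := by
    refine (hχ.integrable_mul_sq hkloc).abs.congr (Filter.Eventually.of_forall fun y => ?_)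
    simp [abs_mul]
  have i3 : ∀ h, IsTest₁ S h → Integrable fun y => deriv h y ^ 2 + k y * h y ^ 2 := fun h hh =>
    hh.integrable_deriv_sq.add (hh.integrable_mul_sq hkloc)
  have form_eq : ∀ h, IsTest₁ S h → ∫ y, (deriv h y ^ 2 + k y * h y ^ 2)
      = fiberForm W B p h - L * ∫ y, h y ^ 2 := by
    intro h hh
    rw [fiberForm, ← integral_const_mul, ← integral_sub (hh.integrable_fiberForm hw B p)
      (hh.integrable_sq.const_mul L)]
    refine integral_congr_ae (Filter.Eventually.of_forall fun y => ?_)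
    simp only [hk]
    ring
  have key : ∀ y, deriv f y ^ 2 + k y * f y ^ 2 ≤ (deriv g y ^ 2 + k y * g y ^ 2)
      + ε ^ 2 * (-(1 / 8) * (χ y * w y) ^ 2 + 3 / 2 * deriv χ y ^ 2
        + 5 / 8 * (|k y| * χ y ^ 2)) := by
    intro y
    have hG := hgε y
    have hG0 := hg.nonneg y
    have h0 := hχ0 y
    have h1 := hχ1 y
    have e1 : deriv g y = w y * (g y + ε) := by
      rw [hw', div_mul_cancel₀ _ hG.ne']
    rw [df, dφ]
    simp only [hf, Pi.add_apply, hφdef, ht]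
    set G := g y + ε with hGdef
    have hGε : ε ≤ G := by linarith
    set c := χ y
    set d := deriv χ y
    set v := w y
    -- first order term
    have a1 : deriv g y * ((2 * c * d - c ^ 2 * v) / G) = 2 * c * d * v - c ^ 2 * v ^ 2 := by
      rw [e1]
      field_simp
    have a2 : k y * g y * (c / G * c) ≤ |k y| * c ^ 2 := by
      have : g y / G ≤ 1 := (div_le_one hG).2 (by linarith)
      have h3 : 0 ≤ g y / G := div_nonneg hG0 hG.le
      calc k y * g y * (c / G * c) = k y * (g y / G) * c ^ 2 := by ring
        _ ≤ |k y| * 1 * c ^ 2 := by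
          gcongr
          exact le_abs_self _
        _ = _ := by ring
    have a3 : 2 * c * d * v ≤ 1 / 2 * (c * v) ^ 2 + 2 * d ^ 2 := by
      nlinarith [sq_nonneg (c * v - 2 * d)]
    -- second order term
    have hGi : ε ^ 2 / G ^ 2 ≤ 1 := (div_le_one (by positivity)).2 (by gcongr)
    have hc2 : c ^ 2 ≤ 1 := by nlinarith
    have b1 : ε ^ 2 * ((2 * c * d - c ^ 2 * v) / G) ^ 2 ≤ 8 * d ^ 2 + 2 * (c * v) ^ 2 := by
      calc ε ^ 2 * ((2 * c * d - c ^ 2 * v) / G) ^ 2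
          = (ε ^ 2 / G ^ 2) * (c ^ 2 * (2 * d - c * v) ^ 2) := by
            field_simp
        _ ≤ 1 * (1 * (2 * d - c * v) ^ 2) := by gcongr
        _ ≤ _ := by nlinarith [sq_nonneg (2 * d + c * v)]
    have b2 : ε ^ 2 * (k y * (c / G * c) ^ 2) ≤ |k y| * c ^ 2 := by
      calc ε ^ 2 * (k y * (c / G * c) ^ 2) = (ε ^ 2 / G ^ 2) * (k y * (c ^ 2 * c ^ 2)) := by
            field_simp
        _ ≤ (ε ^ 2 / G ^ 2) * (|k y| * (1 * c ^ 2)) := by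
            gcongr
            exact le_abs_self _
        _ ≤ 1 * (|k y| * (1 * c ^ 2)) := by gcongr
        _ = _ := by ring
    have hε2 : 0 ≤ ε ^ 2 := sq_nonneg ε
    have s1 : deriv g y * ((2 * c * d - c ^ 2 * v) / G) + k y * g y * (c / G * c)
        ≤ -(1 / 2) * (c * v) ^ 2 + 2 * d ^ 2 + |k y| * c ^ 2 := by
      rw [a1]
      nlinarith
    have s2 := mul_le_mul_of_nonneg_left s1 hε2
    have s3 := mul_le_mul_of_nonneg_left (add_le_add b1 b2) hε2
    have hkc : 0 ≤ ε ^ 2 * (|k y| * c ^ 2) := by positivity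
    nlinarith
  have j1 : Integrable fun y => -(1 / 8) * (χ y * w y) ^ 2 + 3 / 2 * deriv χ y ^ 2 :=
    (i1.const_mul _).add (hχ.integrable_deriv_sq.const_mul _)
  have j2 : Integrable fun y => -(1 / 8) * (χ y * w y) ^ 2 + 3 / 2 * deriv χ y ^ 2
      + 5 / 8 * (|k y| * χ y ^ 2) := j1.add (i2.const_mul _)
  have hint := integral_mono (i3 f hft) ((i3 g hg.test).add (j2.const_mul (ε ^ 2))) key
  simp only [Pi.add_apply] at hint
  rw [integral_add (i3 g hg.test) (j2.const_mul (ε ^ 2)), integral_const_mul,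
    integral_add j1 (i2.const_mul _),
    integral_add (i1.const_mul _) (hχ.integrable_deriv_sq.const_mul _),
    integral_const_mul, integral_const_mul, integral_const_mul, form_eq f hft,
    form_eq g hg.test] at hint
  have hpos := groundEnergy_mul_le (B := B) hw hft p
  have hmin := hg.form_le
  have hε2 : 0 < ε ^ 2 := by positivity
  -- The form of `f` minus `L` times its mass is nonnegative, whereas for `g` it is at most `ε²`.
  -- Since the gain also carries a factor `ε²`, division yields a bound uniform in `ε`, and the
  -- excess becomes the constant `8`.
  have hfin : 0 ≤ ε ^ 2 * (1 + (-(1 / 8) * (∫ y, (χ y * w y) ^ 2)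
      + 3 / 2 * (∫ y, deriv χ y ^ 2) + 5 / 8 * ∫ y, |k y| * χ y ^ 2)) := by
    rw [mul_add, mul_one]
    linarith
  have hfin' := nonneg_of_mul_nonneg_right hfin hε2
  linarith

end GroundEnergy

/-! ### Tightness, Harnack's inequality and uniform positivity of near-minimizers. -/

section Harnack

variable {S : Set ℝ} {W : ℝ → ℝ} {B : ℝ}

/-- On a bounded cross-section the energy bounds `sup g²`, so a thin layer at the boundary carries
little mass. On the line, `W ≥ c r²` outside `[-r, r]` and the energy bound limits the mass there.
-/
theorem exists_tight (hw : IsWire S W) {G : ℝ} (hG : 0 ≤ G) : ∃ r₀ ∈ S, 0 < r₀ ∧ ∀ r ∈ S,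
    r₀ ≤ r → ∀ g, IsTest₁ S g →
    (∫ y, deriv g y ^ 2) + (∫ y, W y * g y ^ 2) + (∫ y, g y ^ 2) ≤ G →
    ∫ y in (Set.Icc (-r) r)ᶜ, g y ^ 2 ≤ 1 / 4 := by
  have nonneg1 : ∀ g : ℝ → ℝ, 0 ≤ ∫ y, deriv g y ^ 2 := fun g =>
    integral_nonneg fun y => sq_nonneg _
  have nonneg2 : ∀ g : ℝ → ℝ, 0 ≤ ∫ y, g y ^ 2 := fun g => integral_nonneg fun y => sq_nonneg _
  have nonneg3 : ∀ g, IsTest₁ S g → 0 ≤ ∫ y, W y * g y ^ 2 := fun g hg =>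
    integral_nonneg fun y => hg.mul_sq_nonneg hw y
  obtain ⟨c, hc, hc', hW⟩ := hw.confining
  have shape := hw.shape
  have hloc := hw.locallyIntegrable
  rcases shape with ⟨a, ha, rfl⟩ | rfl
  · have hr₀ : 0 < a / (8 * a * (G + 1) + 2) := by positivity
    -- The layer width: `d ≤ a / 2` keeps the inner interval nondegenerate, and `2 d G ≤ 1 / 4`
    -- bounds the mass of both layers by their total length times `sup g²`.
    set d := a / (8 * a * (G + 1) + 2) with hd
    have hda : d ≤ a / 2 := by
      rw [hd]
      gcongr
      have : 0 ≤ 8 * a * (G + 1) := by positivity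
      linarith
    have hdG : 2 * d * G ≤ 1 / 4 := by
      have : d * (8 * a * (G + 1) + 2) = a := div_mul_cancel₀ _ (by positivity)
      have h2 : a * (8 * d * G) ≤ a * 1 := by nlinarith [mul_pos hr₀ ha]
      linarith [le_of_mul_le_mul_left h2 ha]
    refine ⟨a - d, ⟨by linarith, by linarith⟩, by linarith, fun r hr hle g hg hE => ?_⟩
    -- The one-dimensional Sobolev bound: `g²` is the integral of `2 g g'` from `-∞`, and `2 g g' ≤
    -- g'² + g²`.
    have hpt : ∀ y, g y ^ 2 ≤ G := by
      intro y
      have cd := hg.continuous_deriv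
      have cg := hg.smooth.continuous
      have h1 : ∫ x in Set.Iic y, deriv (fun x => g x ^ 2) x = g y ^ 2 :=
        HasCompactSupport.integral_Iic_deriv_eq ((hg.smooth.pow 2).of_le (by simp))
          (hasCompactSupport_sq hg.compact) y
      have hd' : ∀ x, deriv (fun x => g x ^ 2) x = 2 * g x * deriv g x := by
        intro x
        have := ((hg.differentiable x).hasDerivAt.fun_pow 2).deriv
        simpa using this
      rw [← h1]
      simp only [hd']
      have isum : Integrable fun x => deriv g x ^ 2 + g x ^ 2 :=
        hg.integrable_deriv_sq.add hg.integrable_sq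
      calc ∫ x in Set.Iic y, 2 * g x * deriv g x
          ≤ ∫ x in Set.Iic y, (deriv g x ^ 2 + g x ^ 2) := by
            refine integral_mono ?_ isum.restrict fun x => ?_
            · refine (Continuous.integrable_of_hasCompactSupport (by fun_prop) ?_).restrict
              exact hg.compact.mul_left.mul_right
            · nlinarith [sq_nonneg (deriv g x - g x)]
        _ ≤ ∫ x, (deriv g x ^ 2 + g x ^ 2) :=
            setIntegral_le_integral isum (Filter.Eventually.of_forall fun x => by positivity)
        _ = (∫ x, deriv g x ^ 2) + ∫ x, g x ^ 2 :=
            integral_add hg.integrable_deriv_sq hg.integrable_sq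
        _ ≤ G := by linarith [nonneg3 g hg]
    have hsub : ∫ y in (Set.Icc (-r) r)ᶜ, g y ^ 2
        = ∫ y in (Set.Icc (-r) r)ᶜ ∩ Set.Ioo (-a) a, g y ^ 2 := by
      refine setIntegral_eq_of_subset_of_forall_sdiff_eq_zero measurableSet_Icc.compl
        Set.inter_subset_left fun y hy => ?_
      have : y ∉ Set.Ioo (-a) a := fun h => hy.2 ⟨hy.1, h⟩
      simp [hg.eq_zero_of_notMem this]
    have hcover : (Set.Icc (-r) r)ᶜ ∩ Set.Ioo (-a) a ⊆ Set.Icc (-a) (-r) ∪ Set.Icc r a := by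
      rintro y ⟨h1, h2, h3⟩
      by_cases h4 : y < -r
      · exact Or.inl ⟨h2.le, h4.le⟩
      · refine Or.inr ⟨?_, h3.le⟩
        by_contra h5
        exact h1 ⟨not_lt.1 h4, (not_le.1 h5).le⟩
    have htop : volume (Set.Icc (-a) (-r) ∪ Set.Icc r a) < ⊤ :=
      (isCompact_Icc.union isCompact_Icc).measure_lt_top
    have hvol : volume.real ((Set.Icc (-r) r)ᶜ ∩ Set.Ioo (-a) a) ≤ 2 * d := by
      refine (measureReal_mono hcover htop.ne).trans ((measureReal_union_le _ _).trans ?_)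
      rw [Real.volume_real_Icc_of_le (by linarith [hr.2]),
        Real.volume_real_Icc_of_le (by linarith [hr.2])]
      linarith
    rw [hsub]
    refine (Real.le_norm_self _).trans ((norm_setIntegral_le_of_norm_le_const (C := G)
      ((measure_mono hcover).trans_lt htop) fun y _ => ?_).trans ?_)
    · rw [Real.norm_eq_abs, abs_of_nonneg (sq_nonneg _)]
      exact hpt y
    · calc G * volume.real ((Set.Icc (-r) r)ᶜ ∩ Set.Ioo (-a) a) ≤ G * (2 * d) := by gcongr
        _ ≤ 1 / 4 := by linarith
  · have hc0 := hc' rfl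
    -- Since `r₀ ≥ 1`, every `r ≥ r₀` satisfies `c r² ≥ c r ≥ 4 (G + 1)`.
    set r₀ := 4 * (G + 1) / c + 1 with hr₀
    have hr₀1 : 1 ≤ r₀ := by
      have : 0 ≤ 4 * (G + 1) / c := by positivity
      linarith
    refine ⟨r₀, trivial, by linarith, fun r _ hle g hg hE => ?_⟩
    have hiW : Integrable fun y => W y * g y ^ 2 := hg.integrable_mul_sq hloc
    have hr1 : 4 * (G + 1) ≤ c * r ^ 2 := by
      have h1 : 4 * (G + 1) ≤ c * r := by
        have : 4 * (G + 1) / c ≤ r := by linarith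
        rwa [div_le_iff₀' hc0] at this
      nlinarith
    have h2 : c * r ^ 2 * ∫ y in (Set.Icc (-r) r)ᶜ, g y ^ 2 ≤ G := by
      rw [← integral_const_mul]
      calc ∫ y in (Set.Icc (-r) r)ᶜ, c * r ^ 2 * g y ^ 2
          ≤ ∫ y in (Set.Icc (-r) r)ᶜ, W y * g y ^ 2 := by
            refine setIntegral_mono_on (hg.integrable_sq.const_mul _).integrableOn
              hiW.integrableOn measurableSet_Icc.compl fun y hy => ?_
            refine mul_le_mul_of_nonneg_right ((mul_le_mul_of_nonneg_left ?_ hc).trans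
              (hW y trivial)) (sq_nonneg _)
            rw [← sq_abs y]
            have : r < |y| := by
              by_contra h
              exact hy (abs_le.1 (not_lt.1 h))
            gcongr
            linarith
        _ ≤ ∫ y, W y * g y ^ 2 := setIntegral_le_integral hiW
            (Filter.Eventually.of_forall fun y => mul_nonneg
              ((mul_nonneg hc (sq_nonneg y)).trans (hW y trivial)) (sq_nonneg _))
        _ ≤ G := by linarith [nonneg1 g, nonneg2 g]
    have h0 : 0 ≤ ∫ y in (Set.Icc (-r) r)ᶜ, g y ^ 2 := integral_nonneg fun y => sq_nonneg _
    nlinarith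

/-- Harnack's inequality for almost minimizers. -/
theorem harnack {p ε r X : ℝ} (hε : 0 < ε) (hr : 0 < r) {g χ : ℝ → ℝ}
    (hg : IsNearMin S W B (ε ^ 2) p g) (hχ : IsTest₁ S χ)
    (hχr : ∀ y, |y| ≤ r → χ y = 1)
    (hX : ∫ y, (χ y * (deriv g y / (g y + ε))) ^ 2 ≤ X) {s t : ℝ} (hs : |s| ≤ r) (ht : |t| ≤ r) :
    g s + ε ≤ Real.exp (r + X) * (g t + ε) := by
  have hgε : ∀ y, 0 < g y + ε := fun y => add_pos_of_nonneg_of_pos (hg.nonneg y) hε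
  have cd := hg.test.continuous_deriv
  have cg := hg.test.smooth.continuous
  have cχ := hχ.smooth.continuous
  have cw : Continuous fun y => deriv g y / (g y + ε) :=
    cd.div (cg.add continuous_const) fun y => (hgε y).ne'
  have hftc : ∫ y in t..s, deriv g y / (g y + ε) = Real.log (g s + ε) - Real.log (g t + ε) :=
    intervalIntegral.integral_eq_sub_of_hasDerivAt
      (fun y _ => (((hg.test.differentiable y).hasDerivAt).add_const ε).log (hgε y).ne')
      (cw.intervalIntegrable t s)
  have i1 : Integrable fun y => (χ y * (deriv g y / (g y + ε))) ^ 2 :=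
    Continuous.integrable_of_hasCompactSupport (by fun_prop)
      (hasCompactSupport_sq hχ.compact.mul_right)
  have hbound : |∫ y in t..s, deriv g y / (g y + ε)| ≤ r + X := by
    have hsub : Set.uIoc t s ⊆ Set.Icc (-r) r := by
      refine Set.uIoc_subset_uIcc.trans ?_
      exact Set.uIcc_subset_Icc (abs_le.1 ht) (abs_le.1 hs)
    have iI : IntegrableOn (fun y => 1 / 2 + 1 / 2 * (χ y * (deriv g y / (g y + ε))) ^ 2)
        (Set.Icc (-r) r) :=
      (continuousOn_const.integrableOn_Icc).add (i1.const_mul _).integrableOn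
    calc |∫ y in t..s, deriv g y / (g y + ε)|
        ≤ ∫ y in Set.uIoc t s, ‖deriv g y / (g y + ε)‖ := by
          rw [← Real.norm_eq_abs]
          exact intervalIntegral.norm_integral_le_integral_norm_uIoc
      _ ≤ ∫ y in Set.Icc (-r) r, ‖deriv g y / (g y + ε)‖ :=
          setIntegral_mono_set (cw.norm.continuousOn.integrableOn_Icc)
            (Filter.Eventually.of_forall fun y => norm_nonneg _) hsub.eventuallyLE
      -- The inequality `u ≤ (1 + u²) / 2` over an interval of length `2r` gives the exponent `r + X
      -- / 2`, which is weakened to `r + X`.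
      _ ≤ ∫ y in Set.Icc (-r) r, (1 / 2 + 1 / 2 * (χ y * (deriv g y / (g y + ε))) ^ 2) := by
          refine setIntegral_mono_on cw.norm.continuousOn.integrableOn_Icc iI measurableSet_Icc
            fun y hy => ?_
          rw [hχr y (abs_le.2 hy), one_mul, Real.norm_eq_abs,
            ← sq_abs (deriv g y / (g y + ε))]
          nlinarith [sq_nonneg (|deriv g y / (g y + ε)| - 1)]
      _ = r + 1 / 2 * ∫ y in Set.Icc (-r) r, (χ y * (deriv g y / (g y + ε))) ^ 2 := by
          rw [integral_add (continuousOn_const.integrableOn_Icc) (i1.const_mul _).integrableOn,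
            integral_const_mul, setIntegral_const, Real.volume_real_Icc_of_le (by linarith),
            smul_eq_mul]
          ring
      _ ≤ r + 1 / 2 * ∫ y, (χ y * (deriv g y / (g y + ε))) ^ 2 := by
          have := setIntegral_le_integral (s := Set.Icc (-r) r) i1
            (Filter.Eventually.of_forall fun y => sq_nonneg _)
          linarith
      _ ≤ r + X := by
          have : 0 ≤ ∫ y, (χ y * (deriv g y / (g y + ε))) ^ 2 :=
            integral_nonneg fun y => sq_nonneg _
          linarith
  have hlog : Real.log (g s + ε) ≤ (r + X) + Real.log (g t + ε) := by
    rw [hftc] at hbound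
    linarith [(abs_le.1 hbound).2]
  calc g s + ε = Real.exp (Real.log (g s + ε)) := (Real.exp_log (hgε s)).symm
    _ ≤ Real.exp ((r + X) + Real.log (g t + ε)) := Real.exp_le_exp.2 hlog
    _ = _ := by rw [Real.exp_add, Real.exp_log (hgε t)]

/-- Almost minimizers are bounded away from zero on compact subsets of the cross-section. -/
theorem exists_lower_bound (hw : IsWire S W) (B : ℝ) : ∃ r₀ ∈ S, 0 < r₀ ∧ ∀ r ∈ S, r₀ ≤ r →
    ∃ δ > 0, ∃ η > 0, ∀ p g, IsNearMin S W B η p g → ∀ y, |y| ≤ r → δ ≤ g y := by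
  set L := groundEnergy S W B with hL
  have hL0 : 0 ≤ L := groundEnergy_nonneg hw
  -- A near-minimizer with excess at most `1` has form at most `L + 1` and mass at most `1`.
  obtain ⟨r₀, hr₀S, hr₀, htight⟩ := exists_tight hw (G := L + 2) (by positivity)
  obtain ⟨M, hM, hMS⟩ := hw.exists_sq_le
  refine ⟨r₀, hr₀S, hr₀, fun r hr hle => ?_⟩
  have hr0 : 0 < r := hr₀.trans_le hle
  obtain ⟨χ, hχ, hχ0, hχ1, hχr⟩ := hw.exists_cutoff hr0 hr
  -- A bound for `p²` valid for every near-minimizer. It makes `K`, hence the Harnack constant `C`,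
  -- independent of `p` and `g`.
  set P := 4 * (L + 1) + 4 * B ^ 2 * (M * (L + 2)) with hP
  set K := ∫ y, (2 * P + 2 * (B * y) ^ 2 + W y + L) * χ y ^ 2 with hK
  set X := 12 * (∫ y, deriv χ y ^ 2) + 5 * K + 8 with hX
  set C := Real.exp (r + X) with hC
  have hC0 : 0 < C := Real.exp_pos _
  -- If `g < m` on all of `[-r, r]`, the mass there would be less than `2 r m² = 1 / 4`, which
  -- tightness and the lower bound on the total mass exclude.
  set m := √(1 / (8 * r)) with hm
  have hm0 : 0 < m := Real.sqrt_pos.2 (by positivity)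
  have hm2 : m ^ 2 = 1 / (8 * r) := Real.sq_sqrt (by positivity)
  -- Harnack gives `m ≤ C (g t + ε)`. Since `C ε = m / 2`, the shift `ε` uses only half of `m` and
  -- leaves `g t ≥ ε`, so `ε` is also the final lower bound.
  set ε := m / (2 * C) with hε
  have hε0 : 0 < ε := by positivity
  -- Excess at most `1` serves the energy and momentum bounds; excess at most `ε²` is what the
  -- logarithmic derivative estimate requires.
  refine ⟨ε, hε0, min 1 (ε ^ 2), lt_min one_pos (by positivity), fun p g hg t ht => ?_⟩
  have hgt := hg.test
  have hN0 := hg.half_le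
  have hN1 := hg.le_one
  have iq : Integrable fun y => (p - B * y) ^ 2 * g y ^ 2 := by
    have cg := hgt.smooth.continuous
    exact Continuous.integrable_of_hasCompactSupport (by fun_prop)
      (hasCompactSupport_sq hgt.compact).mul_left
  have iW : Integrable fun y => W y * g y ^ 2 := hgt.integrable_mul_sq hw.locallyIntegrable
  have hform : fiberForm W B p g = (∫ y, deriv g y ^ 2) + ((∫ y, (p - B * y) ^ 2 * g y ^ 2)
      + ∫ y, W y * g y ^ 2) := by
    have iqW : Integrable fun y => (p - B * y) ^ 2 * g y ^ 2 + W y * g y ^ 2 := iq.add iW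
    rw [← integral_add iq iW, ← integral_add hgt.integrable_deriv_sq iqW]
    refine integral_congr_ae (Filter.Eventually.of_forall fun y => ?_)
    simp only [pot]
    ring
  have hE : fiberForm W B p g ≤ L + 1 := by
    have h1 := hg.form_le
    have h2 := min_le_left 1 (ε ^ 2)
    have h3 : L * (∫ y, g y ^ 2) ≤ L * 1 := mul_le_mul_of_nonneg_left hN1 hL0
    linarith
  have n1 : 0 ≤ ∫ y, deriv g y ^ 2 := integral_nonneg fun y => sq_nonneg _
  have n2 : 0 ≤ ∫ y, (p - B * y) ^ 2 * g y ^ 2 := integral_nonneg fun y => by positivity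
  have n3 : 0 ≤ ∫ y, W y * g y ^ 2 := integral_nonneg fun y => hgt.mul_sq_nonneg hw y
  -- the momentum is bounded
  have hp : p ^ 2 ≤ P := by
    have h1 : p ^ 2 * ∫ y, g y ^ 2 ≤ 2 * (∫ y, (p - B * y) ^ 2 * g y ^ 2)
        + 2 * B ^ 2 * M * ((∫ y, g y ^ 2) + ∫ y, W y * g y ^ 2) := by
      have isW : Integrable fun y => g y ^ 2 + W y * g y ^ 2 := hgt.integrable_sq.add iW
      rw [← integral_add hgt.integrable_sq iW, ← integral_const_mul, ← integral_const_mul,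
        ← integral_const_mul, ← integral_add (iq.const_mul _) (isW.const_mul _)]
      refine integral_mono (hgt.integrable_sq.const_mul _) ((iq.const_mul _).add
          (isW.const_mul _)) fun y => ?_
      by_cases hy : y ∈ S
      · have h2 := hMS y hy
        have h3 : p ^ 2 ≤ 2 * (p - B * y) ^ 2 + 2 * B ^ 2 * M * (1 + W y) := by
          have : 2 * B ^ 2 * y ^ 2 ≤ 2 * B ^ 2 * (M * (1 + W y)) :=
            mul_le_mul_of_nonneg_left h2 (by positivity)
          nlinarith [sq_nonneg (p - 2 * (B * y))]
        have h4 := mul_le_mul_of_nonneg_right h3 (sq_nonneg (g y))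
        simp only
        linarith
      · simp [hgt.eq_zero_of_notMem hy]
    have h5 : 2 * B ^ 2 * M * ((∫ y, g y ^ 2) + ∫ y, W y * g y ^ 2)
        ≤ 2 * B ^ 2 * M * (L + 2) := by
      refine mul_le_mul_of_nonneg_left ?_ (by positivity)
      linarith
    nlinarith [sq_nonneg p]
  have hKle : ∫ y, |pot W B p y - L| * χ y ^ 2 ≤ K := by
    have hloc : ∀ c : ℝ, LocallyIntegrableOn (fun y => 2 * c + 2 * (B * y) ^ 2 + W y + L) S
        volume := fun c =>
      (((by fun_prop : Continuous fun y => 2 * c + 2 * (B * y) ^ 2).continuousOn.locallyIntegrableOn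
        hw.isOpen.measurableSet).add hw.locallyIntegrable).add
        (continuousOn_const.locallyIntegrableOn hw.isOpen.measurableSet)
    have hloc' : LocallyIntegrableOn (fun y => pot W B p y - L) S volume :=
      (locallyIntegrableOn_pot hw.isOpen hw.locallyIntegrable B p).sub
        (continuousOn_const.locallyIntegrableOn hw.isOpen.measurableSet)
    refine integral_mono ((hχ.integrable_mul_sq hloc').abs.congr
      (Filter.Eventually.of_forall fun y => by simp [abs_mul])) (hχ.integrable_mul_sq (hloc P))
      fun y => ?_
    by_cases hy : y ∈ S
    · refine mul_le_mul_of_nonneg_right ?_ (sq_nonneg _)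
      have h1 := hw.nonneg hy
      rw [pot, abs_le]
      constructor <;> nlinarith [sq_nonneg (p - B * y), sq_nonneg (p + B * y), sq_nonneg (B * y)]
    · simp [hχ.eq_zero_of_notMem hy]
  have hg' : IsNearMin S W B (ε ^ 2) p g :=
    ⟨hgt, hg.nonneg, hN0, hN1, hg.form_le.trans (by gcongr; exact min_le_right _ _)⟩
  have hlog := integral_log_deriv_le hw hε0 hg' hχ hχ0 hχ1
  have hlogX : ∫ y, (χ y * (deriv g y / (g y + ε))) ^ 2 ≤ X := hlog.trans (by
    rw [hX]
    linarith)
  -- a point where `g` is not small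
  have hmass : 1 / 4 ≤ ∫ y in Set.Icc (-r) r, g y ^ 2 := by
    have h1 := htight r hr hle g hgt (by linarith)
    have h2 := integral_add_compl (measurableSet_Icc (a := -r) (b := r)) hgt.integrable_sq
    linarith
  obtain ⟨s, hs, hsm⟩ : ∃ s, |s| ≤ r ∧ m ≤ g s := by
    by_contra hc
    push Not at hc
    have h1 : ∫ y in Set.Icc (-r) r, g y ^ 2 < 1 / 4 := by
      obtain ⟨y₀, hy₀, hmax⟩ := (isCompact_Icc (a := -r) (b := r)).exists_isMaxOn
        ⟨0, by constructor <;> linarith⟩ (hgt.smooth.continuous.continuousOn)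
      have hlt : g y₀ < m := hc y₀ (abs_le.2 hy₀)
      calc ∫ y in Set.Icc (-r) r, g y ^ 2 ≤ ∫ y in Set.Icc (-r) r, g y₀ ^ 2 := by
            refine setIntegral_mono_on hgt.integrable_sq.integrableOn
              continuousOn_const.integrableOn_Icc measurableSet_Icc fun y hy => ?_
            exact pow_le_pow_left₀ (hg.nonneg y) (hmax hy) 2
        _ = 2 * r * g y₀ ^ 2 := by
            rw [setIntegral_const, Real.volume_real_Icc_of_le (by linarith), smul_eq_mul]
            ring
        _ < 2 * r * m ^ 2 := by
            have := pow_lt_pow_left₀ hlt (hg.nonneg y₀) two_ne_zero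
            gcongr
        _ = 1 / 4 := by
            rw [hm2]
            field_simp
            norm_num
    linarith
  have hH := harnack hε0 hr0 hg' hχ hχr hlogX hs ht
  have h1 : m ≤ C * (g t + ε) := by linarith
  have h2 : C * ε = m / 2 := by
    rw [hε]
    field_simp
  have h3 : C * ε ≤ C * g t := by linarith
  exact le_of_mul_le_mul_left h3 hC0

end Harnack

/-! ### Partial Fourier transform in `x` and the lower bound by the fibers. -/

section PartialFourier

variable {S : Set ℝ} {W : ℝ → ℝ} {B : ℝ} {φ : ℝ × ℝ → ℂ}

theorem IsTest.fderiv_apply (hφ : IsTest S φ) (v : ℝ × ℝ) : IsTest S fun z => fderiv ℝ φ z v := by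
  have hs : tsupport (fun z => fderiv ℝ φ z v) ⊆ tsupport φ :=
    closure_minimal (fun z hz => by
      by_contra h
      have h2 : fderiv ℝ φ z = 0 :=
        image_eq_zero_of_notMem_tsupport fun h' => h (tsupport_fderiv_subset ℝ h')
      exact hz (by simp [h2])) (isClosed_tsupport φ)
  exact ⟨(hφ.smooth.fderiv_right (m := ∞) (by simp)).clm_apply contDiff_const,
    hφ.compact.of_isClosed_subset (isClosed_tsupport _) hs, hs.trans hφ.supp⟩

theorem IsTest.transDeriv (hφ : IsTest S φ) : IsTest S (transDeriv φ) := hφ.fderiv_apply (0, 1)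

theorem IsTest.magDeriv (hφ : IsTest S φ) (B : ℝ) : IsTest S (magDeriv B φ) := by
  have h1 := (hφ.fderiv_apply (1, 0)).smooth
  have h2 := hφ.smooth
  have hs : tsupport (QuantumWire.magDeriv B φ) ⊆ tsupport φ :=
    closure_minimal (fun z hz => by
      by_contra h
      have h1 := image_eq_zero_of_notMem_tsupport h
      have h2 : fderiv ℝ φ z = 0 :=
        image_eq_zero_of_notMem_tsupport fun h' => h (tsupport_fderiv_subset ℝ h')
      exact hz (by simp [QuantumWire.magDeriv, h1, h2])) (isClosed_tsupport φ)
  refine ⟨?_, hφ.compact_magDeriv, hs.trans hφ.supp⟩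
  have h3 : ContDiff ℝ ∞ fun z : ℝ × ℝ => ((B * z.2 : ℝ) : ℂ) :=
    Complex.ofRealCLM.contDiff.comp (contDiff_const.mul contDiff_snd)
  exact (contDiff_const.mul h1).sub (h3.mul h2)

theorem IsTest.eq_zero_of_notMem (hφ : IsTest S φ) {z : ℝ × ℝ} (hz : z.2 ∉ S) : φ z = 0 :=
  image_eq_zero_of_notMem_tsupport fun h => hz (hφ.supp h).2

theorem IsTest.slice_contDiff (hφ : IsTest S φ) (y : ℝ) : ContDiff ℝ ∞ fun x => φ (x, y) :=
  hφ.smooth.comp (contDiff_id.prodMk contDiff_const)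

theorem IsTest.slice_compact (hφ : IsTest S φ) (y : ℝ) : HasCompactSupport fun x => φ (x, y) :=
  HasCompactSupport.intro (hφ.compact.isCompact.image continuous_fst) fun x hx =>
    image_eq_zero_of_notMem_tsupport fun h => hx ⟨(x, y), h, rfl⟩

theorem IsTest.slice_integrable (hφ : IsTest S φ) (y : ℝ) : Integrable fun x => φ (x, y) :=
  (hφ.slice_contDiff y).continuous.integrable_of_hasCompactSupport (hφ.slice_compact y)

theorem IsTest.hasDerivAt_slice (hφ : IsTest S φ) (x y : ℝ) :
    HasDerivAt (fun x => φ (x, y)) (fderiv ℝ φ (x, y) (1, 0)) x :=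
  ((hφ.smooth.differentiable (by simp)) (x, y)).hasFDerivAt.comp_hasDerivAt x
    ((hasDerivAt_id x).prodMk (hasDerivAt_const x y))

theorem IsTest.hasDerivAt_slice' (hφ : IsTest S φ) (x y : ℝ) :
    HasDerivAt (fun y => φ (x, y)) (QuantumWire.transDeriv φ (x, y)) y :=
  ((hφ.smooth.differentiable (by simp)) (x, y)).hasFDerivAt.comp_hasDerivAt y
    ((hasDerivAt_const y x).prodMk (hasDerivAt_id y))

/-- The kernel of the Fourier transform. -/
noncomputable def fourierKernel (p x : ℝ) : ℂ := Complex.exp (↑(-2 * Real.pi * x * p) * Complex.I)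

theorem continuous_fourierKernel : Continuous fun q : ℝ × ℝ => fourierKernel q.1 q.2 := by
  unfold fourierKernel
  fun_prop

theorem norm_fourierKernel (p x : ℝ) : ‖fourierKernel p x‖ = 1 := Complex.norm_exp_ofReal_mul_I _

/-- The partial Fourier transform in the longitudinal variable. -/
noncomputable def hat (φ : ℝ × ℝ → ℂ) (p y : ℝ) : ℂ := ∫ x, fourierKernel p x * φ (x, y)

theorem fourier_slice (φ : ℝ × ℝ → ℂ) (p y : ℝ) :
    FourierTransform.fourier (fun x => φ (x, y)) p = hat φ p y := by
  rw [Real.fourier_real_eq_integral_exp_smul]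
  rfl

theorem IsTest.integrable_kernel_mul (hφ : IsTest S φ) (p y : ℝ) :
    Integrable fun x => fourierKernel p x * φ (x, y) := by
  have h1 : Continuous fun x => fourierKernel p x :=
    continuous_fourierKernel.comp (by fun_prop : Continuous fun x : ℝ => (p, x))
  have h2 := (hφ.slice_contDiff y).continuous
  exact Continuous.integrable_of_hasCompactSupport (h1.mul h2) (hφ.slice_compact y).mul_left

theorem stronglyMeasurable_hat (hφ : IsTest S φ) :
    StronglyMeasurable fun q : ℝ × ℝ => hat φ q.1 q.2 := by
  have h1 := hφ.smooth.continuous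
  have h2 : Continuous fun r : (ℝ × ℝ) × ℝ => fourierKernel r.1.1 r.2 * φ (r.2, r.1.2) :=
    (continuous_fourierKernel.comp (by fun_prop : Continuous fun r : (ℝ × ℝ) × ℝ =>
      (r.1.1, r.2))).mul (h1.comp (by fun_prop))
  exact h2.stronglyMeasurable.integral_prod_right'

/-- Differentiation under the integral, dominated by a constant on the compact projection of the
support to the `x`-axis. -/
theorem IsTest.hasDerivAt_hat (hφ : IsTest S φ) (p y : ℝ) :
    HasDerivAt (hat φ p) (hat (QuantumWire.transDeriv φ) p y) y := by
  have ht := hφ.transDeriv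
  obtain ⟨C, hC⟩ := ht.smooth.continuous.bounded_above_of_compact_support ht.compact
  set K := Prod.fst '' tsupport (QuantumWire.transDeriv φ)
  have hK : IsCompact K := ht.compact.isCompact.image continuous_fst
  refine (hasDerivAt_integral_of_dominated_loc_of_deriv_le (bound := K.indicator fun _ => C)
    (F := fun y x => fourierKernel p x * φ (x, y))
    (F' := fun y x => fourierKernel p x * QuantumWire.transDeriv φ (x, y))
    Filter.univ_mem (Filter.Eventually.of_forall fun y =>
      (hφ.integrable_kernel_mul p y).aestronglyMeasurable) (hφ.integrable_kernel_mul p y)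
    (ht.integrable_kernel_mul p y).aestronglyMeasurable
    (Filter.Eventually.of_forall fun x y _ => ?_) ?_
    (Filter.Eventually.of_forall fun x y _ => (hφ.hasDerivAt_slice' x y).const_mul _)).2
  · rw [norm_mul, norm_fourierKernel, one_mul]
    by_cases hx : x ∈ K
    · rw [Set.indicator_of_mem hx]
      exact hC _
    · rw [Set.indicator_of_notMem hx, image_eq_zero_of_notMem_tsupport fun h =>
        hx ⟨(x, y), h, rfl⟩, norm_zero]
  · rw [integrable_indicator_iff hK.measurableSet]
    exact integrableOn_const hK.measure_lt_top.ne

theorem IsTest.contDiff_hat (hφ : IsTest S φ) (p : ℝ) : ContDiff ℝ ∞ (hat φ p) := by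
  rw [contDiff_infty]
  intro n
  induction n generalizing φ with
  | zero =>
    exact contDiff_zero.2 (continuous_iff_continuousAt.2 fun y =>
      (hφ.hasDerivAt_hat p y).continuousAt)
  | succ n ih =>
    rw [Nat.cast_succ, contDiff_succ_iff_deriv]
    refine ⟨fun y => (hφ.hasDerivAt_hat p y).differentiableAt, by simp, ?_⟩
    rw [funext fun y => (hφ.hasDerivAt_hat p y).deriv]
    exact ih hφ.transDeriv

theorem hat_eq_zero (p : ℝ) {y : ℝ} (hy : y ∉ Prod.snd '' tsupport φ) :
    hat φ p y = 0 := by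
  rw [hat]
  refine integral_eq_zero_of_ae (Filter.Eventually.of_forall fun x => ?_)
  simp only [Pi.zero_apply]
  rw [image_eq_zero_of_notMem_tsupport fun h => hy ⟨(x, y), h, rfl⟩, mul_zero]

/-- Applied with the real and imaginary parts, this makes each Fourier slice accessible to the fiber
forms, which are stated for real functions. -/
theorem IsTest.isTest₁_comp_hat (hφ : IsTest S φ) (p : ℝ) (A : ℂ →L[ℝ] ℝ) :
    IsTest₁ S fun y => A (hat φ p y) := by
  have hK : IsCompact (Prod.snd '' tsupport φ) := hφ.compact.isCompact.image continuous_snd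
  refine ⟨A.contDiff.comp (hφ.contDiff_hat p), ?_, ?_⟩
  · refine HasCompactSupport.intro hK fun y hy => ?_
    rw [hat_eq_zero p hy, map_zero]
  · refine (closure_minimal (fun y hy => ?_) hK.isClosed).trans ?_
    · by_contra h
      exact hy (by simp [hat_eq_zero p h])
    · rintro _ ⟨z, hz, rfl⟩
      exact (hφ.supp hz).2

/-- With the kernel `exp(-2πixp)`, the physical momentum of the fiber is `2πp`. -/
theorem IsTest.hat_magDeriv (hφ : IsTest S φ) (B p y : ℝ) :
    hat (QuantumWire.magDeriv B φ) p y = ((2 * Real.pi * p - B * y : ℝ) : ℂ) * hat φ p y := by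
  have hx := hφ.fderiv_apply (1, 0)
  have e1 : hat (fun z => fderiv ℝ φ z (1, 0)) p y
      = (2 * Real.pi * Complex.I * p) * hat φ p y := by
    have hd : deriv (fun x => φ (x, y)) = fun x => fderiv ℝ φ (x, y) (1, 0) :=
      funext fun x => (hφ.hasDerivAt_slice x y).deriv
    have h1 := Real.fourier_deriv (hφ.slice_integrable y)
      ((hφ.slice_contDiff y).differentiable (by simp)) (by
        rw [hd]
        exact hx.slice_integrable y)
    rw [hd] at h1
    rw [← fourier_slice, ← fourier_slice φ, h1]
    rfl
  have e2 : hat (QuantumWire.magDeriv B φ) p y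
      = -Complex.I * hat (fun z => fderiv ℝ φ z (1, 0)) p y - (B * y : ℝ) * hat φ p y := by
    rw [hat, hat, hat, ← integral_const_mul, ← integral_const_mul,
      ← integral_sub ((hx.integrable_kernel_mul p y).const_mul _)
        ((hφ.integrable_kernel_mul p y).const_mul _)]
    refine integral_congr_ae (Filter.Eventually.of_forall fun x => ?_)
    simp only [QuantumWire.magDeriv]
    ring
  rw [e2, e1]
  push_cast
  linear_combination (-2 * Real.pi * p * hat φ p y) * Complex.I_sq

/-- Each slice in `x` is smooth with compact support, hence a Schwartz function, to which
Plancherel's theorem applies. -/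
theorem IsTest.plancherel_slice (hφ : IsTest S φ) (y : ℝ) :
    ∫⁻ x, ENNReal.ofReal (‖φ (x, y)‖ ^ 2) = ∫⁻ p, ENNReal.ofReal (‖hat φ p y‖ ^ 2) := by
  let f := (hφ.slice_compact y).toSchwartzMap (hφ.slice_contDiff y)
  have h := f.integral_norm_sq_fourier
  have h1 : ∀ p, FourierTransform.fourier f p = hat φ p y := fun p => by
    rw [SchwartzMap.fourier_coe, ← fourier_slice]
    rfl
  have i1 : Integrable fun x => ‖f x‖ ^ 2 := (f.memLp 2).integrable_norm_pow (by simp)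
  have i2 : Integrable fun x => ‖FourierTransform.fourier f x‖ ^ 2 :=
    ((FourierTransform.fourier f).memLp 2).integrable_norm_pow (by simp)
  have h2 := congrArg ENNReal.ofReal h
  rw [ofReal_integral_eq_lintegral_ofReal i1 (Filter.Eventually.of_forall fun x => sq_nonneg _),
    ofReal_integral_eq_lintegral_ofReal i2 (Filter.Eventually.of_forall fun x => sq_nonneg _)] at h2
  simp only [h1] at h2
  exact h2.symm

theorem stripMeasure_eq_prod (S : Set ℝ) :
    stripMeasure S = (volume : Measure ℝ).prod ((volume : Measure ℝ).restrict S) := by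
  rw [stripMeasure, strip, Measure.volume_eq_prod, ← Measure.prod_restrict, Measure.restrict_univ]

/-- Plancherel's theorem on the strip, with a weight in the transverse variable. -/
theorem IsTest.plancherel (hφ : IsTest S φ) {w : ℝ → ENNReal}
    (hw : AEMeasurable w (volume.restrict S)) :
    ∫⁻ z in strip S, w z.2 * ENNReal.ofReal (‖φ z‖ ^ 2)
      = ∫⁻ p, ∫⁻ y in S, w y * ENNReal.ofReal (‖hat φ p y‖ ^ 2) := by
  have hφm := hφ.smooth.continuous
  have hhat := (stronglyMeasurable_hat hφ).measurable
  have m1 : AEMeasurable (fun z : ℝ × ℝ => w z.2)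
      ((volume : Measure ℝ).prod ((volume : Measure ℝ).restrict S)) := hw.comp_snd
  have e : ∫⁻ z in strip S, w z.2 * ENNReal.ofReal (‖φ z‖ ^ 2)
      = ∫⁻ z, w z.2 * ENNReal.ofReal (‖φ z‖ ^ 2)
        ∂((volume : Measure ℝ).prod ((volume : Measure ℝ).restrict S)) := by
    rw [← stripMeasure_eq_prod]
  have m2 : AEMeasurable (fun z : ℝ × ℝ => w z.2 * ENNReal.ofReal (‖φ z‖ ^ 2))
      ((volume : Measure ℝ).prod ((volume : Measure ℝ).restrict S)) :=
    m1.mul (by fun_prop)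
  have m3 : AEMeasurable (Function.uncurry fun p y : ℝ =>
      w y * ENNReal.ofReal (‖hat φ p y‖ ^ 2))
      ((volume : Measure ℝ).prod ((volume : Measure ℝ).restrict S)) :=
    m1.mul (hhat.norm.pow_const 2).ennreal_ofReal.aemeasurable
  rw [e, lintegral_prod_symm _ m2, lintegral_lintegral_swap m3]
  refine lintegral_congr fun y => ?_
  simp only
  rw [lintegral_const_mul, lintegral_const_mul, hφ.plancherel_slice y]
  · exact ((hhat.comp (measurable_id.prodMk measurable_const)).norm.pow_const 2).ennreal_ofReal
  · exact ((hφ.slice_contDiff y).continuous.norm.pow 2).measurable.ennreal_ofReal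

/-- The fiber form has real coefficients, so it splits into the contributions of the real and
imaginary parts. -/
theorem fiber_lower_bound (hw : IsWire S W) {f : ℝ → ℂ} (hre : IsTest₁ S fun y => (f y).re)
    (him : IsTest₁ S fun y => (f y).im) {f' : ℝ → ℂ} (hf : ∀ y, HasDerivAt f (f' y) y) (q : ℝ) :
    groundEnergy S W B * (∫ y, ‖f y‖ ^ 2)
      ≤ ∫ y, (‖f' y‖ ^ 2 + pot W B q y * ‖f y‖ ^ 2) := by
  have h1 := groundEnergy_mul_le (B := B) hw hre q
  have h2 := groundEnergy_mul_le (B := B) hw him q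
  have d1 : ∀ y, deriv (fun y => (f y).re) y = (f' y).re := fun y =>
    (Complex.reCLM.hasFDerivAt.comp_hasDerivAt y (hf y)).deriv
  have d2 : ∀ y, deriv (fun y => (f y).im) y = (f' y).im := fun y =>
    (Complex.imCLM.hasFDerivAt.comp_hasDerivAt y (hf y)).deriv
  have e0 : ∀ z : ℂ, ‖z‖ ^ 2 = z.re ^ 2 + z.im ^ 2 := fun z => by
    rw [Complex.sq_norm, Complex.normSq_apply]
    ring
  simp only [e0]
  rw [integral_add hre.integrable_sq him.integrable_sq, mul_add]
  refine (add_le_add h1 h2).trans_eq ?_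
  rw [fiberForm, fiberForm, ← integral_add (hre.integrable_fiberForm hw B q)
    (him.integrable_fiberForm hw B q)]
  refine integral_congr_ae (Filter.Eventually.of_forall fun y => ?_)
  simp only [d1, d2]
  ring

theorem measurable_hat_sq (hφ : IsTest S φ) :
    Measurable fun q : ℝ × ℝ => ENNReal.ofReal (‖hat φ q.1 q.2‖ ^ 2) :=
  ((stronglyMeasurable_hat hφ).measurable.norm.pow_const 2).ennreal_ofReal

theorem measurable_hat_sq_slice (hφ : IsTest S φ) (p : ℝ) :
    Measurable fun y => ENNReal.ofReal (‖hat φ p y‖ ^ 2) :=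
  ((hφ.contDiff_hat p).continuous.norm.pow 2).measurable.ennreal_ofReal

theorem measurable_lintegral_hat_sq (hφ : IsTest S φ) :
    Measurable fun p => ∫⁻ y in S, ENNReal.ofReal (‖hat φ p y‖ ^ 2) :=
  (measurable_hat_sq hφ).lintegral_prod_right'

theorem lintegral_hat_ge (hw : IsWire S W) (hφ : IsTest S φ) (p : ℝ) :
    ENNReal.ofReal (groundEnergy S W B) * ∫⁻ y in S, ENNReal.ofReal (‖hat φ p y‖ ^ 2)
      ≤ (∫⁻ y in S, ENNReal.ofReal (‖hat (magDeriv B φ) p y‖ ^ 2))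
        + (∫⁻ y in S, ENNReal.ofReal (‖hat (transDeriv φ) p y‖ ^ 2))
        + ∫⁻ y in S, ENNReal.ofReal (W y) * ENNReal.ofReal (‖hat φ p y‖ ^ 2) := by
  have hL0 : 0 ≤ groundEnergy S W B := groundEnergy_nonneg hw
  have hre : IsTest₁ S fun y => (hat φ p y).re := hφ.isTest₁_comp_hat p Complex.reCLM
  have him : IsTest₁ S fun y => (hat φ p y).im := hφ.isTest₁_comp_hat p Complex.imCLM
  have key := fiber_lower_bound (B := B) hw hre him (fun y => hφ.hasDerivAt_hat p y)
    (2 * Real.pi * p)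
  have e0 : ∀ z : ℂ, ‖z‖ ^ 2 = z.re ^ 2 + z.im ^ 2 := fun z => by
    rw [Complex.sq_norm, Complex.normSq_apply]
    ring
  have i1 : Integrable fun y => ‖hat φ p y‖ ^ 2 := by
    simp only [e0]
    exact hre.integrable_sq.add him.integrable_sq
  have i2 : Integrable fun y => ‖hat (transDeriv φ) p y‖ ^ 2
      + pot W B (2 * Real.pi * p) y * ‖hat φ p y‖ ^ 2 := by
    have d1 : ∀ y, deriv (fun y => (hat φ p y).re) y = (hat (transDeriv φ) p y).re := fun y =>
      (Complex.reCLM.hasFDerivAt.comp_hasDerivAt y (hφ.hasDerivAt_hat p y)).deriv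
    have d2 : ∀ y, deriv (fun y => (hat φ p y).im) y = (hat (transDeriv φ) p y).im := fun y =>
      (Complex.imCLM.hasFDerivAt.comp_hasDerivAt y (hφ.hasDerivAt_hat p y)).deriv
    refine ((hre.integrable_fiberForm hw B (2 * Real.pi * p)).add
      (him.integrable_fiberForm hw B (2 * Real.pi * p))).congr
      (Filter.Eventually.of_forall fun y => ?_)
    simp only [Pi.add_apply, d1, d2, e0]
    ring
  have hz : ∀ y, y ∉ S → hat φ p y = 0 := fun y hy => hat_eq_zero p (by
    rintro ⟨z, hz, rfl⟩
    exact hy (hφ.supp hz).2)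
  have hz' : ∀ y, y ∉ S → hat (transDeriv φ) p y = 0 := fun y hy => hat_eq_zero p (by
    rintro ⟨z, hz, rfl⟩
    exact hy (hφ.transDeriv.supp hz).2)
  have s1 := setIntegral_eq_integral_of_forall_compl_eq_zero (μ := volume) (s := S)
    (f := fun y => ‖hat φ p y‖ ^ 2) fun y hy => by simp [hz y hy]
  have s2 := setIntegral_eq_integral_of_forall_compl_eq_zero (μ := volume) (s := S)
    (f := fun y => ‖hat (transDeriv φ) p y‖ ^ 2 + pot W B (2 * Real.pi * p) y * ‖hat φ p y‖ ^ 2)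
    fun y hy => by simp [hz y hy, hz' y hy]
  rw [← s1, ← s2] at key
  have hnn : ∀ y ∈ S, 0 ≤ pot W B (2 * Real.pi * p) y := fun y hy => by
    have := hw.nonneg hy
    rw [pot]
    positivity
  have key2 := ENNReal.ofReal_le_ofReal key
  rw [ENNReal.ofReal_mul hL0, ofReal_integral_eq_lintegral_ofReal i1.restrict
      (Filter.Eventually.of_forall fun y => sq_nonneg _),
    ofReal_integral_eq_lintegral_ofReal i2.restrict ((ae_restrict_iff' hw.isOpen.measurableSet).2
      (Filter.Eventually.of_forall fun y hy => add_nonneg (sq_nonneg _)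
        (mul_nonneg (hnn y hy) (sq_nonneg _))))] at key2
  refine key2.trans_eq ?_
  have mm : Measurable fun y => ENNReal.ofReal (‖hat (magDeriv B φ) p y‖ ^ 2)
      + ENNReal.ofReal (‖hat (transDeriv φ) p y‖ ^ 2) :=
    (measurable_hat_sq_slice (hφ.magDeriv B) p).add (measurable_hat_sq_slice hφ.transDeriv p)
  rw [← lintegral_add_left (measurable_hat_sq_slice (hφ.magDeriv B) p), ← lintegral_add_left mm]
  refine setLIntegral_congr_fun hw.isOpen.measurableSet fun y hy => ?_
  have hWy := hw.nonneg hy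
  simp only [hφ.hat_magDeriv, norm_mul, mul_pow, Complex.norm_real, Real.norm_eq_abs, sq_abs]
  rw [← ENNReal.ofReal_mul hWy, ← ENNReal.ofReal_add (by positivity) (by positivity),
    ← ENNReal.ofReal_add (by positivity) (by positivity), pot]
  congr 1
  ring

/-- Plancherel reduces every term to an integral over fibers, where the bound holds pointwise in
`p`. Working with lower integrals avoids integrability questions in `p`. -/
theorem lintegral_strip_ge (hw : IsWire S W) (hφ : IsTest S φ) :
    ENNReal.ofReal (groundEnergy S W B) * ∫⁻ z in strip S, ENNReal.ofReal (‖φ z‖ ^ 2)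
      ≤ (∫⁻ z in strip S, ENNReal.ofReal (‖magDeriv B φ z‖ ^ 2))
        + (∫⁻ z in strip S, ENNReal.ofReal (‖transDeriv φ z‖ ^ 2))
        + ∫⁻ z in strip S, ENNReal.ofReal (‖sqrtMul W φ z‖ ^ 2) := by
  have mW : AEMeasurable (fun y => ENNReal.ofReal (W y)) (volume.restrict S) :=
    hw.locallyIntegrable.aestronglyMeasurable.aemeasurable.ennreal_ofReal
  have one : AEMeasurable (fun _ : ℝ => (1 : ENNReal)) (volume.restrict S) := aemeasurable_const
  have e4 : ∀ z, ENNReal.ofReal (‖sqrtMul W φ z‖ ^ 2)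
      = ENNReal.ofReal (W z.2) * ENNReal.ofReal (‖φ z‖ ^ 2) := by
    intro z
    rw [sqrtMul, norm_mul, mul_pow, Complex.norm_real, Real.norm_eq_abs, sq_abs]
    by_cases h : 0 ≤ W z.2
    · rw [Real.sq_sqrt h, ENNReal.ofReal_mul h]
    · have h' := (not_le.1 h).le
      rw [Real.sqrt_eq_zero_of_nonpos h', ENNReal.ofReal_of_nonpos h']
      simp
  simp only [e4]
  have P1 := hφ.plancherel one
  have P2 := (hφ.magDeriv B).plancherel one
  have P3 := hφ.transDeriv.plancherel one
  simp only [one_mul] at P1 P2 P3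
  rw [P1, P2, P3, hφ.plancherel mW]
  have mm : Measurable fun p => (∫⁻ y in S, ENNReal.ofReal (‖hat (magDeriv B φ) p y‖ ^ 2))
      + ∫⁻ y in S, ENNReal.ofReal (‖hat (transDeriv φ) p y‖ ^ 2) :=
    (measurable_lintegral_hat_sq (hφ.magDeriv B)).add (measurable_lintegral_hat_sq hφ.transDeriv)
  rw [← lintegral_const_mul _ (measurable_lintegral_hat_sq hφ),
    ← lintegral_add_left (measurable_lintegral_hat_sq (hφ.magDeriv B)), ← lintegral_add_left mm]
  exact lintegral_mono fun p => lintegral_hat_ge hw hφ p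

theorem IsTest.integrable_norm_sq (hφ : IsTest S φ) :
    Integrable (fun z => ‖φ z‖ ^ 2) (stripMeasure S) :=
  ((hφ.smooth.continuous.memLp_of_hasCompactSupport (p := 2) hφ.compact).integrable_norm_pow
    (by simp)).restrict

/-- The form of `H₀(B)` is bounded from below by the ground state energy of the fibers. -/
theorem groundEnergy_mul_le_energy (hw : IsWire S W) (hφ : IsTest S φ) :
    groundEnergy S W B * (∫ z in strip S, ‖φ z‖ ^ 2)
      ≤ (∫ z in strip S, ‖magDeriv B φ z‖ ^ 2) + (∫ z in strip S, ‖transDeriv φ z‖ ^ 2)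
        + ∫ z in strip S, ‖sqrtMul W φ z‖ ^ 2 := by
  have h := lintegral_strip_ge (B := B) hw hφ
  have i4 : Integrable (fun z => ‖sqrtMul W φ z‖ ^ 2) (stripMeasure S) :=
    (hφ.memLp_sqrtMul hw.locallyIntegrable).integrable_norm_pow (by simp)
  have nn : ∀ f : ℝ × ℝ → ℂ, 0 ≤ ∫ z in strip S, ‖f z‖ ^ 2 := fun f =>
    integral_nonneg fun z => sq_nonneg _
  have hc : ∀ f : ℝ × ℝ → ℂ, 0 ≤ᵐ[stripMeasure S] fun z => ‖f z‖ ^ 2 := fun f =>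
    Filter.Eventually.of_forall fun z => sq_nonneg _
  rw [← ofReal_integral_eq_lintegral_ofReal hφ.integrable_norm_sq (hc _),
    ← ofReal_integral_eq_lintegral_ofReal (hφ.magDeriv B).integrable_norm_sq (hc _),
    ← ofReal_integral_eq_lintegral_ofReal hφ.transDeriv.integrable_norm_sq (hc _),
    ← ofReal_integral_eq_lintegral_ofReal i4 (hc _),
    ← ENNReal.ofReal_mul (groundEnergy_nonneg hw), ← ENNReal.ofReal_add (nn _) (nn _),
    ← ENNReal.ofReal_add (add_nonneg (nn _) (nn _)) (nn _)] at h
  exact (ENNReal.ofReal_le_ofReal_iff (add_nonneg (add_nonneg (nn _) (nn _)) (nn _))).1 h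

end PartialFourier

/-! ### Poincaré inequalities with averages on intervals and squares. -/

section Poincare

/-- Cauchy–Schwarz, obtained by expanding the nonnegative integral of `(‖f‖ - D / h)²`, where `D /
h` is the mean of `‖f‖`. -/
theorem sq_integral_norm_le {f : ℝ → ℂ} (hf : Continuous f) {a b : ℝ} (hab : a < b) :
    (∫ t in a..b, ‖f t‖) ^ 2 ≤ (b - a) * ∫ t in a..b, ‖f t‖ ^ 2 := by
  set D := ∫ t in a..b, ‖f t‖
  set h := b - a
  have hh : 0 < h := sub_pos.2 hab
  have i1 : IntervalIntegrable (fun t => ‖f t‖ ^ 2) volume a b :=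
    (by fun_prop : Continuous fun t => ‖f t‖ ^ 2).intervalIntegrable _ _
  have i2 : IntervalIntegrable (fun t => 2 * (D / h) * ‖f t‖) volume a b :=
    (by fun_prop : Continuous fun t => 2 * (D / h) * ‖f t‖).intervalIntegrable _ _
  have h0 : 0 ≤ ∫ t in a..b, (‖f t‖ ^ 2 - 2 * (D / h) * ‖f t‖ + (D / h) ^ 2) :=
    intervalIntegral.integral_nonneg hab.le fun t _ => by nlinarith [sq_nonneg (‖f t‖ - D / h)]
  rw [intervalIntegral.integral_add (i1.sub i2) (by simp), intervalIntegral.integral_sub i1 i2,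
    intervalIntegral.integral_const_mul, intervalIntegral.integral_const, smul_eq_mul] at h0
  have e : ∫ t in a..b, ‖f t‖ ^ 2 ≥ D ^ 2 / h := by
    have : (∫ t in a..b, ‖f t‖ ^ 2) - 2 * (D / h) * D + h * (D / h) ^ 2
        = (∫ t in a..b, ‖f t‖ ^ 2) - D ^ 2 / h := by
      field_simp
      ring
    linarith
  calc D ^ 2 = h * (D ^ 2 / h) := by field_simp
    _ ≤ _ := by gcongr

/-- The oscillation of `f` is at most the integral `D` of `‖f'‖`, so `h f t` differs from the
integral `F` by at most `D h`. Squaring, using `D² ≤ h E`, and integrating over length `h` gives the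
constants. -/
theorem poincare_interval {f f' : ℝ → ℂ} (hf : ∀ t, HasDerivAt f (f' t) t) (hf' : Continuous f')
    {a b : ℝ} (hab : a < b) :
    ∫ t in a..b, ‖f t‖ ^ 2 ≤ 2 / (b - a) * ‖∫ t in a..b, f t‖ ^ 2
      + 2 * (b - a) ^ 2 * ∫ t in a..b, ‖f' t‖ ^ 2 := by
  have cf : Continuous f := continuous_iff_continuousAt.2 fun t => (hf t).continuousAt
  set h := b - a
  have hh : 0 < h := sub_pos.2 hab
  set E := ∫ t in a..b, ‖f' t‖ ^ 2
  set D := ∫ t in a..b, ‖f' t‖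
  set F := ∫ t in a..b, f t
  have hD : D ^ 2 ≤ h * E := sq_integral_norm_le hf' hab
  have hdiff : ∀ t ∈ Set.Icc a b, ∀ s ∈ Set.Icc a b, ‖f t - f s‖ ≤ D := by
    intro t ht s hs
    rw [← intervalIntegral.integral_eq_sub_of_hasDerivAt (fun x _ => hf x)
      (hf'.intervalIntegrable s t)]
    refine (intervalIntegral.norm_integral_le_abs_integral_norm).trans ?_
    have i := hf'.norm.integrableOn_Icc (μ := volume) (a := a) (b := b)
    rw [intervalIntegral.abs_integral_eq_abs_integral_uIoc, abs_of_nonneg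
      (integral_nonneg fun x => norm_nonneg _)]
    simp only [D]
    rw [intervalIntegral.integral_of_le hab.le, ← integral_Icc_eq_integral_Ioc]
    exact setIntegral_mono_set i (Filter.Eventually.of_forall fun x => norm_nonneg _)
      (Set.uIoc_subset_uIcc.trans (Set.uIcc_subset_Icc hs ht)).eventuallyLE
  have hpt : ∀ t ∈ Set.Icc a b, ‖f t‖ ^ 2 ≤ 2 / h ^ 2 * ‖F‖ ^ 2 + 2 * h * E := by
    intro t ht
    have h1 : (h : ℂ) * f t - F = ∫ s in a..b, (f t - f s) := by
      rw [intervalIntegral.integral_sub (by simp) (cf.intervalIntegrable a b),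
        intervalIntegral.integral_const, Complex.real_smul]
    have h2 : ‖(h : ℂ) * f t - F‖ ≤ D * h := by
      rw [h1]
      have := intervalIntegral.norm_integral_le_of_norm_le_const (a := a) (b := b) (C := D)
        (f := fun s => f t - f s) fun s hs => by
          rw [Set.uIoc_of_le hab.le] at hs
          exact hdiff t ht s ⟨hs.1.le, hs.2⟩
      rwa [abs_of_pos hh] at this
    have h3 : h * ‖f t‖ ≤ ‖F‖ + D * h := by
      have e : h * ‖f t‖ = ‖(h : ℂ) * f t‖ := by
        rw [norm_mul, Complex.norm_real, Real.norm_of_nonneg hh.le]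
      rw [e]
      calc ‖(h : ℂ) * f t‖ = ‖F + ((h : ℂ) * f t - F)‖ := by congr 1; ring
        _ ≤ ‖F‖ + ‖(h : ℂ) * f t - F‖ := norm_add_le _ _
        _ ≤ _ := by gcongr
    have h4 : (h * ‖f t‖) ^ 2 ≤ 2 * ‖F‖ ^ 2 + 2 * h ^ 2 * (h * E) := by
      have h5 : (h * ‖f t‖) ^ 2 ≤ (‖F‖ + D * h) ^ 2 := by gcongr
      have h6 : h ^ 2 * D ^ 2 ≤ h ^ 2 * (h * E) := by gcongr
      nlinarith [sq_nonneg (‖F‖ - D * h)]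
    have h7 : ‖f t‖ ^ 2 = (h * ‖f t‖) ^ 2 / h ^ 2 := by field_simp
    rw [h7, div_le_iff₀ (by positivity)]
    refine h4.trans_eq ?_
    field_simp
  have := intervalIntegral.integral_mono_on hab.le
    ((cf.norm.pow 2).intervalIntegrable (μ := volume) a b) (by simp) hpt
  rw [intervalIntegral.integral_const, smul_eq_mul] at this
  refine this.trans_eq ?_
  change h * _ = _
  field_simp

/-- Partition of an interval into `N` intervals of length `h`. -/
theorem sum_integral_steps {E : Type*} [NormedAddCommGroup E] [NormedSpace ℝ E] {f : ℝ → E}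
    (hf : Continuous f) (a h : ℝ) (N : ℕ) :
    ∑ i ∈ Finset.range N, ∫ t in (a + i * h)..(a + (i + 1) * h), f t
      = ∫ t in a..(a + N * h), f t := by
  have := intervalIntegral.sum_integral_adjacent_intervals (μ := volume) (f := f)
    (a := fun i : ℕ => a + i * h) (n := N) fun k _ => hf.intervalIntegrable _ _
  simpa using this

theorem poincare_steps {f f' : ℝ → ℂ} (hf : ∀ t, HasDerivAt f (f' t) t) (hf' : Continuous f')
    (a : ℝ) {h : ℝ} (hh : 0 < h) (N : ℕ) :
    ∫ t in a..(a + N * h), ‖f t‖ ^ 2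
      ≤ 2 / h * (∑ i ∈ Finset.range N, ‖∫ t in (a + i * h)..(a + (i + 1) * h), f t‖ ^ 2)
        + 2 * h ^ 2 * ∫ t in a..(a + N * h), ‖f' t‖ ^ 2 := by
  have cf : Continuous f := continuous_iff_continuousAt.2 fun t => (hf t).continuousAt
  rw [← sum_integral_steps (by fun_prop : Continuous fun t => ‖f t‖ ^ 2),
    ← sum_integral_steps (by fun_prop : Continuous fun t => ‖f' t‖ ^ 2), Finset.mul_sum,
    Finset.mul_sum, ← Finset.sum_add_distrib]
  refine Finset.sum_le_sum fun i _ => ?_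
  have := poincare_interval hf hf' (a := a + i * h) (b := a + (i + 1) * h) (by nlinarith)
  rwa [show a + (i + 1) * h - (a + i * h) = h by ring] at this

variable {S : Set ℝ} {φ : ℝ × ℝ → ℂ}

theorem IsTest.hasDerivAt_integral (hφ : IsTest S φ) (a b y : ℝ) :
    HasDerivAt (fun y => ∫ x in a..b, φ (x, y))
      (∫ x in a..b, QuantumWire.transDeriv φ (x, y)) y := by
  have ht := hφ.transDeriv
  obtain ⟨C, hC⟩ := ht.smooth.continuous.bounded_above_of_compact_support ht.compact
  exact (intervalIntegral.hasDerivAt_integral_of_dominated_loc_of_deriv_le (bound := fun _ => C)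
    (F := fun y x => φ (x, y)) (F' := fun y x => QuantumWire.transDeriv φ (x, y))
    Filter.univ_mem (Filter.Eventually.of_forall fun y =>
      (hφ.slice_contDiff y).continuous.aestronglyMeasurable)
    ((hφ.slice_contDiff y).continuous.intervalIntegrable _ _)
    (ht.slice_contDiff y).continuous.aestronglyMeasurable
    (Filter.Eventually.of_forall fun x _ y _ => hC _) intervalIntegrable_const
    (Filter.Eventually.of_forall fun x _ y _ => hφ.hasDerivAt_slice' x y)).2

theorem continuous_integral_slice {E : Type*} [NormedAddCommGroup E] [NormedSpace ℝ E]
    {f : ℝ × ℝ → E} (hf : Continuous f) (a b : ℝ) :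
    Continuous fun y => ∫ x in a..b, f (x, y) :=
  intervalIntegral.continuous_parametric_intervalIntegral_of_continuous'
    (f := fun y x => f (x, y)) (by fun_prop) a b

/-- The Poincaré inequality on a square divided into `N²` squares of size `h`. -/
theorem IsTest.poincare_square (hφ : IsTest S φ) (a : ℝ) {h : ℝ} (hh : 0 < h) (N : ℕ) :
    ∫ y in a..(a + N * h), ∫ x in a..(a + N * h), ‖φ (x, y)‖ ^ 2
      ≤ 4 / h ^ 2 * (∑ i ∈ Finset.range N, ∑ j ∈ Finset.range N,
          ‖∫ y in (a + j * h)..(a + (j + 1) * h), ∫ x in (a + i * h)..(a + (i + 1) * h),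
            φ (x, y)‖ ^ 2)
        + 2 * h ^ 2 * (∫ y in a..(a + N * h), ∫ x in a..(a + N * h),
            ‖fderiv ℝ φ (x, y) (1, 0)‖ ^ 2)
        + 4 * h ^ 2 * ∫ y in a..(a + N * h), ∫ x in a..(a + N * h),
            ‖QuantumWire.transDeriv φ (x, y)‖ ^ 2 := by
  set b := a + N * h with hb
  have hab : a ≤ b := by
    have : 0 ≤ N * h := by positivity
    linarith
  have hx := hφ.fderiv_apply (1, 0)
  have hy := hφ.transDeriv
  have cφ := hφ.smooth.continuous
  have cx := hx.smooth.continuous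
  have cy := hy.smooth.continuous
  have cφ2 : Continuous fun z => ‖φ z‖ ^ 2 := by fun_prop
  have cx2 : Continuous fun z => ‖fderiv ℝ φ z (1, 0)‖ ^ 2 := by fun_prop
  have cy2 : Continuous fun z => ‖QuantumWire.transDeriv φ z‖ ^ 2 := by fun_prop
  have hstep : ∀ i : ℕ, a + i * h < a + (i + 1) * h := fun i => by nlinarith
  set F : ℕ → ℝ → ℂ := fun i y => ∫ x in (a + i * h)..(a + (i + 1) * h), φ (x, y) with hF
  have cF : ∀ i, Continuous (F i) := fun i => continuous_integral_slice cφ _ _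
  -- the inequality in the first variable
  have h1 : ∀ y, ∫ x in a..b, ‖φ (x, y)‖ ^ 2 ≤ 2 / h * (∑ i ∈ Finset.range N, ‖F i y‖ ^ 2)
      + 2 * h ^ 2 * ∫ x in a..b, ‖fderiv ℝ φ (x, y) (1, 0)‖ ^ 2 := fun y =>
    poincare_steps (fun x => hφ.hasDerivAt_slice x y) (hx.slice_contDiff y).continuous a hh N
  have cF2 : ∀ i, Continuous fun y => ‖F i y‖ ^ 2 := fun i => (cF i).norm.pow 2
  have cFs : Continuous fun y => 2 / h * (∑ i ∈ Finset.range N, ‖F i y‖ ^ 2) :=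
    continuous_const.mul (continuous_finsetSum _ fun i _ => (cF i).norm.pow 2)
  have cxs : Continuous fun y => 2 * h ^ 2 * ∫ x in a..b, ‖fderiv ℝ φ (x, y) (1, 0)‖ ^ 2 :=
    continuous_const.mul (continuous_integral_slice cx2 a b)
  have h2 := intervalIntegral.integral_mono_on hab
    ((continuous_integral_slice cφ2 a b).intervalIntegrable (μ := volume) a b)
    ((cFs.add cxs).intervalIntegrable (μ := volume) a b) fun y _ => h1 y
  simp only [Pi.add_apply] at h2
  rw [intervalIntegral.integral_add (cFs.intervalIntegrable _ _) (cxs.intervalIntegrable _ _),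
    intervalIntegral.integral_const_mul, intervalIntegral.integral_const_mul,
    intervalIntegral.integral_finsetSum fun i _ => (cF2 i).intervalIntegrable _ _] at h2
  -- the inequality in the second variable
  have h3 : ∀ i : ℕ, ∫ y in a..b, ‖F i y‖ ^ 2 ≤ 2 / h * (∑ j ∈ Finset.range N,
      ‖∫ y in (a + j * h)..(a + (j + 1) * h), F i y‖ ^ 2)
      + 2 * h ^ 2 * ∫ y in a..b, h * ∫ x in (a + i * h)..(a + (i + 1) * h),
        ‖QuantumWire.transDeriv φ (x, y)‖ ^ 2 := by
    intro i
    have cF' := continuous_integral_slice cy (a + i * h) (a + (i + 1) * h)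
    refine (poincare_steps (fun y => hφ.hasDerivAt_integral _ _ y) cF' a hh N).trans ?_
    gcongr
    refine intervalIntegral.integral_mono_on hab ((cF'.norm.pow 2).intervalIntegrable a b)
      ((continuous_const.mul (continuous_integral_slice cy2 _ _)).intervalIntegrable a b)
      fun y _ => ?_
    -- Cauchy–Schwarz over an `x`-interval of length `h` supplies a factor `h`, which compensates
    -- the `1 / h` from the inequality in `x`.
    have h4 := sq_integral_norm_le (hy.slice_contDiff y).continuous (hstep i)
    rw [show a + (i + 1) * h - (a + i * h) = h by ring] at h4
    refine le_trans ?_ h4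
    gcongr
    exact intervalIntegral.norm_integral_le_integral_norm (hstep i).le
  have h5 := Finset.sum_le_sum fun i (_ : i ∈ Finset.range N) => h3 i
  rw [Finset.sum_add_distrib, ← Finset.mul_sum, ← Finset.mul_sum] at h5
  have h6 : ∑ i ∈ Finset.range N, ∫ y in a..b, h * ∫ x in (a + i * h)..(a + (i + 1) * h),
        ‖QuantumWire.transDeriv φ (x, y)‖ ^ 2
      = h * ∫ y in a..b, ∫ x in a..b, ‖QuantumWire.transDeriv φ (x, y)‖ ^ 2 := by
    simp only [intervalIntegral.integral_const_mul]
    rw [← Finset.mul_sum, ← intervalIntegral.integral_finsetSum fun i _ =>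
      (continuous_integral_slice cy2 _ _).intervalIntegrable _ _]
    congr 1
    refine intervalIntegral.integral_congr fun y _ => ?_
    rw [sum_integral_steps (f := fun x => ‖QuantumWire.transDeriv φ (x, y)‖ ^ 2)
      (by fun_prop)]
  rw [h6] at h5
  have h7 : 2 / h * (∑ i ∈ Finset.range N, ∫ y in a..b, ‖F i y‖ ^ 2)
      ≤ 2 / h * (2 / h * (∑ i ∈ Finset.range N, ∑ j ∈ Finset.range N,
          ‖∫ y in (a + j * h)..(a + (j + 1) * h), F i y‖ ^ 2)
        + 2 * h ^ 2 * (h * ∫ y in a..b, ∫ x in a..b, ‖QuantumWire.transDeriv φ (x, y)‖ ^ 2)) := by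
    gcongr
  have h8 : 2 / h * (2 / h * (∑ i ∈ Finset.range N, ∑ j ∈ Finset.range N,
          ‖∫ y in (a + j * h)..(a + (j + 1) * h), F i y‖ ^ 2)
        + 2 * h ^ 2 * (h * ∫ y in a..b, ∫ x in a..b, ‖QuantumWire.transDeriv φ (x, y)‖ ^ 2))
      = 4 / h ^ 2 * (∑ i ∈ Finset.range N, ∑ j ∈ Finset.range N,
          ‖∫ y in (a + j * h)..(a + (j + 1) * h), F i y‖ ^ 2)
        + 4 * h ^ 2 * ∫ y in a..b, ∫ x in a..b, ‖QuantumWire.transDeriv φ (x, y)‖ ^ 2 := by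
    field_simp
    ring
  linarith

end Poincare

/-! ### The lower bound for the full form, modulo finitely many averages. -/

section Averages

variable {S : Set ℝ} {W : ℝ → ℝ} {B : ℝ} {φ : ℝ × ℝ → ℂ}

theorem setIntegral_box {E : Type*} [NormedAddCommGroup E] [NormedSpace ℝ E] {f : ℝ × ℝ → E}
    (hf : Continuous f) {a b c d : ℝ} (hab : a ≤ b) (hcd : c ≤ d) :
    ∫ z in Set.Ioc a b ×ˢ Set.Ioc c d, f z = ∫ y in c..d, ∫ x in a..b, f (x, y) := by
  have hi : IntegrableOn f (Set.Ioc a b ×ˢ Set.Ioc c d) :=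
    (hf.continuousOn.integrableOn_compact (isCompact_Icc.prod isCompact_Icc)).mono_set
      (Set.prod_mono Set.Ioc_subset_Icc_self Set.Ioc_subset_Icc_self)
  rw [intervalIntegral.integral_of_le hcd]
  simp only [intervalIntegral.integral_of_le hab]
  rw [IntegrableOn, Measure.volume_eq_prod, ← Measure.prod_restrict] at hi
  rw [Measure.volume_eq_prod, ← Measure.prod_restrict, integral_prod_symm _ hi]

theorem setIntegral_inter_strip {E : Type*} [NormedAddCommGroup E] [NormedSpace ℝ E]
    {f : ℝ × ℝ → E} (hf : ∀ z : ℝ × ℝ, z.2 ∉ S → f z = 0) {A : Set (ℝ × ℝ)}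
    (hA : MeasurableSet A) : ∫ z in A ∩ strip S, f z = ∫ z in A, f z :=
  (setIntegral_eq_of_subset_of_forall_sdiff_eq_zero hA Set.inter_subset_left fun z hz =>
    hf z fun h => hz.2 ⟨hz.1, (⟨trivial, h⟩ : z ∈ strip S)⟩).symm

theorem setIntegral_strip {E : Type*} [NormedAddCommGroup E] [NormedSpace ℝ E]
    {f : ℝ × ℝ → E} (hf : ∀ z : ℝ × ℝ, z.2 ∉ S → f z = 0) : ∫ z in strip S, f z = ∫ z, f z :=
  setIntegral_eq_integral_of_forall_compl_eq_zero fun z hz => hf z fun h => hz ⟨trivial, h⟩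

/-- The Poincaré inequality on a square, with respect to the form of `H₀(B)`. -/
theorem IsTest.setIntegral_square_le (hφ : IsTest S φ) (B : ℝ) {R : ℝ} (hR : 0 < R) {N : ℕ}
    (hN : 0 < N) : ∫ z in Set.Ioc (-R) R ×ˢ Set.Ioc (-R) R, ‖φ z‖ ^ 2
      ≤ 4 / (2 * R / N) ^ 2 * (∑ i ∈ Finset.range N, ∑ j ∈ Finset.range N,
          ‖∫ z in (Set.Ioc (-R + i * (2 * R / N)) (-R + (i + 1) * (2 * R / N)) ×ˢ
            Set.Ioc (-R + j * (2 * R / N)) (-R + (j + 1) * (2 * R / N))) ∩ strip S, φ z‖ ^ 2)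
        + 4 * (2 * R / N) ^ 2 * ((∫ z in strip S, ‖QuantumWire.magDeriv B φ z‖ ^ 2)
          + B ^ 2 * R ^ 2 * (∫ z in strip S, ‖φ z‖ ^ 2)
          + ∫ z in strip S, ‖QuantumWire.transDeriv φ z‖ ^ 2) := by
  set h := 2 * R / N with hh
  have hN' : (0 : ℝ) < N := Nat.cast_pos.2 hN
  have hh0 : 0 < h := by positivity
  have hNh : -R + N * h = R := by
    rw [hh]
    field_simp
    ring
  have hx := hφ.fderiv_apply (1, 0)
  have hy := hφ.transDeriv
  have hm := hφ.magDeriv B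
  have cφ := hφ.smooth.continuous
  have cx := hx.smooth.continuous
  have cy := hy.smooth.continuous
  have nsq : ∀ {χ : ℝ × ℝ → ℂ}, IsTest S χ → ∫ z in strip S, ‖χ z‖ ^ 2 = ∫ z, ‖χ z‖ ^ 2 :=
    fun hχ => setIntegral_strip fun z hz => by simp [hχ.eq_zero_of_notMem hz]
  have isq : ∀ {χ : ℝ × ℝ → ℂ}, IsTest S χ → Integrable fun z => ‖χ z‖ ^ 2 := fun {χ} hχ =>
    (hχ.smooth.continuous.memLp_of_hasCompactSupport (p := 2) hχ.compact).integrable_norm_pow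
      (by simp)
  have key := hφ.poincare_square (-R) hh0 N
  rw [hNh] at key
  have hRR : -R ≤ R := by linarith
  have cφ2 : Continuous fun z => ‖φ z‖ ^ 2 := by fun_prop
  have cx2 : Continuous fun z => ‖fderiv ℝ φ z (1, 0)‖ ^ 2 := by fun_prop
  have cy2 : Continuous fun z => ‖QuantumWire.transDeriv φ z‖ ^ 2 := by fun_prop
  have hstep : ∀ i : ℕ, -R + i * h ≤ -R + (i + 1) * h := fun i => by nlinarith
  have hsum : ∀ i j : ℕ, ∫ z in (Set.Ioc (-R + i * h) (-R + (i + 1) * h) ×ˢ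
      Set.Ioc (-R + j * h) (-R + (j + 1) * h)) ∩ strip S, φ z
      = ∫ y in (-R + j * h)..(-R + (j + 1) * h), ∫ x in (-R + i * h)..(-R + (i + 1) * h),
        φ (x, y) := by
    intro i j
    rw [setIntegral_inter_strip (fun z hz => hφ.eq_zero_of_notMem hz)
      (measurableSet_Ioc.prod measurableSet_Ioc), setIntegral_box cφ (hstep i) (hstep j)]
  rw [← setIntegral_box cφ2 hRR hRR, ← setIntegral_box cx2 hRR hRR,
    ← setIntegral_box cy2 hRR hRR] at key
  simp only [← hsum] at key
  -- The Poincaré inequality involves `∂ₓ`, while the form contains the magnetic derivative. They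
  -- differ by the term `B y φ`, whose coefficient is at most `|B| R` on the square.
  have hxle : ∫ z in Set.Ioc (-R) R ×ˢ Set.Ioc (-R) R, ‖fderiv ℝ φ z (1, 0)‖ ^ 2
      ≤ 2 * (∫ z in strip S, ‖QuantumWire.magDeriv B φ z‖ ^ 2)
        + 2 * (B ^ 2 * R ^ 2) * ∫ z in strip S, ‖φ z‖ ^ 2 := by
    have i1 : Integrable fun z => 2 * ‖QuantumWire.magDeriv B φ z‖ ^ 2
        + 2 * (B ^ 2 * R ^ 2) * ‖φ z‖ ^ 2 :=
      ((isq hm).const_mul _).add ((isq hφ).const_mul _)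
    rw [nsq hm, nsq hφ, ← integral_const_mul, ← integral_const_mul,
      ← integral_add ((isq hm).const_mul _) ((isq hφ).const_mul _)]
    refine le_trans (setIntegral_mono_on (isq hx).integrableOn i1.integrableOn
      (measurableSet_Ioc.prod measurableSet_Ioc) fun z hz => ?_)
      (setIntegral_le_integral i1 (Filter.Eventually.of_forall fun z => by positivity))
    have e1 : fderiv ℝ φ z (1, 0)
        = Complex.I * (QuantumWire.magDeriv B φ z + (B * z.2 : ℝ) * φ z) := by
      rw [QuantumWire.magDeriv]
      linear_combination fderiv ℝ φ z (1, 0) * Complex.I_sq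
    have e2 : ‖fderiv ℝ φ z (1, 0)‖ ≤ ‖QuantumWire.magDeriv B φ z‖ + |B * z.2| * ‖φ z‖ := by
      rw [e1, norm_mul, Complex.norm_I, one_mul]
      refine (norm_add_le _ _).trans ?_
      rw [norm_mul, Complex.norm_real, Real.norm_eq_abs]
    have e3 : (|B * z.2| * ‖φ z‖) ^ 2 ≤ B ^ 2 * R ^ 2 * ‖φ z‖ ^ 2 := by
      rw [mul_pow, sq_abs, mul_pow]
      have : z.2 ^ 2 ≤ R ^ 2 := sq_le_sq' hz.2.1.le hz.2.2
      gcongr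
    have e4 := pow_le_pow_left₀ (norm_nonneg _) e2 2
    nlinarith [sq_nonneg (‖QuantumWire.magDeriv B φ z‖ - |B * z.2| * ‖φ z‖)]
  have hyle : ∫ z in Set.Ioc (-R) R ×ˢ Set.Ioc (-R) R, ‖QuantumWire.transDeriv φ z‖ ^ 2
      ≤ ∫ z in strip S, ‖QuantumWire.transDeriv φ z‖ ^ 2 := by
    rw [nsq hy]
    exact setIntegral_le_integral (isq hy) (Filter.Eventually.of_forall fun z => sq_nonneg _)
  have h1 := mul_le_mul_of_nonneg_left hxle (by positivity : 0 ≤ 2 * h ^ 2)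
  have h2 := mul_le_mul_of_nonneg_left hyle (by positivity : 0 ≤ 4 * h ^ 2)
  linarith

theorem ae_abs_le_norm {μ : Measure (ℝ × ℝ)} (U : Lp ℝ ⊤ μ) : ∀ᵐ z ∂μ, |U z| ≤ ‖U‖ := by
  filter_upwards [enorm_ae_le_eLpNormEssSup U μ] with z hz
  rw [Lp.norm_def, eLpNorm_exponent_top, ← Real.norm_eq_abs, ← toReal_enorm]
  refine ENNReal.toReal_mono ?_ hz
  rw [← eLpNorm_exponent_top]
  exact (Lp.memLp U).2.ne

theorem integrable_mul_norm_sq (U : Lp ℝ ⊤ (stripMeasure S)) (hφ : IsTest S φ) :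
    Integrable (fun z => U z * ‖φ z‖ ^ 2) (stripMeasure S) :=
  hφ.integrable_norm_sq.bdd_mul (Lp.aestronglyMeasurable U) (ae_abs_le_norm U)

/-- Refining the mesh makes the gradient term of the Poincaré inequality as small as desired. -/
theorem exists_sq_mul_le (M X : ℝ) {ε : ℝ} (hε : 0 < ε) (hM : 0 ≤ M) : ∃ N : ℕ,
    0 < N ∧ M * (4 * (X / N) ^ 2) ≤ ε := by
  obtain ⟨N, hN⟩ := exists_nat_gt (4 * M * X ^ 2 / ε + 1)
  have hN1 : (1 : ℝ) < N := by
    have : 0 ≤ 4 * M * X ^ 2 / ε := by positivity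
    linarith
  refine ⟨N, by exact_mod_cast one_pos.trans hN1, ?_⟩
  have h1 : 4 * M * X ^ 2 ≤ ε * N := by
    have : 4 * M * X ^ 2 / ε ≤ N := by linarith
    rwa [div_le_iff₀' hε] at this
  rw [div_pow, mul_div_assoc', mul_div_assoc', div_le_iff₀ (by positivity)]
  have h2 : ε * N ≤ ε * N ^ 2 := mul_le_mul_of_nonneg_left (by nlinarith) hε.le
  linarith

/-- Up to finitely many averages, the form of `H_U(B)` is bounded from below by every number below
the ground state energy of the fibers. -/
theorem exists_lower_bound_mod_averages (hw : IsWire S W) (U : Lp ℝ ⊤ (stripMeasure S))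
    (hU : ∀ ε : ℝ, 0 < ε → ∃ R : ℝ, ∀ᵐ z ∂(stripMeasure S), R ≤ |z.1| → |U z| ≤ ε)
    {l : ℝ} (hl : l < groundEnergy S W B) :
    ∃ (m : ℕ) (A : Fin m → Set (ℝ × ℝ)) (c : ℝ), (∀ j, MeasurableSet (A j)) ∧
      (∀ j, volume (A j) ≠ ⊤) ∧ 0 ≤ c ∧ ∀ φ, IsTest S φ → l * ∫ z in strip S, ‖φ z‖ ^ 2
        ≤ energy S W U B φ + c * ∑ j, ‖∫ z in A j ∩ strip S, φ z‖ ^ 2 := by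
  set L := groundEnergy S W B with hL
  have hL0 : 0 ≤ L := groundEnergy_nonneg hw
  -- The estimates below cost `ε` times the kinetic and confinement terms and `3ε` times the mass:
  -- `2ε` from the potential outside the box, `ε` from inside. The remaining bound is `(1 - ε) L -
  -- 3ε = L - ε (L + 3) ≥ l`.
  set ε := min 1 ((L - l) / (L + 3)) with hε
  have hε0 : 0 < ε := lt_min one_pos (div_pos (sub_pos.2 hl) (by linarith))
  have hε1 : ε ≤ 1 := min_le_left _ _
  have hεl : ε * (L + 3) ≤ L - l := by
    rw [← le_div_iff₀ (by linarith)]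
    exact min_le_right _ _
  obtain ⟨M, hM, hMS⟩ := hw.exists_sq_le
  obtain ⟨R₀, hR₀⟩ := hU ε hε0
  -- Here `R ≥ R₀` makes `|U| ≤ ε` for `|x| ≥ R`, and `‖U‖ M ≤ ε R²` makes `‖U‖ ≤ ε (1 + W)` for
  -- `|y| ≥ R`.
  set R := |R₀| + 1 + ‖U‖ * M / ε with hR
  have hUM : 0 ≤ ‖U‖ * M / ε := by positivity
  have hR1 : 1 ≤ R := by linarith [abs_nonneg R₀]
  have hR0 : 0 < R := by linarith
  have hRR₀ : R₀ ≤ R := by linarith [le_abs_self R₀]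
  have hRM : ‖U‖ * M ≤ ε * R ^ 2 := by
    have h1 : ‖U‖ * M / ε ≤ R := by linarith [abs_nonneg R₀]
    rw [div_le_iff₀' hε0] at h1
    exact h1.trans (mul_le_mul_of_nonneg_left (by nlinarith) hε0.le)
  -- The box is fixed before the mesh, so the factor `1 + B² R²` from the magnetic potential is
  -- harmless.
  obtain ⟨N, hN, hNε⟩ := exists_sq_mul_le (‖U‖ * (1 + B ^ 2 * R ^ 2)) (2 * R) hε0
    (by positivity)
  set h := 2 * R / N with hh
  set I : ℕ → Set ℝ := fun i => Set.Ioc (-R + i * h) (-R + (i + 1) * h) with hI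
  let e : Fin N × Fin N ≃ Fin (N * N) := finProdFinEquiv
  refine ⟨N * N, fun j => I (e.symm j).1 ×ˢ I (e.symm j).2, ‖U‖ * (4 / h ^ 2),
    fun j => measurableSet_Ioc.prod measurableSet_Ioc, fun j => ?_, by positivity, fun φ hφ => ?_⟩
  · rw [Measure.volume_eq_prod, Measure.prod_prod]
    exact ENNReal.mul_ne_top measure_Ioc_lt_top.ne measure_Ioc_lt_top.ne
  rw [Equiv.sum_comp e.symm (fun q : Fin N × Fin N => ‖∫ z in I q.1 ×ˢ I q.2 ∩ strip S, φ z‖ ^ 2),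
    Fintype.sum_prod_type]
  have hbox := hφ.setIntegral_square_le B hR0 hN
  have hsum : (∑ i : Fin N, ∑ j : Fin N, ‖∫ z in I i ×ˢ I j ∩ strip S, φ z‖ ^ 2)
      = ∑ i ∈ Finset.range N, ∑ j ∈ Finset.range N, ‖∫ z in I i ×ˢ I j ∩ strip S, φ z‖ ^ 2 := by
    rw [Finset.sum_range]
    refine Finset.sum_congr rfl fun i _ => ?_
    rw [Finset.sum_range]
  simp only
  rw [hsum]
  set Av := ∑ i ∈ Finset.range N, ∑ j ∈ Finset.range N, ‖∫ z in I i ×ˢ I j ∩ strip S, φ z‖ ^ 2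
  have hbound := groundEnergy_mul_le_energy (B := B) hw hφ
  set K : Set (ℝ × ℝ) := Set.Ioc (-R) R ×ˢ Set.Ioc (-R) R with hK
  have mK : MeasurableSet K := measurableSet_Ioc.prod measurableSet_Ioc
  have i1 := hφ.integrable_norm_sq
  have i4 : Integrable (fun z => ‖sqrtMul W φ z‖ ^ 2) (stripMeasure S) :=
    (hφ.memLp_sqrtMul hw.locallyIntegrable).integrable_norm_pow (by simp)
  have hpot : -(2 * ε * (∫ z in strip S, ‖φ z‖ ^ 2) + ε * (∫ z in strip S, ‖sqrtMul W φ z‖ ^ 2)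
      + ‖U‖ * ∫ z in K, ‖φ z‖ ^ 2) ≤ ∫ z in strip S, U z * ‖φ z‖ ^ 2 := by
    have j1 : Integrable (fun z => 2 * ε * ‖φ z‖ ^ 2 + ε * ‖sqrtMul W φ z‖ ^ 2)
        (stripMeasure S) := (i1.const_mul _).add (i4.const_mul _)
    have j2 : Integrable (fun z => K.indicator (fun z => ‖U‖ * ‖φ z‖ ^ 2) z) (stripMeasure S) :=
      (i1.const_mul _).indicator mK
    have eK : ∫ z in strip S, K.indicator (fun z => ‖U‖ * ‖φ z‖ ^ 2) z
        = ‖U‖ * ∫ z in K, ‖φ z‖ ^ 2 := by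
      rw [integral_indicator mK, Measure.restrict_restrict mK,
        setIntegral_inter_strip (fun z hz => by simp [hφ.eq_zero_of_notMem hz]) mK,
        integral_const_mul]
    rw [← eK, ← integral_const_mul, ← integral_const_mul,
      ← integral_add (i1.const_mul _) (i4.const_mul _), ← integral_add j1 j2, ← integral_neg]
    refine integral_mono_ae (j1.add j2).neg (integrable_mul_norm_sq U hφ) ?_
    have hmem : ∀ᵐ z ∂(stripMeasure S), z ∈ strip S :=
      ae_restrict_mem (isOpen_strip hw.isOpen).measurableSet
    filter_upwards [hR₀, ae_abs_le_norm U, hmem] with z hz1 hz2 hz3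
    have hWz := hw.nonneg hz3.2
    have e4 : ‖sqrtMul W φ z‖ ^ 2 = W z.2 * ‖φ z‖ ^ 2 := by
      rw [sqrtMul, norm_mul, mul_pow, Complex.norm_real, Real.norm_eq_abs, sq_abs,
        Real.sq_sqrt hWz]
    -- Three regions: inside the box `|U|` is bounded by its norm; for `|x| ≥ R` it is at most `ε`;
    -- for `|y| ≥ R` it is absorbed by `ε (1 + W)`.
    have main : |U z| * ‖φ z‖ ^ 2 ≤ 2 * ε * ‖φ z‖ ^ 2 + ε * ‖sqrtMul W φ z‖ ^ 2
        + K.indicator (fun z => ‖U‖ * ‖φ z‖ ^ 2) z := by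
      rw [e4]
      have hn : 0 ≤ ‖φ z‖ ^ 2 := sq_nonneg _
      have hεn : 0 ≤ ε * ‖φ z‖ ^ 2 := by positivity
      have hεW : 0 ≤ ε * (W z.2 * ‖φ z‖ ^ 2) := by positivity
      by_cases hzK : z ∈ K
      · rw [Set.indicator_of_mem hzK]
        have := mul_le_mul_of_nonneg_right hz2 hn
        linarith
      · rw [Set.indicator_of_notMem hzK, add_zero]
        by_cases hz1R : R ≤ |z.1|
        · have := mul_le_mul_of_nonneg_right (hz1 (hRR₀.trans hz1R)) hn
          linarith
        · have hz2R : R ≤ |z.2| := by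
            by_contra hcon
            rw [not_le, abs_lt] at hcon hz1R
            exact hzK ⟨⟨hz1R.1, hz1R.2.le⟩, ⟨hcon.1, hcon.2.le⟩⟩
          have h2 : R ^ 2 ≤ z.2 ^ 2 := by
            rw [← sq_abs z.2]
            gcongr
          have h3 := hMS z.2 hz3.2
          have h4 : ‖U‖ ≤ ε * (1 + W z.2) := by
            have h5 : M * ‖U‖ ≤ M * (ε * (1 + W z.2)) := by
              calc M * ‖U‖ = ‖U‖ * M := mul_comm _ _
                _ ≤ ε * R ^ 2 := hRM
                _ ≤ ε * (M * (1 + W z.2)) := by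
                  gcongr
                  exact h2.trans h3
                _ = _ := by ring
            exact le_of_mul_le_mul_left h5 hM
          have := mul_le_mul_of_nonneg_right (hz2.trans h4) hn
          linarith
    have h5 : -(|U z| * ‖φ z‖ ^ 2) ≤ U z * ‖φ z‖ ^ 2 := by
      have := mul_le_mul_of_nonneg_right (neg_abs_le (U z)) (sq_nonneg ‖φ z‖)
      linarith
    change -(2 * ε * ‖φ z‖ ^ 2 + ε * ‖sqrtMul W φ z‖ ^ 2
      + K.indicator (fun z => ‖U‖ * ‖φ z‖ ^ 2) z) ≤ _
    linarith
  have hn0 : 0 ≤ ∫ z in strip S, ‖φ z‖ ^ 2 := integral_nonneg fun z => sq_nonneg _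
  have hm0 : 0 ≤ ∫ z in strip S, ‖magDeriv B φ z‖ ^ 2 := integral_nonneg fun z => sq_nonneg _
  have ht0 : 0 ≤ ∫ z in strip S, ‖transDeriv φ z‖ ^ 2 := integral_nonneg fun z => sq_nonneg _
  rw [energy]
  set n := ∫ z in strip S, ‖φ z‖ ^ 2
  set mg := ∫ z in strip S, ‖magDeriv B φ z‖ ^ 2
  set t := ∫ z in strip S, ‖transDeriv φ z‖ ^ 2
  set w := ∫ z in strip S, ‖sqrtMul W φ z‖ ^ 2
  have hbox' : ‖U‖ * ∫ z in K, ‖φ z‖ ^ 2 ≤ ‖U‖ * (4 / h ^ 2) * Av + ε * (mg + n + t) := by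
    have hb2 : 0 ≤ B ^ 2 * R ^ 2 := by positivity
    calc ‖U‖ * ∫ z in K, ‖φ z‖ ^ 2
        ≤ ‖U‖ * (4 / h ^ 2 * Av + 4 * h ^ 2 * (mg + B ^ 2 * R ^ 2 * n + t)) := by
          gcongr
      _ ≤ ‖U‖ * (4 / h ^ 2 * Av + 4 * h ^ 2 * ((1 + B ^ 2 * R ^ 2) * (mg + n + t))) := by
          gcongr
          nlinarith [mul_nonneg hb2 hm0, mul_nonneg hb2 ht0]
      _ = ‖U‖ * (4 / h ^ 2) * Av + (‖U‖ * (1 + B ^ 2 * R ^ 2) * (4 * h ^ 2)) * (mg + n + t) := by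
          ring
      _ ≤ _ := by gcongr
  have h6 : (1 - ε) * (L * n) ≤ (1 - ε) * (mg + t + w) :=
    mul_le_mul_of_nonneg_left hbound (sub_nonneg.2 hε1)
  have h7 : ε * (L + 3) * n ≤ (L - l) * n := mul_le_mul_of_nonneg_right hεl hn0
  linarith

end Averages

/-! ### Trial functions with energy below the fiber ground state energy. -/

section Trial

variable {S : Set ℝ} {W : ℝ → ℝ} {B p : ℝ} {f g : ℝ → ℝ}

/-- The trial function `exp(ipx) f(x) g(y)`. -/
noncomputable def trial (p : ℝ) (f g : ℝ → ℝ) (z : ℝ × ℝ) : ℂ :=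
  Complex.exp ((p * z.1 : ℝ) * Complex.I) * (f z.1 * g z.2 : ℝ)

theorem norm_sq_trial (z : ℝ × ℝ) : ‖trial p f g z‖ ^ 2 = f z.1 ^ 2 * g z.2 ^ 2 := by
  rw [trial, norm_mul, Complex.norm_exp_ofReal_mul_I, one_mul, Complex.norm_real, Real.norm_eq_abs,
    sq_abs, mul_pow]

theorem isTest_trial (hf : IsTest₁ Set.univ f) (hg : IsTest₁ S g) : IsTest S (trial p f g) := by
  have hsub : tsupport (trial p f g) ⊆ tsupport f ×ˢ tsupport g := by
    refine closure_minimal (fun z hz => ?_)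
      ((isClosed_tsupport f).prod (isClosed_tsupport g))
    have h : f z.1 * g z.2 ≠ 0 := fun h => hz (by rw [trial, h, Complex.ofReal_zero, mul_zero])
    exact ⟨subset_tsupport _ (left_ne_zero_of_mul h), subset_tsupport _ (right_ne_zero_of_mul h)⟩
  have sf := hf.smooth
  have sg := hg.smooth
  refine ⟨?_, (hf.compact.prod hg.compact).of_isClosed_subset (isClosed_tsupport _) hsub,
    hsub.trans (Set.prod_mono (Set.subset_univ _) hg.supp)⟩
  refine ContDiff.mul (ContDiff.cexp ?_) (Complex.ofRealCLM.contDiff.comp ?_)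
  · exact (Complex.ofRealCLM.contDiff.comp (contDiff_const.mul contDiff_fst)).mul contDiff_const
  · exact (sf.comp contDiff_fst).mul (sg.comp contDiff_snd)

theorem magDeriv_trial (hf : IsTest₁ Set.univ f) (hg : IsTest₁ S g) (z : ℝ × ℝ) :
    magDeriv B (trial p f g) z = Complex.exp ((p * z.1 : ℝ) * Complex.I)
      * (((p - B * z.2) * f z.1 * g z.2 : ℝ) + (-(deriv f z.1 * g z.2) : ℝ) * Complex.I) := by
  have h1 := (isTest_trial (p := p) hf hg).hasDerivAt_slice z.1 z.2
  have h2 : HasDerivAt (fun x => trial p f g (x, z.2))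
      (Complex.exp ((p * z.1 : ℝ) * Complex.I) * ((p * 1 : ℝ) * Complex.I)
        * (f z.1 * g z.2 : ℝ) + Complex.exp ((p * z.1 : ℝ) * Complex.I)
        * (deriv f z.1 * g z.2 : ℝ)) z.1 :=
    ((((hasDerivAt_id z.1).const_mul p).ofReal_comp.mul_const Complex.I).cexp).mul
      (((hf.differentiable z.1).hasDerivAt.mul_const (g z.2)).ofReal_comp)
  rw [magDeriv, h1.unique h2, trial]
  push_cast
  linear_combination (-Complex.exp (p * z.1 * Complex.I) * p * f z.1 * g z.2) * Complex.I_sq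

/-- Up to a phase, the contribution of `p - By` is real and that of `f'` is imaginary, so no cross
term appears. -/
theorem norm_sq_magDeriv_trial (hf : IsTest₁ Set.univ f) (hg : IsTest₁ S g) (z : ℝ × ℝ) :
    ‖magDeriv B (trial p f g) z‖ ^ 2
      = f z.1 ^ 2 * ((p - B * z.2) ^ 2 * g z.2 ^ 2) + deriv f z.1 ^ 2 * g z.2 ^ 2 := by
  rw [magDeriv_trial hf hg, norm_mul, Complex.norm_exp_ofReal_mul_I, one_mul, Complex.sq_norm,
    Complex.normSq_add_mul_I]
  ring

theorem norm_sq_transDeriv_trial (hf : IsTest₁ Set.univ f) (hg : IsTest₁ S g) (z : ℝ × ℝ) :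
    ‖transDeriv (trial p f g) z‖ ^ 2 = f z.1 ^ 2 * deriv g z.2 ^ 2 := by
  have h1 := (isTest_trial (p := p) hf hg).hasDerivAt_slice' z.1 z.2
  have h2 : HasDerivAt (fun y => trial p f g (z.1, y))
      (Complex.exp ((p * z.1 : ℝ) * Complex.I) * (f z.1 * deriv g z.2 : ℝ)) z.2 :=
    (((hg.differentiable z.2).hasDerivAt.const_mul (f z.1)).ofReal_comp).const_mul
      (Complex.exp ((p * z.1 : ℝ) * Complex.I))
  rw [h1.unique h2, norm_mul, Complex.norm_exp_ofReal_mul_I, one_mul, Complex.norm_real,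
    Real.norm_eq_abs, sq_abs, mul_pow]

theorem norm_sq_sqrtMul_trial (hw : IsWire S W) (hg : IsTest₁ S g) (z : ℝ × ℝ) :
    ‖sqrtMul W (trial p f g) z‖ ^ 2 = f z.1 ^ 2 * (W z.2 * g z.2 ^ 2) := by
  rw [sqrtMul, norm_mul, mul_pow, norm_sq_trial, Complex.norm_real, Real.norm_eq_abs, sq_abs]
  by_cases hz : z.2 ∈ S
  · rw [Real.sq_sqrt (hw.nonneg hz)]
    ring
  · simp [hg.eq_zero_of_notMem hz]

theorem integral_norm_sq_trial (hg : IsTest₁ S g) :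
    ∫ z in strip S, ‖trial p f g z‖ ^ 2 = (∫ x, f x ^ 2) * ∫ y, g y ^ 2 := by
  simp only [norm_sq_trial]
  rw [setIntegral_strip fun z hz => by simp [hg.eq_zero_of_notMem hz], Measure.volume_eq_prod]
  exact integral_prod_mul (fun x => f x ^ 2) (fun y => g y ^ 2)

theorem IsTest₁.integrable_momentum_mul_sq (hg : IsTest₁ S g) (B p : ℝ) :
    Integrable fun y => (p - B * y) ^ 2 * g y ^ 2 := by
  have cg := hg.smooth.continuous
  exact Continuous.integrable_of_hasCompactSupport (by fun_prop)
    (hasCompactSupport_sq hg.compact).mul_left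

theorem integral_magDeriv_trial (hf : IsTest₁ Set.univ f) (hg : IsTest₁ S g) :
    ∫ z in strip S, ‖magDeriv B (trial p f g) z‖ ^ 2
      = (∫ x, f x ^ 2) * (∫ y, (p - B * y) ^ 2 * g y ^ 2)
        + (∫ x, deriv f x ^ 2) * ∫ y, g y ^ 2 := by
  have i1 := hg.integrable_momentum_mul_sq B p
  simp only [norm_sq_magDeriv_trial hf hg]
  rw [setIntegral_strip fun z hz => by simp [hg.eq_zero_of_notMem hz], Measure.volume_eq_prod,
    integral_add (hf.integrable_sq.mul_prod i1)
      (hf.integrable_deriv_sq.mul_prod hg.integrable_sq)]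
  exact congrArg₂ (· + ·) (integral_prod_mul (fun x => f x ^ 2) fun y => (p - B * y) ^ 2 * g y ^ 2)
    (integral_prod_mul (fun x => deriv f x ^ 2) fun y => g y ^ 2)

theorem integral_transDeriv_trial (hf : IsTest₁ Set.univ f) (hg : IsTest₁ S g) :
    ∫ z in strip S, ‖transDeriv (trial p f g) z‖ ^ 2
      = (∫ x, f x ^ 2) * ∫ y, deriv g y ^ 2 := by
  rw [setIntegral_strip fun z hz => by
    simp [(isTest_trial (p := p) hf hg).transDeriv.eq_zero_of_notMem hz]]
  simp only [norm_sq_transDeriv_trial hf hg]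
  rw [Measure.volume_eq_prod]
  exact integral_prod_mul (fun x => f x ^ 2) (fun y => deriv g y ^ 2)

theorem integral_sqrtMul_trial (hw : IsWire S W) (hg : IsTest₁ S g) :
    ∫ z in strip S, ‖sqrtMul W (trial p f g) z‖ ^ 2
      = (∫ x, f x ^ 2) * ∫ y, W y * g y ^ 2 := by
  simp only [norm_sq_sqrtMul_trial hw hg]
  rw [setIntegral_strip fun z hz => by simp [hg.eq_zero_of_notMem hz], Measure.volume_eq_prod]
  exact integral_prod_mul (fun x => f x ^ 2) (fun y => W y * g y ^ 2)

/-- Separation of variables: the cut-off contributes only through `∫ f'²`, the excess over the fiber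
energy carried along the wire. -/
theorem energy_trial (hw : IsWire S W) (U : ℝ × ℝ → ℝ) (hf : IsTest₁ Set.univ f)
    (hg : IsTest₁ S g) : energy S W U B (trial p f g)
      = (∫ x, f x ^ 2) * fiberForm W B p g + (∫ x, deriv f x ^ 2) * (∫ y, g y ^ 2)
        + ∫ z in strip S, U z * ‖trial p f g z‖ ^ 2 := by
  have i1 := hg.integrable_momentum_mul_sq B p
  have i2 := hg.integrable_mul_sq hw.locallyIntegrable
  have e : fiberForm W B p g = (∫ y, deriv g y ^ 2) + ((∫ y, (p - B * y) ^ 2 * g y ^ 2)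
      + ∫ y, W y * g y ^ 2) := by
    have i3 : Integrable fun y => (p - B * y) ^ 2 * g y ^ 2 + W y * g y ^ 2 := i1.add i2
    rw [← integral_add i1 i2, ← integral_add hg.integrable_deriv_sq i3, fiberForm]
    simp only [pot, add_mul]
  rw [energy, integral_magDeriv_trial hf hg, integral_transDeriv_trial hf hg,
    integral_sqrtMul_trial hw hg, e]
  ring

/-- Dilated cut-off functions. -/
theorem exists_dilated_cutoff : ∃ A : ℝ, 0 < A ∧ ∀ L : ℝ, 0 < L → ∃ f, IsTest₁ Set.univ f ∧
    (∀ x, |x| ≤ L → f x = 1) ∧ ∫ x, f x ^ 2 ≤ L * A ∧ ∫ x, deriv f x ^ 2 ≤ A / L := by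
  let b : ContDiffBump (0 : ℝ) := ⟨1, 2, one_pos, one_lt_two⟩
  have n1 : 0 ≤ ∫ x, b x ^ 2 := integral_nonneg fun x => sq_nonneg _
  have n2 : 0 ≤ ∫ x, deriv b x ^ 2 := integral_nonneg fun x => sq_nonneg _
  refine ⟨(∫ x, b x ^ 2) + (∫ x, deriv b x ^ 2) + 1, by linarith, fun L hL =>
    ⟨fun x => b (x / L), ⟨b.contDiff.comp (contDiff_id.div_const L), ?_, Set.subset_univ _⟩,
      fun x hx => b.one_of_mem_closedBall ?_, ?_, ?_⟩⟩
  · have := b.hasCompactSupport.comp_homeomorph (Homeomorph.mulRight₀ L⁻¹ (inv_ne_zero hL.ne'))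
    simpa [Function.comp_def, div_eq_mul_inv] using this
  · rw [mem_closedBall_zero_iff, Real.norm_eq_abs, abs_div, abs_of_pos hL]
    exact div_le_one_of_le₀ hx hL.le
  · rw [Measure.integral_comp_div (fun x => b x ^ 2) L, abs_of_pos hL, smul_eq_mul]
    gcongr
    linarith
  · have hd : ∀ x, deriv (fun x => b (x / L)) x = deriv b (x / L) / L := fun x => by
      have h1 : HasDerivAt b (deriv b (x / L)) (x / L) :=
        ((b.contDiff (n := 1)).differentiable one_ne_zero _).hasDerivAt
      have h2 := h1.comp x ((hasDerivAt_id x).div_const L)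
      rw [show (fun x => b (x / L)) = b ∘ fun x => id x / L from rfl, h2.deriv, mul_one_div]
    simp only [hd, div_pow]
    rw [integral_div, Measure.integral_comp_div (fun x => deriv b x ^ 2) L, abs_of_pos hL,
      smul_eq_mul, sq L, mul_div_mul_left _ _ hL.ne']
    gcongr
    linarith

theorem integrableOn_potential (U : Lp ℝ ⊤ (stripMeasure S)) (n r : ℝ) :
    IntegrableOn U (Set.Icc (-n) n ×ˢ Set.Icc (-r) r) (stripMeasure S) := by
  refine Measure.integrableOn_of_bounded (M := ‖U‖) ?_ (Lp.aestronglyMeasurable U)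
    (ae_restrict_of_ae (ae_abs_le_norm U))
  exact ((Measure.restrict_apply_le _ _).trans_lt
    (isCompact_Icc.prod isCompact_Icc).measure_lt_top).ne

/-- An essentially nonpositive nonzero potential has a negative integral over some rectangle. -/
theorem exists_setIntegral_neg (hw : IsWire S W) (U : Lp ℝ ⊤ (stripMeasure S)) (hU : U ≠ 0)
    (hU' : ∀ᵐ z ∂(stripMeasure S), U z ≤ 0) : ∃ n : ℝ, ∃ r ∈ S,
      ∫ z in Set.Icc (-n) n ×ˢ Set.Icc (-r) r, U z ∂(stripMeasure S) < 0 := by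
  by_contra! hc
  -- Natural `n` and rational `q` give countably many rectangles covering the strip, so the null
  -- sets can be combined. On each rectangle a nonpositive `U` with nonnegative integral vanishes
  -- almost everywhere.
  have key : ∀ (n : ℕ) (q : ℚ), ∀ᵐ z ∂(stripMeasure S), (q : ℝ) ∈ S →
      z ∈ Set.Icc (-n : ℝ) n ×ˢ Set.Icc (-q : ℝ) q → U z = 0 := by
    intro n q
    by_cases hq : (q : ℝ) ∈ S
    · have h1 := hc n q hq
      have hneg : 0 ≤ᵐ[(stripMeasure S).restrict (Set.Icc (-n : ℝ) n ×ˢ Set.Icc (-q : ℝ) q)]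
          fun z => -U z := ae_restrict_of_ae (hU'.mono fun z hz => neg_nonneg.2 hz)
      have h2 : ∫ z in Set.Icc (-n : ℝ) n ×ˢ Set.Icc (-q : ℝ) q, -U z ∂(stripMeasure S) = 0 :=
        le_antisymm (by rw [integral_neg]; linarith) (integral_nonneg_of_ae hneg)
      rw [setIntegral_eq_zero_iff_of_nonneg_ae hneg (integrableOn_potential U n q).neg] at h2
      filter_upwards [(ae_restrict_iff' (measurableSet_Icc.prod measurableSet_Icc)).1 h2]
        with z hz _ hzK
      exact neg_eq_zero.1 (hz hzK)
    · exact Filter.Eventually.of_forall fun z h => absurd h hq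
  refine hU (Lp.ext ?_)
  filter_upwards [ae_all_iff.2 fun n => ae_all_iff.2 (key n),
    ae_restrict_mem (isOpen_strip hw.isOpen).measurableSet, Lp.coeFn_zero ℝ ⊤ (stripMeasure S)]
    with z hz hzS h0
  rw [h0]
  obtain ⟨n, hn⟩ := exists_nat_ge |z.1|
  obtain ⟨r, hr, hlt⟩ := hw.exists_gt (hw.abs_mem hzS.2)
  obtain ⟨q, hq1, hq2⟩ := exists_rat_btwn hlt
  have hq0 : (0 : ℝ) ≤ q := (abs_nonneg _).trans hq1.le
  exact hz n q (hw.mem_of_abs_le hr (by rw [abs_of_nonneg hq0]; exact hq2.le))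
    ⟨abs_le.1 hn, abs_le.1 hq1.le⟩

/-- Since `U ≤ 0`, discarding everything outside the rectangle only increases the integral; inside,
the squared trial function is at least `δ²`. -/
theorem integral_potential_trial_le (U : Lp ℝ ⊤ (stripMeasure S))
    (hU : ∀ᵐ z ∂(stripMeasure S), U z ≤ 0) (hf : IsTest₁ Set.univ f) (hg : IsTest₁ S g)
    {n r δ : ℝ} (hδ : 0 ≤ δ) (hf1 : ∀ x, |x| ≤ n → f x = 1) (hgδ : ∀ y, |y| ≤ r → δ ≤ g y) :
    ∫ z in strip S, U z * ‖trial p f g z‖ ^ 2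
      ≤ δ ^ 2 * ∫ z in Set.Icc (-n) n ×ˢ Set.Icc (-r) r, U z ∂(stripMeasure S) := by
  have mK : MeasurableSet (Set.Icc (-n) n ×ˢ Set.Icc (-r) r) :=
    measurableSet_Icc.prod measurableSet_Icc
  rw [← integral_const_mul, ← integral_indicator mK]
  refine integral_mono_ae (integrable_mul_norm_sq U (isTest_trial hf hg))
    ((integrable_indicator_iff mK).2 ((integrableOn_potential U n r).const_mul _)) ?_
  filter_upwards [hU] with z hz
  by_cases hzK : z ∈ Set.Icc (-n) n ×ˢ Set.Icc (-r) r
  · simp only [Set.indicator_of_mem hzK, norm_sq_trial]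
    rw [hf1 z.1 (abs_le.2 hzK.1), one_pow, one_mul, mul_comm]
    exact mul_le_mul_of_nonpos_right (pow_le_pow_left₀ hδ (hgδ z.2 (abs_le.2 hzK.2)) 2) hz
  · simp only [Set.indicator_of_notMem hzK]
    exact mul_nonpos_of_nonpos_of_nonneg hz (sq_nonneg _)

/-- A purely attractive potential lowers the energy below the ground state energy of the fibers. -/
theorem exists_energy_lt (hw : IsWire S W) (B : ℝ) (U : Lp ℝ ⊤ (stripMeasure S)) (hU : U ≠ 0)
    (hU' : U ≤ 0) : ∃ φ, IsTest S φ ∧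
      energy S W U B φ < groundEnergy S W B * ∫ z in strip S, ‖φ z‖ ^ 2 := by
  have hneg : ∀ᵐ z ∂(stripMeasure S), U z ≤ 0 := by
    filter_upwards [(Lp.coeFn_le U 0).2 hU', Lp.coeFn_zero ℝ ⊤ (stripMeasure S)] with z h1 h2
    rwa [h2] at h1
  obtain ⟨n, r, hr, hκ⟩ := exists_setIntegral_neg hw U hU hneg
  set κ := ∫ z in Set.Icc (-n) n ×ˢ Set.Icc (-r) r, U z ∂(stripMeasure S)
  obtain ⟨r₀, hr₀, -, hlow⟩ := exists_lower_bound hw B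
  -- The lower bound is available only for radii at least `r₀`; both `δ` and `η₀` are fixed before
  -- the cut-off length and the near-minimizer.
  obtain ⟨δ, hδ, η₀, hη₀, hlow⟩ := hlow (max r r₀) (by
    rcases max_choice r r₀ with h | h <;> rw [h] <;> assumption) (le_max_right _ _)
  obtain ⟨A, hA, hcut⟩ := exists_dilated_cutoff
  set γ := -(δ ^ 2 * κ) with hγ
  have hγ0 : 0 < γ := by
    have := mul_neg_of_pos_of_neg (pow_pos hδ 2) hκ
    linarith
  -- The cut-off must equal `1` on `[-n, n]`, and its kinetic cost `A / L` must be at most a quarter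
  -- of the guaranteed gain `γ`.
  set L := |n| + 4 * A / γ with hL
  have hL0 : 0 < L := by positivity
  have hAL : A / L ≤ γ / 4 := by
    have h1 : 4 * A / γ ≤ L := by linarith [abs_nonneg n]
    rw [div_le_iff₀ hγ0] at h1
    rw [div_le_iff₀ hL0]
    linarith
  have hnL : n ≤ L := by
    have : 0 ≤ 4 * A / γ := by positivity
    linarith [le_abs_self n]
  obtain ⟨f, hf, hf1, hf2, hf3⟩ := hcut L hL0
  -- The excess is chosen after `L`, since its cost is multiplied by the mass of the cut-off, at
  -- most `L A`. The total cost is then at most `γ / 2`, less than the gain.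
  set η := min η₀ (γ / (4 * (L * A))) with hη
  have hη0 : 0 < η := by positivity
  have hηL : L * A * η ≤ γ / 4 := by
    calc L * A * η ≤ L * A * (γ / (4 * (L * A))) := by
          gcongr
          exact min_le_right _ _
      _ = γ / 4 := by field_simp
  obtain ⟨p, g, hg⟩ := exists_isNearMin hw B hη0
  have hg' : IsNearMin S W B η₀ p g := ⟨hg.test, hg.nonneg, hg.half_le, hg.le_one,
    hg.form_le.trans (by gcongr; exact min_le_left _ _)⟩
  have hpot := integral_potential_trial_le (p := p) U hneg hf hg.test hδ.le
    (fun x hx => hf1 x (hx.trans hnL))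
    (fun y hy => hlow p g hg' y (hy.trans (le_max_left r r₀)))
  refine ⟨trial p f g, isTest_trial hf hg.test, ?_⟩
  rw [energy_trial hw U hf hg.test, integral_norm_sq_trial hg.test]
  have hf0 : 0 ≤ ∫ x, f x ^ 2 := integral_nonneg fun x => sq_nonneg _
  have hg0 : 0 ≤ ∫ y, g y ^ 2 := integral_nonneg fun y => sq_nonneg _
  have h1 := mul_le_mul_of_nonneg_left hg.form_le hf0
  have h2 : (∫ x, f x ^ 2) * η ≤ γ / 4 := (mul_le_mul_of_nonneg_right hf2 hη0.le).trans hηL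
  have h3 : (∫ x, deriv f x ^ 2) * (∫ y, g y ^ 2) ≤ γ / 4 :=
    (mul_le_mul (hf3.trans hAL) hg.le_one hg0 (by positivity)).trans (mul_one _).le
  linarith

end Trial

end QuantumWire

/-! ### The main theorem. -/

/-- **Bound states of purely attractive perturbations of magnetic quantum wires.** -/
theorem mainTheorem3 (S : Set ℝ) (hS : (∃ a : ℝ, 0 < a ∧ S = Set.Ioo (-a) a) ∨ S = Set.univ)
    (W : ℝ → ℝ) (hWloc : LocallyIntegrableOn W S volume)
    (hW : ∃ c : ℝ, 0 ≤ c ∧ (S = Set.univ → 0 < c) ∧ ∀ y ∈ S, c * y ^ 2 ≤ W y)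
    (U : Lp ℝ ⊤ (QuantumWire.stripMeasure S))
    (hUlim : ∀ ε : ℝ, 0 < ε → ∃ R : ℝ,
      ∀ᵐ z ∂(QuantumWire.stripMeasure S), R ≤ |z.1| → |U z| ≤ ε)
    (hUne : U ≠ 0) (hUneg : U ≤ 0) (B : ℝ) :
    (QuantumWire.discreteSpectrum (QuantumWire.hamiltonian S W U B)).Nonempty := by
  have hw : QuantumWire.IsWire S W := ⟨hS, hWloc, hW⟩
  obtain ⟨φ, hφ, hlt⟩ := QuantumWire.exists_energy_lt hw B U hUne hUneg
  have hn0 : 0 ≤ ∫ z in QuantumWire.strip S, ‖φ z‖ ^ 2 := integral_nonneg fun z => sq_nonneg _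
  set n := ∫ z in QuantumWire.strip S, ‖φ z‖ ^ 2 with hn
  -- The bound modulo averages needs `l` strictly below the ground state energy, so part of the
  -- strict inequality is given up. With `d = (L n - E) / (n + 1)` and `l = L - d`, one has `l n = E
  -- + d > E`; the denominator `n + 1` avoids division by zero.
  obtain ⟨l, hl, hlt'⟩ : ∃ l < QuantumWire.groundEnergy S W B,
      QuantumWire.energy S W U B φ < l * n := by
    set E := QuantumWire.energy S W U B φ
    set L := QuantumWire.groundEnergy S W B
    have hd : 0 < (L * n - E) / (n + 1) := div_pos (sub_pos.2 hlt) (by linarith)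
    have he : (L * n - E) / (n + 1) * (n + 1) = L * n - E := div_mul_cancel₀ _ (by linarith)
    exact ⟨L - (L * n - E) / (n + 1), by linarith, by linarith⟩
  obtain ⟨m, A, c, hA, hA', hc, hbound⟩ :=
    QuantumWire.exists_lower_bound_mod_averages hw U hUlim hl
  exact QuantumWire.discreteSpectrum_nonempty_of_test hw.isOpen hWloc U hA hA' hc hbound
    ⟨φ, hφ, hlt'⟩
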